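/- **Setting.** Let $(M,d_1)$ be a compact connected smooth Riemannian manifold with its Riemannian distance, $(K,d_2)$ a non-empty compact metric space, $\Sigma=M\times K$, and let $0<\zeta\le 1$. For $h:M\to\mathbb R$ put $H_\zeta(h)=\sup_{x\ne y}|h(x)-h(y)|/d_1(x,y)^\zeta$, $|h|_\infty=\sup|h|$, $|h|_\zeta=H_\zeta(h)+|h|_\infty$, and let $H_\zeta=\{h: H_\zeta(h)<\infty\}$; define $H_\zeta(g)$ in the same way for $g:K\to\mathbb R$. *Base map.* Let $f:M\to M$ be a ($C^1$) local diffeomorphism, $\deg(f)=\#f^{-1}(x)$, and let $x\mapsto L(x)$ be a continuous function on $M$ such that every $x\in M$ has a neighbourhood $U_x$ on which $f$ is injective and $d_1(y,z)\le L(x)\,d_1(f(y),f(z))$ for all $y,z\in U_x$. Let $m_1$ be an $f$-invariant Borel probability on $M$ with respect to which $f$ has Jacobian $1/\rho$, $\rho:M\to(0,\infty)$, that is, $m_1(f(E))=\int_E\rho^{-1}dm_1$ for every Borel set $E$ on which $f$ is injective. Assume that there are an open set $\mathcal A\subset M$, $\sigma>1$, $1\le L\le 2$, $\epsilon_\rho>0$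 and an integer $0\le q<\deg(f)$ such that * (f1) $L(x)\le L$ for $x\in\mathcal A$ and $L(x)<\sigma^{-1}$ for $x\notin\mathcal A$; * (f2) $M$ has a finite cover by open sets on which $f$ is injective, $q$ of which cover $\mathcal A$; * (f3) $\sup\log\rho-\inf\log\rho<\epsilon_\rho$ and $H_\zeta(\rho)<\epsilon_\rho\inf\rho$; * $\displaystyle e^{\epsilon_\rho}\,\frac{(\deg(f)-q)\sigma^{-\zeta}+qL^\zeta[1+(L-1)^\zeta]}{\deg(f)}<1.$ *Skew product.* Let $F(x,z)=(f(x),G(x,z))$ with $G:\Sigma\to K$ measurable satisfying * (G1) there is $0<\alpha<1$ such that for $m_1$-a.e. $x$, $d_2(G(x,z_1),G(x,z_2))\le\alpha\,d_2(z_1,z_2)$ for all $z_1,z_2\in K$. *Spaces.* For a finite positive Borel measure $\mu$ on $\Sigma$ whose marginal on $M$ is $\phi\, m_1$, with disintegration $(\mu_x)_{x\in M}$ into probabilities on the fibres $\{x\}\times K\cong K$, put $\mu|_x=\phi(x)\mu_x$, a measure on $K$. For a signed Borel measure $\mu=\mu^+-\mu^-$ (Jordan decomposition) on $\Sigma$ such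 that the marginals $\phi^\pm m_1$ of $\mu^\pm$ are absolutely continuous, put $\phi_\mu=\phi^+-\phi^-$ and $$\|\mu\|_\infty=\operatorname*{ess\,sup}_{x,\,m_1}\ \sup\Big\{\Big|\int g\,d\mu^+|_x-\int g\,d\mu^-|_x\Big| : H_\zeta(g)\le1,\ |g|_\infty\le1\Big\}.$$ Let $S^\infty$ be the vector space of all such $\mu$ with $\|\mu\|_\infty<\infty$ whose marginal density $\phi_\mu$ agrees $m_1$-a.e. with a function in $H_\zeta$, with norm $\|\mu\|_{S^\infty}=|\phi_\mu|_\zeta+\|\mu\|_\infty$, where $|\phi_\mu|_\zeta$ is the infimum of $|h|_\zeta$ over the versions $h\in H_\zeta$ of $\phi_\mu$ (the version is unique if $m_1$ has full support). Let $F_*\mu=\mu\circ F^{-1}$. **Theorem B (spectral gap on $S^\infty$).** Under these assumptions $F_*$ maps $S^\infty$ into itself and there are linear operators $P,N:S^\infty\to S^\infty$ with $F_*=P+N$ such that * (a) $P$ is bounded, $P^2=P$ and $\dim P(S^\infty)=1$; * (b) there are $0<\xi<1$ and $C>0$ with $\|N^n\mu\|_{S^\infty}\le C\,\xi^n\|\mu\|_{S^\infty}$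 for all $\mu\in S^\infty$ and $n\ge0$; * (c) $PN=NP=0$. Moreover, the rate is explicit. Let $P_f\varphi(x)=\sum_{f(y)=x}\varphi(y)\rho(y)$. There are $0<\lambda<1$ and $B,C'>0$ with $$|P_f^n g|_\zeta\le B\lambda^n|g|_\zeta+C'|g|_\infty\quad(g\in H_\zeta,\ n\ge1),\tag{1}$$ and there are $0<r<1$ and $D>0$ with $$|P_f^n\varphi|_\zeta\le Dr^n|\varphi|_\zeta\quad(\varphi\in H_\zeta,\ \textstyle\int\varphi\,dm_1=0,\ n\ge1).\tag{2}$$ For every $r\in(0,1)$ for which (2) holds with some $D$, the number $\beta_1=\max\{\sqrt r,\sqrt{\alpha^\zeta}\}$ is a rate of convergence to equilibrium, meaning that there is $D_2$ with $$\|F_*^n\mu\|_\infty\le D_2\beta_1^n\|\mu\|_{S^\infty}\quad(\mu\in S^\infty,\ \mu(\Sigma)=0,\ n\ge1).\tag{3}$$ Finally, for all $\lambda,\beta_1\in(0,1)$ for which (1) and (3) hold with some constants, (b) holds with $\xi=\max\{\sqrt\lambda,\sqrt{\beta_1}\}$ (and a suitable $C$). -/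

import Mathlib

open MeasureTheory Set Filter Topology Bundle
open scoped NNReal ENNReal Manifold ContDiff

noncomputable section

section Base

variable {M : Type*}

/-- The number of preimages under `f` (for a covering map of a connected space all fibres have the
same cardinality, so the infimum is the common value). -/
def mapDegree (f : M → M) : ℕ := ⨅ x, (f ⁻¹' {x}).ncard

/-- `f` is locally invertible around every `x`, with inverse branch `Lf x`-Lipschitz. -/
def LocalInverseLipschitz [MetricSpace M] (f : M → M) (Lf : M → ℝ) : Prop :=
  ∀ x, ∃ U ∈ 𝓝 x, InjOn f U ∧ ∀ y ∈ U, ∀ z ∈ U, dist y z ≤ Lf x * dist (f y) (f z)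

/-- Condition (f1): at most weak contraction on `A`, expansion by more than `σ` off `A`. -/
def CondF1 (Lf : M → ℝ) (A : Set M) (σ L : ℝ) : Prop :=
  (∀ x ∈ A, Lf x ≤ L) ∧ ∀ x ∉ A, Lf x < σ⁻¹

/-- Condition (f2): `M` has a finite cover by open domains of injectivity of `f`, `q < deg f` of
which cover `A`. -/
def CondF2 [TopologicalSpace M] (f : M → M) (A : Set M) (q : ℕ) : Prop :=
  q < mapDegree f ∧ ∃ 𝒰 : Finset (Set M), (∀ U ∈ 𝒰, IsOpen U ∧ InjOn f U) ∧
    (⋃ U ∈ 𝒰, U) = univ ∧ ∃ 𝒱 ⊆ 𝒰, 𝒱.card = q ∧ A ⊆ ⋃ U ∈ 𝒱, U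

/-- Condition (f3): `ρ` has small oscillation and lies in a small cone of Hölder functions. -/
def CondF3 [MetricSpace M] (ζ : ℝ≥0) (ρ : M → ℝ) (ε : ℝ) : Prop :=
  (⨆ x, Real.log (ρ x)) - (⨅ x, Real.log (ρ x)) < ε ∧
    MemHolder ζ ρ ∧ (nnHolderNorm ζ ρ : ℝ) < ε * ⨅ x, ρ x

/-- The smallness condition relating `ε`, `L`, `σ`, `q` and the degree `d`. -/
def SmallnessCond (ζ : ℝ≥0) (d q : ℕ) (σ L ε : ℝ) : Prop :=
  Real.exp ε * ((((d : ℝ) - q) * σ ^ (-(ζ : ℝ)) +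
    q * L ^ (ζ : ℝ) * (1 + (L - 1) ^ (ζ : ℝ))) / d) < 1

/-- `J` is a Jacobian of `f` with respect to `m`. -/
def HasJacobian [MeasurableSpace M] (f : M → M) (m : Measure M) (J : M → ℝ) : Prop :=
  ∀ A, MeasurableSet A → InjOn f A → m (f '' A) = ∫⁻ x in A, ENNReal.ofReal (J x) ∂m

/-- The Perron–Frobenius operator `φ ↦ ∑_{f y = x} φ(y) ρ(y)`. -/
def perronFrobenius (f : M → M) (ρ : M → ℝ) (φ : M → ℝ) : M → ℝ :=
  fun x => ∑ᶠ y ∈ f ⁻¹' {x}, φ y * ρ y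

/-- The uniform norm `|h|_∞`. -/
def supNorm (h : M → ℝ) : ℝ := ⨆ x, |h x|

/-- The Hölder norm `|h|_ζ = H_ζ(h) + |h|_∞`. -/
def holderNorm [MetricSpace M] (ζ : ℝ≥0) (h : M → ℝ) : ℝ := nnHolderNorm ζ h + supNorm h

/-- `r` is an exponential rate at which the Perron–Frobenius operator contracts the zero-average
Hölder functions. -/
def IsBaseDecayRate [MetricSpace M] [MeasurableSpace M] (ζ : ℝ≥0) (m : Measure M) (f : M → M)
    (ρ : M → ℝ) (r : ℝ) : Prop :=
  ∃ D : ℝ, 0 < D ∧ ∀ φ : M → ℝ, MemHolder ζ φ → ∫ x, φ x ∂m = 0 → ∀ n ≥ 1,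
    holderNorm ζ ((perronFrobenius f ρ)^[n] φ) ≤ D * r ^ n * holderNorm ζ φ

/-- `lam` is the rate in a Lasota–Yorke inequality for the iterates of the Perron–Frobenius
operator. -/
def IsBaseLasotaYorkeRate [MetricSpace M] (ζ : ℝ≥0) (f : M → M) (ρ : M → ℝ) (lam : ℝ) : Prop :=
  ∃ B C : ℝ, 0 < B ∧ 0 < C ∧ ∀ g : M → ℝ, MemHolder ζ g → ∀ n ≥ 1,
    holderNorm ζ ((perronFrobenius f ρ)^[n] g) ≤ B * lam ^ n * holderNorm ζ g + C * supNorm g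

end Base

section Spaces

variable {M K : Type*} [MeasurableSpace M] [MeasurableSpace K]

/-- The skew product `F(x,z) = (f x, G(x,z))`. -/
def skewProduct (f : M → M) (G : M × K → K) : M × K → M × K := fun p => (f p.1, G p)

/-- The restriction `μ|_x`, a measure on `K`, of a positive finite measure `μ` on `M × K` to the
fibre `{x} × K`: the conditional probability on the fibre, times the marginal density. -/
def leafMeasure [StandardBorelSpace K] [Nonempty K] (m : Measure M) (μ : Measure (M × K))
    [IsFiniteMeasure μ] (x : M) : Measure K :=
  μ.fst.rnDeriv m x • μ.condKernel x

/-- The signed measures whose positive and negative parts have absolutely continuous marginals. -/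
def MemAB (m : Measure M) (s : SignedMeasure (M × K)) : Prop :=
  s.toJordanDecomposition.posPart.fst ≪ m ∧ s.toJordanDecomposition.negPart.fst ≪ m

/-- The marginal density `φ_x = φ_x⁺ - φ_x⁻` of a signed measure. -/
def marginalDensity (m : Measure M) (s : SignedMeasure (M × K)) (x : M) : ℝ :=
  (s.toJordanDecomposition.posPart.fst.rnDeriv m x).toReal -
    (s.toJordanDecomposition.negPart.fst.rnDeriv m x).toReal

/-- The Wasserstein–Kantorovich-like distance
`sup {|∫ g dμ - ∫ g dν| : H_ζ(g) ≤ 1, |g|_∞ ≤ 1}` (continuity of `g` is automatic for `ζ > 0`). -/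
def wassersteinHolder [MetricSpace K] (ζ : ℝ≥0) (μ ν : Measure K) : ℝ≥0∞ :=
  ⨆ (g : K → ℝ) (_ : Continuous g ∧ HolderWith 1 ζ g ∧ ∀ z, |g z| ≤ 1),
    ENNReal.ofReal |∫ z, g z ∂μ - ∫ z, g z ∂ν|

/-- The fibrewise norm `W(μ⁺|_x, μ⁻|_x)`. -/
def leafNorm [MetricSpace K] [StandardBorelSpace K] [Nonempty K] (ζ : ℝ≥0) (m : Measure M)
    (s : SignedMeasure (M × K)) (x : M) : ℝ≥0∞ :=
  wassersteinHolder ζ (leafMeasure m s.toJordanDecomposition.posPart x)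
    (leafMeasure m s.toJordanDecomposition.negPart x)

/-- The `𝓛^∞` norm, as an extended number. -/
def eLInftyNorm [MetricSpace K] [StandardBorelSpace K] [Nonempty K] (ζ : ℝ≥0) (m : Measure M)
    (s : SignedMeasure (M × K)) : ℝ≥0∞ := essSup (leafNorm ζ m s) m

/-- The `𝓛^∞` norm. -/
def lInftyNorm [MetricSpace K] [StandardBorelSpace K] [Nonempty K] (ζ : ℝ≥0) (m : Measure M)
    (s : SignedMeasure (M × K)) : ℝ := (eLInftyNorm ζ m s).toReal

/-- The Hölder norm of an almost everywhere defined function, that is the infimum of the norms of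
its Hölder versions. (There is only one version if `m` charges every nonempty open set.) -/
def aeHolderNorm [MetricSpace M] (ζ : ℝ≥0) (m : Measure M) (φ : M → ℝ) : ℝ :=
  sInf {c | ∃ h : M → ℝ, MemHolder ζ h ∧ φ =ᵐ[m] h ∧ c = holderNorm ζ h}

end Spaces

section Submodule

variable {M K : Type*} [MeasurableSpace M] [MeasurableSpace K] [StandardBorelSpace K] [Nonempty K]

lemma measurable_leafMeasure (m : Measure M) (μ : Measure (M × K)) [IsFiniteMeasure μ] {B : Set K}
    (hB : MeasurableSet B) : Measurable fun x => leafMeasure m μ x B := by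
  simp only [leafMeasure, Measure.smul_apply, smul_eq_mul]
  exact (Measure.measurable_rnDeriv _ _).mul (ProbabilityTheory.Kernel.measurable_coe _ hB)

lemma setLIntegral_leafMeasure (m : Measure M) [IsFiniteMeasure m] (μ : Measure (M × K))
    [IsFiniteMeasure μ] (hμ : μ.fst ≪ m) {A : Set M} (hA : MeasurableSet A) {B : Set K}
    (hB : MeasurableSet B) : ∫⁻ x in A, leafMeasure m μ x B ∂m = μ (A ×ˢ B) := by
  have h1 := setLIntegral_withDensity_eq_setLIntegral_mul m (Measure.measurable_rnDeriv μ.fst m)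
    (ProbabilityTheory.Kernel.measurable_coe μ.condKernel hB) hA
  rw [Measure.withDensity_rnDeriv_eq _ _ hμ] at h1
  have h2 := Measure.compProd_apply_prod (μ := μ.fst) (κ := μ.condKernel) hA hB
  rw [Measure.disintegrate] at h2
  rw [h2, h1]
  rfl

lemma leafMeasure_univ (m : Measure M) (μ : Measure (M × K)) [IsFiniteMeasure μ] (x : M) :
    leafMeasure m μ x univ = μ.fst.rnDeriv m x := by
  simp [leafMeasure]

lemma ae_isFiniteMeasure_leafMeasure (m : Measure M) (μ : Measure (M × K)) [IsFiniteMeasure μ] :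
    ∀ᵐ x ∂m, IsFiniteMeasure (leafMeasure m μ x) := by
  filter_upwards [Measure.rnDeriv_lt_top μ.fst m] with x hx
  exact ⟨by rwa [leafMeasure_univ]⟩

lemma leafMeasure_ae_eq (m : Measure M) [IsFiniteMeasure m] (μ : Measure (M × K))
    [IsFiniteMeasure μ] (hμ : μ.fst ≪ m) (κ : M → Measure K)
    (hκ : ∀ B, MeasurableSet B → Measurable fun x => κ x B)
    (h : ∀ A B, MeasurableSet A → MeasurableSet B → ∫⁻ x in A, κ x B ∂m = μ (A ×ˢ B)) :
    ∀ᵐ x ∂m, leafMeasure m μ x = κ x := by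
  let S := MeasurableSpace.countableGeneratingSet K
  let C : Set (Set K) := sInter '' {t | t.Finite ∧ t ⊆ S}
  have hCc : C.Countable :=
    (Set.countable_ofPred_finite_subset MeasurableSpace.countable_countableGeneratingSet).image _
  have hSm : ∀ s ∈ S, MeasurableSet s := fun s hs =>
    MeasurableSpace.measurableSet_countableGeneratingSet hs
  have hCm : ∀ s ∈ C, MeasurableSet s := by
    rintro _ ⟨t, ⟨ht, hts⟩, rfl⟩
    exact MeasurableSet.sInter ht.countable fun s hs => hSm s (hts hs)
  have hpi : IsPiSystem C := by
    rintro _ ⟨t, ⟨ht, hts⟩, rfl⟩ _ ⟨u, ⟨hu, hus⟩, rfl⟩ -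
    exact ⟨t ∪ u, ⟨ht.union hu, union_subset hts hus⟩, sInter_union t u⟩
  have hgen : ‹MeasurableSpace K› = MeasurableSpace.generateFrom C := by
    apply le_antisymm
    · rw [← MeasurableSpace.generateFrom_countableGeneratingSet (α := K)]
      refine MeasurableSpace.generateFrom_mono fun s hs => ?_
      exact ⟨{s}, ⟨finite_singleton s, by simpa using hs⟩, sInter_singleton s⟩
    · exact MeasurableSpace.generateFrom_le hCm
  have hae : ∀ᵐ x ∂m, ∀ s ∈ C, leafMeasure m μ x s = κ x s := by
    rw [ae_ball_iff hCc]
    intro s hs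
    refine ae_eq_of_forall_setLIntegral_eq_of_sigmaFinite
      (measurable_leafMeasure m μ (hCm s hs)) (hκ s (hCm s hs)) fun A hA _ => ?_
    rw [setLIntegral_leafMeasure m μ hμ hA (hCm s hs), h A s hA (hCm s hs)]
  filter_upwards [hae, ae_isFiniteMeasure_leafMeasure m μ] with x hx hfin
  refine ext_of_generate_finite C hgen hpi hx (hx univ ⟨∅, ⟨finite_empty, empty_subset _⟩, ?_⟩)
  exact sInter_empty

lemma leafMeasure_add (m : Measure M) [IsFiniteMeasure m] (μ ν : Measure (M × K))
    [IsFiniteMeasure μ] [IsFiniteMeasure ν] (hμ : μ.fst ≪ m) (hν : ν.fst ≪ m) :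
    ∀ᵐ x ∂m, leafMeasure m (μ + ν) x = leafMeasure m μ x + leafMeasure m ν x := by
  refine leafMeasure_ae_eq m (μ + ν) (by rw [Measure.fst_add]; exact hμ.add_left hν) _
    (fun B hB => ?_) fun A B hA hB => ?_
  · simp only [Measure.add_apply]
    exact (measurable_leafMeasure m μ hB).add (measurable_leafMeasure m ν hB)
  · simp only [Measure.add_apply]
    rw [lintegral_add_left (measurable_leafMeasure m μ hB), setLIntegral_leafMeasure m μ hμ hA hB,
      setLIntegral_leafMeasure m ν hν hA hB]

lemma fst_smul_absolutelyContinuous {M K : Type*} [MeasurableSpace M] [MeasurableSpace K]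
    {m : Measure M} {μ : Measure (M × K)} (hμ : μ.fst ≪ m)
    (c : ℝ≥0) : (c • μ).fst ≪ m := by
  intro A hA
  have := hμ hA
  have h : (c • μ).fst = c • μ.fst := by simp [Measure.fst, Measure.map_smul]
  rw [h]
  simp [this]

lemma leafMeasure_smul (m : Measure M) [IsFiniteMeasure m] (μ : Measure (M × K))
    [IsFiniteMeasure μ] (hμ : μ.fst ≪ m) (c : ℝ≥0) :
    ∀ᵐ x ∂m, leafMeasure m (c • μ) x = c • leafMeasure m μ x := by
  refine leafMeasure_ae_eq m (c • μ) (fst_smul_absolutelyContinuous hμ c) _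
    (fun B hB => ?_) fun A B hA hB => ?_
  · simp only [Measure.smul_apply]
    exact (measurable_leafMeasure m μ hB).const_smul c
  · simp only [Measure.smul_apply, ENNReal.smul_def, smul_eq_mul]
    rw [lintegral_const_mul _ (measurable_leafMeasure m μ hB), setLIntegral_leafMeasure m μ hμ hA hB]

lemma posPart_le_of_eq_sub {α : Type*} [MeasurableSpace α] (s : SignedMeasure α) (μ ν : Measure α)
    [IsFiniteMeasure μ] [IsFiniteMeasure ν] (h : s = μ.toSignedMeasure - ν.toSignedMeasure) :
    s.toJordanDecomposition.posPart ≤ μ := by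
  obtain ⟨i, hi, hi2, hi3, hpos, -⟩ := s.toJordanDecomposition_spec
  refine Measure.le_iff.2 fun E hE => ?_
  have h1 : (s.toJordanDecomposition.posPart).real E ≤ μ.real E := by
    rw [hpos, SignedMeasure.toMeasureOfZeroLE_real_apply s hi2 hi hE, h,
      Measure.toSignedMeasure_sub_apply (hi.inter hE)]
    have h2 : μ.real (i ∩ E) ≤ μ.real E := measureReal_mono inter_subset_right
    have h3 : 0 ≤ ν.real (i ∩ E) := measureReal_nonneg
    linarith
  exact (ENNReal.toReal_le_toReal (measure_ne_top _ _) (measure_ne_top _ _)).1 h1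

lemma posPart_add_eq_of_eq_sub {α : Type*} [MeasurableSpace α] (s : SignedMeasure α)
    (μ ν : Measure α) [IsFiniteMeasure μ] [IsFiniteMeasure ν]
    (h : s = μ.toSignedMeasure - ν.toSignedMeasure) :
    s.toJordanDecomposition.posPart + ν = s.toJordanDecomposition.negPart + μ := by
  have h1 := s.toSignedMeasure_toJordanDecomposition
  rw [JordanDecomposition.toSignedMeasure] at h1
  rw [← Measure.toSignedMeasure_eq_toSignedMeasure_iff, Measure.toSignedMeasure_add,
    Measure.toSignedMeasure_add]
  rw [h] at h1 ⊢
  rw [sub_eq_sub_iff_add_eq_add] at h1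
  rw [h1, add_comm]

lemma memAB_of_eq_sub {M K : Type*} [MeasurableSpace M] [MeasurableSpace K]
    {m : Measure M} (s : SignedMeasure (M × K)) (μ ν : Measure (M × K))
    [IsFiniteMeasure μ] [IsFiniteMeasure ν] (hμ : μ.fst ≪ m) (hν : ν.fst ≪ m)
    (h : s = μ.toSignedMeasure - ν.toSignedMeasure) : MemAB m s := by
  have hpos := posPart_le_of_eq_sub s μ ν h
  have hneg : s.toJordanDecomposition.negPart ≤ ν := by
    have := posPart_le_of_eq_sub (-s) ν μ (by rw [h, neg_sub])
    simpa [SignedMeasure.toJordanDecomposition_neg] using this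
  exact ⟨(Measure.absolutelyContinuous_of_le (Measure.fst_mono hpos)).trans hμ,
    (Measure.absolutelyContinuous_of_le (Measure.fst_mono hneg)).trans hν⟩

/-- The fibre restriction of a signed measure does not depend on the way it is written as a
difference of positive measures. -/
lemma leafMeasure_of_eq_sub (m : Measure M) [IsFiniteMeasure m] (s : SignedMeasure (M × K))
    (μ ν : Measure (M × K)) [IsFiniteMeasure μ] [IsFiniteMeasure ν] (hμ : μ.fst ≪ m)
    (hν : ν.fst ≪ m) (h : s = μ.toSignedMeasure - ν.toSignedMeasure) :
    ∀ᵐ x ∂m, leafMeasure m s.toJordanDecomposition.posPart x + leafMeasure m ν x =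
      leafMeasure m s.toJordanDecomposition.negPart x + leafMeasure m μ x := by
  obtain ⟨hp, hn⟩ := memAB_of_eq_sub s μ ν hμ hν h
  have key := posPart_add_eq_of_eq_sub s μ ν h
  have h1 := leafMeasure_add m _ ν hp hν
  have h2 := leafMeasure_add m _ μ hn hμ
  filter_upwards [h1, h2] with x hx1 hx2
  rw [← hx1, ← hx2]
  congr 1

lemma marginalDensity_of_eq_sub (m : Measure M) [IsFiniteMeasure m] (s : SignedMeasure (M × K))
    (μ ν : Measure (M × K)) [IsFiniteMeasure μ] [IsFiniteMeasure ν] (hμ : μ.fst ≪ m)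
    (hν : ν.fst ≪ m) (h : s = μ.toSignedMeasure - ν.toSignedMeasure) :
    ∀ᵐ x ∂m, marginalDensity m s x =
      (leafMeasure m μ x univ).toReal - (leafMeasure m ν x univ).toReal := by
  filter_upwards [leafMeasure_of_eq_sub m s μ ν hμ hν h, ae_isFiniteMeasure_leafMeasure m μ,
    ae_isFiniteMeasure_leafMeasure m ν,
    ae_isFiniteMeasure_leafMeasure m s.toJordanDecomposition.posPart,
    ae_isFiniteMeasure_leafMeasure m s.toJordanDecomposition.negPart] with x hx h1 h2 h3 h4
  have := congrArg (fun κ : Measure K => (κ univ).toReal) hx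
  simp only [Measure.add_apply] at this
  rw [ENNReal.toReal_add (measure_ne_top _ _) (measure_ne_top _ _),
    ENNReal.toReal_add (measure_ne_top _ _) (measure_ne_top _ _)] at this
  rw [marginalDensity, ← leafMeasure_univ, ← leafMeasure_univ]
  linarith

lemma integrable_of_test {X : Type*} [MetricSpace X] [MeasurableSpace X] [BorelSpace X] {g : X → ℝ}
    (hg : Continuous g) (hb : ∀ z, |g z| ≤ 1) (μ : Measure X) [IsFiniteMeasure μ] :
    Integrable g μ :=
  Integrable.of_bound hg.measurable.aestronglyMeasurable 1 (Eventually.of_forall hb)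

lemma wassersteinHolder_congr {X : Type*} [MetricSpace X] [MeasurableSpace X] [BorelSpace X]
    {ζ : ℝ≥0} {a b μ ν : Measure X} [IsFiniteMeasure a] [IsFiniteMeasure b] [IsFiniteMeasure μ]
    [IsFiniteMeasure ν] (h : a + ν = b + μ) :
    wassersteinHolder ζ a b = wassersteinHolder ζ μ ν := by
  unfold wassersteinHolder
  refine iSup_congr fun g => iSup_congr fun hg => ?_
  have hI : ∀ (κ : Measure X) [IsFiniteMeasure κ], Integrable g κ := fun κ _ =>
    integrable_of_test hg.1 hg.2.2 κ
  have : ∫ z, g z ∂(a + ν) = ∫ z, g z ∂(b + μ) := by rw [h]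
  rw [integral_add_measure (hI _) (hI _), integral_add_measure (hI _) (hI _)] at this
  congr 2
  linarith

lemma wassersteinHolder_add_le {X : Type*} [MetricSpace X] [MeasurableSpace X] [BorelSpace X]
    {ζ : ℝ≥0} (a b μ ν : Measure X) [IsFiniteMeasure a] [IsFiniteMeasure b] [IsFiniteMeasure μ]
    [IsFiniteMeasure ν] : wassersteinHolder ζ (a + μ) (b + ν) ≤
      wassersteinHolder ζ a b + wassersteinHolder ζ μ ν := by
  refine iSup₂_le fun g hg => ?_
  have hI : ∀ (κ : Measure X) [IsFiniteMeasure κ], Integrable g κ := fun κ _ =>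
    integrable_of_test hg.1 hg.2.2 κ
  rw [integral_add_measure (hI _) (hI _), integral_add_measure (hI _) (hI _)]
  refine le_trans ?_ (add_le_add
    (le_iSup₂_of_le (f := fun (g : X → ℝ) (_ : Continuous g ∧ HolderWith 1 ζ g ∧ ∀ z, |g z| ≤ 1) =>
      ENNReal.ofReal |∫ z, g z ∂a - ∫ z, g z ∂b|) g hg le_rfl)
    (le_iSup₂_of_le (f := fun (g : X → ℝ) (_ : Continuous g ∧ HolderWith 1 ζ g ∧ ∀ z, |g z| ≤ 1) =>
      ENNReal.ofReal |∫ z, g z ∂μ - ∫ z, g z ∂ν|) g hg le_rfl))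
  rw [← ENNReal.ofReal_add (abs_nonneg _) (abs_nonneg _)]
  refine ENNReal.ofReal_le_ofReal (le_trans (le_of_eq ?_) (abs_add_le _ _))
  congr 1
  ring

lemma wassersteinHolder_smul_le {X : Type*} [MetricSpace X] [MeasurableSpace X]
    {ζ : ℝ≥0} (c : ℝ≥0) (μ ν : Measure X) :
    wassersteinHolder ζ (c • μ) (c • ν) ≤ c * wassersteinHolder ζ μ ν := by
  refine iSup₂_le fun g hg => ?_
  refine le_trans (le_of_eq ?_) (mul_le_mul_right (le_iSup₂_of_le
    (f := fun (g : X → ℝ) (_ : Continuous g ∧ HolderWith 1 ζ g ∧ ∀ z, |g z| ≤ 1) =>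
      ENNReal.ofReal |∫ z, g z ∂μ - ∫ z, g z ∂ν|) g hg le_rfl) _)
  rw [integral_smul_nnreal_measure, integral_smul_nnreal_measure, ← smul_sub, NNReal.smul_def,
    smul_eq_mul, abs_mul, NNReal.abs_eq, ENNReal.ofReal_mul c.coe_nonneg, ENNReal.ofReal_coe_nnreal]

lemma wassersteinHolder_comm {X : Type*} [MetricSpace X] [MeasurableSpace X]
    {ζ : ℝ≥0} (μ ν : Measure X) : wassersteinHolder ζ μ ν = wassersteinHolder ζ ν μ := by
  unfold wassersteinHolder
  simp_rw [abs_sub_comm]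

lemma leafNorm_of_eq_sub [MetricSpace K] [BorelSpace K] {ζ : ℝ≥0} (m : Measure M)
    [IsFiniteMeasure m] (s : SignedMeasure (M × K))
    (μ ν : Measure (M × K)) [IsFiniteMeasure μ] [IsFiniteMeasure ν] (hμ : μ.fst ≪ m)
    (hν : ν.fst ≪ m) (h : s = μ.toSignedMeasure - ν.toSignedMeasure) :
    ∀ᵐ x ∂m, leafNorm ζ m s x = wassersteinHolder ζ (leafMeasure m μ x) (leafMeasure m ν x) := by
  filter_upwards [leafMeasure_of_eq_sub m s μ ν hμ hν h, ae_isFiniteMeasure_leafMeasure m μ,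
    ae_isFiniteMeasure_leafMeasure m ν,
    ae_isFiniteMeasure_leafMeasure m s.toJordanDecomposition.posPart,
    ae_isFiniteMeasure_leafMeasure m s.toJordanDecomposition.negPart] with x hx h1 h2 h3 h4
  exact wassersteinHolder_congr hx

/-- Membership in `S^∞`: absolutely continuous marginals, finite `𝓛^∞` norm, and a Hölder marginal
density. -/
def MemSInfty [MetricSpace M] [MetricSpace K] (ζ : ℝ≥0) (m : Measure M)
    (s : SignedMeasure (M × K)) : Prop :=
  MemAB m s ∧ eLInftyNorm ζ m s < ⊤ ∧ ∃ h : M → ℝ, MemHolder ζ h ∧ marginalDensity m s =ᵐ[m] h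

lemma eq_posPart_sub_negPart {α : Type*} [MeasurableSpace α] (s : SignedMeasure α) :
    s = s.toJordanDecomposition.posPart.toSignedMeasure -
      s.toJordanDecomposition.negPart.toSignedMeasure :=
  s.toSignedMeasure_toJordanDecomposition.symm

lemma MemSInfty.zero [MetricSpace M] [MetricSpace K] (ζ : ℝ≥0) (m : Measure M) :
    MemSInfty ζ m (0 : SignedMeasure (M × K)) := by
  refine ⟨?_, ?_, 0, ⟨0, HolderWith.zero⟩, ?_⟩
  · simp [MemAB, SignedMeasure.toJordanDecomposition_zero, Measure.AbsolutelyContinuous.zero]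
  · refine lt_of_le_of_lt (essSup_le_of_ae_le 0 (Eventually.of_forall fun x => ?_)) ENNReal.zero_lt_top
    simp [leafNorm, SignedMeasure.toJordanDecomposition_zero, wassersteinHolder]
  · refine Eventually.of_forall fun x => ?_
    simp [marginalDensity, SignedMeasure.toJordanDecomposition_zero]

lemma MemSInfty.add [MetricSpace M] [MetricSpace K] [BorelSpace K] {ζ : ℝ≥0} {m : Measure M}
    [IsFiniteMeasure m] {s t : SignedMeasure (M × K)} (hs : MemSInfty ζ m s)
    (ht : MemSInfty ζ m t) : MemSInfty ζ m (s + t) := by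
  obtain ⟨⟨hs1, hs2⟩, hs3, g, hg, hgs⟩ := hs
  obtain ⟨⟨ht1, ht2⟩, ht3, k, hk, hkt⟩ := ht
  have hp : (s.toJordanDecomposition.posPart + t.toJordanDecomposition.posPart).fst ≪ m := by
    rw [Measure.fst_add]; exact hs1.add_left ht1
  have hn : (s.toJordanDecomposition.negPart + t.toJordanDecomposition.negPart).fst ≪ m := by
    rw [Measure.fst_add]; exact hs2.add_left ht2
  have hst : s + t =
      (s.toJordanDecomposition.posPart + t.toJordanDecomposition.posPart).toSignedMeasure -
      (s.toJordanDecomposition.negPart + t.toJordanDecomposition.negPart).toSignedMeasure := by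
    rw [Measure.toSignedMeasure_add, Measure.toSignedMeasure_add]
    nth_rewrite 1 [eq_posPart_sub_negPart s, eq_posPart_sub_negPart t]
    abel
  have hap := leafMeasure_add m _ _ hs1 ht1
  have han := leafMeasure_add m _ _ hs2 ht2
  refine ⟨memAB_of_eq_sub _ _ _ hp hn hst, ?_, g + k, hg.add hk, ?_⟩
  · refine lt_of_le_of_lt (essSup_le_of_ae_le (eLInftyNorm ζ m s + eLInftyNorm ζ m t) ?_)
      (ENNReal.add_lt_top.2 ⟨hs3, ht3⟩)
    filter_upwards [leafNorm_of_eq_sub (ζ := ζ) m _ _ _ hp hn hst, hap, han,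
      ENNReal.ae_le_essSup (μ := m) (leafNorm ζ m s), ENNReal.ae_le_essSup (μ := m) (leafNorm ζ m t),
      ae_isFiniteMeasure_leafMeasure m s.toJordanDecomposition.posPart,
      ae_isFiniteMeasure_leafMeasure m s.toJordanDecomposition.negPart,
      ae_isFiniteMeasure_leafMeasure m t.toJordanDecomposition.posPart,
      ae_isFiniteMeasure_leafMeasure m t.toJordanDecomposition.negPart]
      with x hx h1 h2 h3 h4 h5 h6 h7 h8
    rw [hx, h1, h2]
    exact (wassersteinHolder_add_le _ _ _ _).trans (add_le_add h3 h4)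
  · filter_upwards [marginalDensity_of_eq_sub m _ _ _ hp hn hst, hap, han, hgs, hkt,
      ae_isFiniteMeasure_leafMeasure m s.toJordanDecomposition.posPart,
      ae_isFiniteMeasure_leafMeasure m s.toJordanDecomposition.negPart,
      ae_isFiniteMeasure_leafMeasure m t.toJordanDecomposition.posPart,
      ae_isFiniteMeasure_leafMeasure m t.toJordanDecomposition.negPart]
      with x hx h1 h2 h3 h4 h5 h6 h7 h8
    rw [hx, h1, h2, Pi.add_apply, ← h3, ← h4, Measure.add_apply, Measure.add_apply,
      ENNReal.toReal_add (measure_ne_top _ _) (measure_ne_top _ _),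
      ENNReal.toReal_add (measure_ne_top _ _) (measure_ne_top _ _)]
    simp only [marginalDensity, leafMeasure_univ]
    ring

lemma MemSInfty.nnreal_smul [MetricSpace M] [MetricSpace K] [BorelSpace K] {ζ : ℝ≥0}
    {m : Measure M} [IsFiniteMeasure m] {s : SignedMeasure (M × K)} (hs : MemSInfty ζ m s)
    (c : ℝ≥0) : MemSInfty ζ m ((c : ℝ) • s) := by
  obtain ⟨⟨hs1, hs2⟩, hs3, g, hg, hgs⟩ := hs
  have hp := fst_smul_absolutelyContinuous hs1 c
  have hn := fst_smul_absolutelyContinuous hs2 c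
  have hst : (c : ℝ) • s = (c • s.toJordanDecomposition.posPart).toSignedMeasure -
      (c • s.toJordanDecomposition.negPart).toSignedMeasure := by
    ext i hi
    have h1 := congrArg (fun v : SignedMeasure (M × K) => v i) (eq_posPart_sub_negPart s)
    simp only [Measure.toSignedMeasure_sub_apply hi] at h1
    rw [Measure.toSignedMeasure_sub_apply hi, _root_.smul_apply, h1]
    simp [mul_sub]
  have hap := leafMeasure_smul m _ hs1 c
  have han := leafMeasure_smul m _ hs2 c
  refine ⟨memAB_of_eq_sub _ _ _ hp hn hst, ?_, (c : ℝ) • g, hg.smul, ?_⟩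
  · refine lt_of_le_of_lt (essSup_le_of_ae_le (c * eLInftyNorm ζ m s) ?_)
      (ENNReal.mul_lt_top ENNReal.coe_lt_top hs3)
    filter_upwards [leafNorm_of_eq_sub (ζ := ζ) m _ _ _ hp hn hst, hap, han,
      ENNReal.ae_le_essSup (μ := m) (leafNorm ζ m s)] with x hx h1 h2 h3
    rw [hx, h1, h2]
    exact (wassersteinHolder_smul_le _ _ _).trans (mul_le_mul_right h3 _)
  · filter_upwards [marginalDensity_of_eq_sub m _ _ _ hp hn hst, hap, han, hgs]
      with x hx h1 h2 h3
    rw [hx, h1, h2, Pi.smul_apply, ← h3]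
    simp only [marginalDensity, leafMeasure_univ, Measure.smul_apply, ENNReal.toReal_smul]
    rw [← smul_sub]
    rfl

lemma MemSInfty.neg [MetricSpace M] [MetricSpace K] {ζ : ℝ≥0} {m : Measure M}
    {s : SignedMeasure (M × K)} (hs : MemSInfty ζ m s) : MemSInfty ζ m (-s) := by
  obtain ⟨⟨hs1, hs2⟩, hs3, g, hg, hgs⟩ := hs
  refine ⟨⟨?_, ?_⟩, ?_, -g, ?_, ?_⟩
  · simpa [SignedMeasure.toJordanDecomposition_neg] using hs2
  · simpa [SignedMeasure.toJordanDecomposition_neg] using hs1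
  · have : leafNorm ζ m (-s) = leafNorm ζ m s := by
      funext x
      simp only [leafNorm, SignedMeasure.toJordanDecomposition_neg,
        JordanDecomposition.neg_posPart, JordanDecomposition.neg_negPart]
      exact wassersteinHolder_comm _ _
    rwa [eLInftyNorm, this]
  · simpa using hg.smul (c := (-1 : ℝ))
  · filter_upwards [hgs] with x hx
    rw [Pi.neg_apply, ← hx]
    simp [marginalDensity, SignedMeasure.toJordanDecomposition_neg]

/-- The space `S^∞`. -/
def SInfty [MetricSpace M] [MetricSpace K] [BorelSpace K] (ζ : ℝ≥0) (m : Measure M)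
    [IsFiniteMeasure m] : Submodule ℝ (SignedMeasure (M × K)) where
  carrier := {s | MemSInfty ζ m s}
  zero_mem' := MemSInfty.zero ζ m
  add_mem' := MemSInfty.add
  smul_mem' c s hs := by
    rcases le_total 0 c with hc | hc
    · exact hs.nnreal_smul ⟨c, hc⟩
    · have := (hs.nnreal_smul ⟨-c, neg_nonneg.2 hc⟩).neg
      have h2 : -((-c) • s) = c • s := by
        ext i hi
        simp
      rw [← h2]
      exact this

/-- The norm `‖μ‖_{S^∞} = |φ_x|_ζ + ‖μ‖_∞`. -/
def sInftyNorm [MetricSpace M] [MetricSpace K] (ζ : ℝ≥0) (m : Measure M)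
    (s : SignedMeasure (M × K)) : ℝ :=
  aeHolderNorm ζ m (marginalDensity m s) + lInftyNorm ζ m s

/-- `β` is an exponential rate of convergence to equilibrium for the push-forward by `F`: the
`𝓛^∞` norm of the iterates of a zero-average `μ ∈ S^∞` is at most `D β^n ‖μ‖_{S^∞}`. -/
def IsEquilibriumRate [MetricSpace M] [MetricSpace K] (ζ : ℝ≥0) (m : Measure M)
    (F : M × K → M × K) (β : ℝ) : Prop :=
  ∃ D : ℝ, ∀ s : SignedMeasure (M × K), MemSInfty ζ m s → s univ = 0 → ∀ n ≥ 1,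
    lInftyNorm ζ m ((fun t => t.map F)^[n] s) ≤ D * β ^ n * sInftyNorm ζ m s

end Submodule

end

/-! The push-forward F_* preserves total mass and fixes a probability μ₀ with marginal m₁
(`exists_invariant_measure`). Hence F_* = P + N with Pμ = μ(Σ) μ₀, and N^n μ = F_*^n(μ - Pμ) for n ≥
1 (`exists_rank_one_decomposition`). Everything reduces to exponential decay of F_*^n on measures of
total mass zero, for the fibrewise norm and for the marginal density; the latter evolves by P_f.

Base. The fibres of f over two nearby points can be matched so that at most q of the deg(f) pairs
are expanded, by at most L, while the others are contracted by σ⁻¹ (`exists_fibrePairing`). Since ρ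
≤ e^ε/deg(f), the smallness condition says that P_f multiplies local Hölder constants by some θ < 1,
up to a multiple of the sup norm. The same count with exponent 1, chained along short steps,
contracts the average displacement between any two fibres. The measure m₁ need not have full
support, so P_f 1 = 1 is known only on S = supp m₁, which is backward invariant. Comparing a fibre
with the fibre over the nearest point of S shows that P_f contracts the distance to S by θ; this
bounds P_f^n 1 on all of M (`exists_iterate_one_le`) and yields (1) (`exists_lasotaYorke`). On S the
operator averages over preimages, and any two points have n-th preimages at distance at most κ^n
diam M. A Doeblin argument then shrinks oscillations on S (`oscillation_iterate_le`), and together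
with (1) this gives (2) (`exists_isBaseDecayRate`).

Fibres. For a test function g, the function g(G(u, ·)) is a constant plus α^ζ times another
admissible test function. The constant is seen only by the marginal density, so the fibrewise norms
satisfy a_{n+1} ≤ α^ζ a_n + R |P_f^n φ|_∞ (`SkewSystem.leafBound_map`), and (2) turns this into (3)
(`SkewSystem.isEquilibriumRate`).

Gap. About half of the n iterates make the density small in the essential sup norm by (3);
inequality (1) is applied over the other half. Halving the time is the source of the square roots in
ξ (`SkewSystem.exists_sInftyNorm_iterate_le`). -/

noncomputable section

/-! ### Geodesic splitting and matching of nearby fibres -/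

section Geometry

/-- In a compact Riemannian manifold, the distance between two points can be split in any
prescribed ratio by a third point. -/
lemma exists_dist_le_split {d : ℕ} {M : Type*} [MetricSpace M]
    [ChartedSpace (EuclideanSpace ℝ (Fin d)) M]
    [IsManifold 𝓘(ℝ, EuclideanSpace ℝ (Fin d)) ∞ M]
    [RiemannianBundle (fun x : M => TangentSpace 𝓘(ℝ, EuclideanSpace ℝ (Fin d)) x)]
    [IsRiemannianManifold 𝓘(ℝ, EuclideanSpace ℝ (Fin d)) M] [CompactSpace M]
    (x y : M) {a : ℝ} (ha0 : 0 ≤ a) (ha1 : a ≤ 1) :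
    ∃ z, dist x z ≤ a * dist x y ∧ dist z y ≤ (1 - a) * dist x y := by
  have happrox : ∀ η > 0, ∃ z, dist x z = a * dist x y ∧ dist z y ≤ (1 - a) * dist x y + η := by
    intro η hη
    have h1 : Manifold.riemannianEDist 𝓘(ℝ, EuclideanSpace ℝ (Fin d)) x y <
        ENNReal.ofReal (dist x y + η) := by
      rw [← IsRiemannianManifold.out (I := 𝓘(ℝ, EuclideanSpace ℝ (Fin d))) x y, edist_dist]
      exact (ENNReal.ofReal_lt_ofReal_iff (by positivity)).2 (by linarith)
    obtain ⟨γ, h0, h1', hγ, hlen⟩ := Manifold.exists_lt_of_riemannianEDist_lt h1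
    have hcont : ContinuousOn (fun t => dist x (γ t)) (Icc 0 1) :=
      (continuous_const.dist continuous_id).comp_continuousOn hγ.continuousOn
    have hmem : a * dist x y ∈ Icc (dist x (γ 0)) (dist x (γ 1)) := by
      rw [h0, h1', dist_self]
      exact ⟨by positivity, mul_le_of_le_one_left dist_nonneg ha1⟩
    obtain ⟨t, ht, htz⟩ := intermediate_value_Icc zero_le_one hcont hmem
    refine ⟨γ t, htz, ?_⟩
    have e1 : edist x (γ t) ≤ Manifold.pathELength 𝓘(ℝ, EuclideanSpace ℝ (Fin d)) γ 0 t := by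
      rw [IsRiemannianManifold.out (I := 𝓘(ℝ, EuclideanSpace ℝ (Fin d))) x (γ t)]
      exact Manifold.riemannianEDist_le_pathELength (hγ.mono (Icc_subset_Icc_right ht.2)) h0 rfl ht.1
    have e2 : edist (γ t) y ≤ Manifold.pathELength 𝓘(ℝ, EuclideanSpace ℝ (Fin d)) γ t 1 := by
      rw [IsRiemannianManifold.out (I := 𝓘(ℝ, EuclideanSpace ℝ (Fin d))) (γ t) y]
      exact Manifold.riemannianEDist_le_pathELength (hγ.mono (Icc_subset_Icc_left ht.1)) rfl h1' ht.2
    have e3 := (add_le_add e1 e2).trans_lt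
      ((Manifold.pathELength_add ht.1 ht.2).trans_lt hlen)
    rw [edist_dist, edist_dist, ← ENNReal.ofReal_add dist_nonneg dist_nonneg,
      ENNReal.ofReal_lt_ofReal_iff (by positivity)] at e3
    simp only at htz
    linarith
  -- The intermediate value theorem on almost minimising curves splits the distance up to η.
  -- Minimising the distance to y over this compact sphere gives one z that serves every η.
  have hc : IsCompact {z | dist x z = a * dist x y} :=
    (isClosed_eq (by fun_prop) (by fun_prop)).isCompact
  obtain ⟨z₁, hz₁, -⟩ := happrox 1 one_pos
  obtain ⟨z, hz, hmin⟩ := hc.exists_isMinOn ⟨z₁, hz₁⟩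
    (f := fun z => dist z y) (by fun_prop)
  refine ⟨z, hz.le, le_of_forall_pos_le_add fun η hη => ?_⟩
  obtain ⟨w, hw, hwy⟩ := happrox η hη
  exact (hmin hw).trans hwy

variable {M : Type*}

/-- The fibres over points near `c` are in bijection with the fibre over `c`, corresponding points
being close. -/
lemma exists_nhds_fibre_equiv [TopologicalSpace M] [T2Space M] [CompactSpace M] {f : M → M}
    (hf : IsLocalHomeomorph f) (W : M → Set M) (hW : ∀ u, W u ∈ 𝓝 u) (c : M) :
    (f ⁻¹' {c}).Finite ∧
    ∃ V ∈ 𝓝 c, ∀ x ∈ V, ∃ e : f ⁻¹' {c} ≃ f ⁻¹' {x}, ∀ u : f ⁻¹' {c}, (e u : M) ∈ W u := by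
  have hfin : (f ⁻¹' {c}).Finite := by
    refine (isClosed_singleton.preimage hf.continuous).isCompact.finite
      (isDiscrete_iff_discreteTopology.2 ?_)
    exact (isLocalHomeomorph_iff_isCoveringMap.1 hf c).1
  refine ⟨hfin, ?_⟩
  obtain ⟨U, hU, hdisj⟩ := hfin.t2_separation
  have hinj : ∀ u, ∃ I ∈ 𝓝 u, InjOn f I := fun u => by
    obtain ⟨e, he, rfl⟩ := hf u
    exact ⟨e.source, e.open_source.mem_nhds he, e.injOn⟩
  choose I hI hIinj using hinj
  let O : M → Set M := fun u => interior (W u ∩ I u) ∩ U u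
  have hO : ∀ u, IsOpen (O u) := fun u => isOpen_interior.inter (hU u).2
  have hmO : ∀ u, u ∈ O u := fun u =>
    ⟨mem_interior_iff_mem_nhds.2 (inter_mem (hW u) (hI u)), (hU u).1⟩
  -- The first factor gives each x in V a preimage in every O u; the second, the complement of a
  -- closed image, excludes preimages outside their union.
  let V := (⋂ u ∈ f ⁻¹' {c}, f '' O u) ∩ (f '' (⋃ u ∈ f ⁻¹' {c}, O u)ᶜ)ᶜ
  have hV : V ∈ 𝓝 c := by
    refine inter_mem ((biInter_mem hfin).2 fun u hu => ?_) ?_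
    · exact (hf.isOpenMap _ (hO u)).mem_nhds ⟨u, hmO u, hu⟩
    · refine IsOpen.mem_nhds ?_ ?_
      · refine (hf.continuous.isClosedMap _ ?_).isOpen_compl
        exact (isOpen_biUnion fun u _ => hO u).isClosed_compl
      · rintro ⟨u, hu, huc⟩
        exact hu (mem_biUnion (show u ∈ f ⁻¹' {c} from huc) (hmO u))
  refine ⟨V, hV, fun x hx => ?_⟩
  have hex : ∀ u : f ⁻¹' {c}, ∃ v : f ⁻¹' {x}, (v : M) ∈ O u := fun u => by
    obtain ⟨v, hv, hvx⟩ := mem_iInter₂.1 hx.1 u u.2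
    exact ⟨⟨v, hvx⟩, hv⟩
  choose g hg using hex
  have hbij : Function.Bijective g := by
    constructor
    · intro u u' h
      by_contra hne
      have := hdisj u.2 u'.2 (fun h' => hne (Subtype.ext h'))
      exact (Set.disjoint_left.1 this (hg u).2) (h ▸ (hg u').2)
    · intro v
      have hv : (v : M) ∈ ⋃ u ∈ f ⁻¹' {c}, O u := by
        by_contra hcon
        exact hx.2 ⟨v, hcon, v.2⟩
      obtain ⟨u, hu, hvu⟩ := mem_iUnion₂.1 hv
      refine ⟨⟨u, hu⟩, Subtype.ext ?_⟩
      refine hIinj u (interior_subset (hg ⟨u, hu⟩).1).2 (interior_subset hvu.1).2 ?_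
      exact (g ⟨u, hu⟩).2.trans v.2.symm
  exact ⟨Equiv.ofBijective g hbij, fun u => (interior_subset (hg u).1).1⟩

/-- The matching of nearby fibres makes the cardinality locally constant, and M is connected. -/
lemma ncard_fibre_eq_mapDegree [TopologicalSpace M] [T2Space M] [CompactSpace M]
    [ConnectedSpace M] {f : M → M} (hf : IsLocalHomeomorph f) (x : M) :
    (f ⁻¹' {x}).ncard = mapDegree f := by
  have hloc : IsLocallyConstant fun x => (f ⁻¹' {x}).ncard := by
    rw [IsLocallyConstant.iff_eventually_eq]
    intro c
    obtain ⟨-, V, hV, h⟩ := exists_nhds_fibre_equiv hf (fun _ => univ) (fun _ => univ_mem) c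
    filter_upwards [hV] with x hx
    obtain ⟨e, -⟩ := h x hx
    exact (Nat.card_congr e).symm
  have hconst : ∀ y, (f ⁻¹' {y}).ncard = (f ⁻¹' {x}).ncard := fun y =>
    hloc.apply_eq_of_isPreconnected isPreconnected_univ (mem_univ y) (mem_univ x)
  have : Nonempty M := ⟨x⟩
  simp [mapDegree, hconst]

/-- A bijection between the fibres over `x` and `y` that contracts by `a`, relative to the distance
of `x` and `y`, except for at most `q` points where it expands by at most `b`. -/
def FibrePairing [MetricSpace M] (f : M → M) (q : ℕ) (a b : ℝ) (x y : M) : Prop :=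
  ∃ (e : f ⁻¹' {x} ≃ f ⁻¹' {y}) (T : Finset (f ⁻¹' {x})), T.card ≤ q ∧
    (∀ u ∈ T, dist (u : M) (e u) ≤ b * dist x y) ∧ ∀ u ∉ T, dist (u : M) (e u) ≤ a * dist x y

/-- Both fibres are matched with the fibre over a common nearby point c. Partners of the same u in
f⁻¹(c) lie in the neighbourhood of u on which the inverse branch is Lf u-Lipschitz. The pairs that
may expand come from u ∈ A, and there are at most q of them: each of the q domains of injectivity
covering A contains at most one point of the fibre. -/
lemma exists_fibrePairing [MetricSpace M] [CompactSpace M] {f : M → M}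
    (hf : IsLocalHomeomorph f) {Lf : M → ℝ} (hLf : LocalInverseLipschitz f Lf) {A : Set M}
    {σ L : ℝ} {q : ℕ} (hf1 : CondF1 Lf A σ L) (hf2 : CondF2 f A q) :
    ∃ δ > 0, ∀ x y, dist x y < δ → FibrePairing f q σ⁻¹ L x y := by
  choose W hW hWinj hWL using hLf
  choose hfin V hV e he using exists_nhds_fibre_equiv hf W hW
  obtain ⟨δ, hδ, hleb⟩ := lebesgue_number_lemma_of_metric (s := univ) isCompact_univ
    (c := fun x => interior (V x)) (fun _ => isOpen_interior)
    (fun x _ => mem_iUnion.2 ⟨x, mem_interior_iff_mem_nhds.2 (hV x)⟩)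
  refine ⟨δ, hδ, fun x y hxy => ?_⟩
  obtain ⟨c, hc⟩ := hleb x (mem_univ x)
  have hx : x ∈ V c := interior_subset <| hc (Metric.mem_ball_self hδ)
  have hy : y ∈ V c := interior_subset <| hc (by rwa [Metric.mem_ball, dist_comm])
  have := (hfin c).fintype
  classical
  let Tc : Finset (f ⁻¹' {c}) := Finset.univ.filter fun u => (u : M) ∈ A
  have hTc : Tc.card ≤ q := by
    obtain ⟨-, 𝒰, h𝒰, -, 𝒱, h𝒱, hcard, hcov⟩ := hf2
    have hex : ∀ u : f ⁻¹' {c}, ∃ U, (u : M) ∈ A → U ∈ 𝒱 ∧ (u : M) ∈ U := fun u => by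
      by_cases hu : (u : M) ∈ A
      · obtain ⟨U, hU, huU⟩ := mem_iUnion₂.1 (hcov hu)
        exact ⟨U, fun _ => ⟨hU, huU⟩⟩
      · exact ⟨∅, fun h => absurd h hu⟩
    choose U hU using hex
    rw [← hcard]
    refine Finset.card_le_card_of_injOn U (fun u hu => (hU u (by simpa [Tc] using hu)).1) ?_
    intro u hu v hv huv
    have h1 := hU u (by simpa [Tc] using hu)
    have h2 := hU v (by simpa [Tc] using hv)
    refine Subtype.ext ((h𝒰 _ (h𝒱 h1.1)).2 h1.2 (huv ▸ h2.2) ?_)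
    exact u.2.trans v.2.symm
  have hdist : ∀ u : f ⁻¹' {c}, dist (e c x hx u : M) (e c y hy u) ≤ Lf u * dist x y := fun u => by
    have h := hWL u _ (he c x hx u) _ (he c y hy u)
    rwa [show f (e c x hx u) = x from (e c x hx u).2,
      show f (e c y hy u) = y from (e c y hy u).2] at h
  refine ⟨(e c x hx).symm.trans (e c y hy), Tc.map (e c x hx).toEmbedding, by simpa using hTc,
    fun u hu => ?_, fun u hu => ?_⟩
  · obtain ⟨v, rfl⟩ := (e c x hx).surjective u
    have hv : (v : M) ∈ A := by simpa [Tc] using hu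
    simpa using (hdist v).trans (mul_le_mul_of_nonneg_right (hf1.1 _ hv) dist_nonneg)
  · obtain ⟨v, rfl⟩ := (e c x hx).surjective u
    have hv : (v : M) ∉ A := by simpa [Tc] using hu
    simpa using (hdist v).trans (mul_le_mul_of_nonneg_right (hf1.2 _ hv).le dist_nonneg)

end Geometry

/-! ### Hölder seminorm, sup norm, and passage from local to global estimates -/

section HolderNorms

variable {M : Type*} [MetricSpace M] {ζ : ℝ≥0} {φ : M → ℝ}

lemma holderWith_of_abs_sub_le {H : ℝ≥0} (h : ∀ x y, |φ x - φ y| ≤ H * dist x y ^ (ζ : ℝ)) :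
    HolderWith H ζ φ := by
  intro x y
  rw [edist_dist, edist_dist, Real.dist_eq, ENNReal.ofReal_rpow_of_nonneg dist_nonneg ζ.coe_nonneg,
    ← ENNReal.ofReal_coe_nnreal, ← ENNReal.ofReal_mul H.coe_nonneg]
  exact ENNReal.ofReal_le_ofReal (h x y)

lemma memHolder_of_abs_sub_le {H : ℝ} (hH : 0 ≤ H)
    (h : ∀ x y, |φ x - φ y| ≤ H * dist x y ^ (ζ : ℝ)) : MemHolder ζ φ :=
  ⟨⟨H, hH⟩, holderWith_of_abs_sub_le h⟩

lemma nnHolderNorm_le_of_abs_sub_le {H : ℝ} (hH : 0 ≤ H)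
    (h : ∀ x y, |φ x - φ y| ≤ H * dist x y ^ (ζ : ℝ)) : (nnHolderNorm ζ φ : ℝ) ≤ H :=
  (holderWith_of_abs_sub_le (H := ⟨H, hH⟩) h).nnholderNorm_le

lemma HolderWith.abs_sub_le {H : ℝ≥0} (h : HolderWith H ζ φ) (x y : M) :
    |φ x - φ y| ≤ H * dist x y ^ (ζ : ℝ) := by
  rw [← Real.dist_eq]
  exact h.dist_le x y

lemma MemHolder.abs_sub_le (h : MemHolder ζ φ) (x y : M) :
    |φ x - φ y| ≤ nnHolderNorm ζ φ * dist x y ^ (ζ : ℝ) :=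
  h.holderWith.abs_sub_le x y

lemma MemHolder.continuous (h : MemHolder ζ φ) (hζ : 0 < ζ) : Continuous φ :=
  h.choose_spec.continuous hζ

lemma MemHolder.bddAbove [CompactSpace M] (h : MemHolder ζ φ) (hζ : 0 < ζ) :
    BddAbove (range fun x => |φ x|) :=
  (isCompact_range (h.continuous hζ).abs).bddAbove

lemma MemHolder.abs_le_supNorm [CompactSpace M] (h : MemHolder ζ φ) (hζ : 0 < ζ) (x : M) :
    |φ x| ≤ supNorm φ :=
  le_ciSup (h.bddAbove hζ) x

lemma supNorm_nonneg {X : Type*} (φ : X → ℝ) : 0 ≤ supNorm φ :=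
  Real.iSup_nonneg fun _ => abs_nonneg _

lemma supNorm_le_of_abs_le {X : Type*} {φ : X → ℝ} {B : ℝ} (hB : 0 ≤ B) (h : ∀ x, |φ x| ≤ B) :
    supNorm φ ≤ B :=
  Real.iSup_le h hB

lemma holderNorm_nonneg (ζ : ℝ≥0) (φ : M → ℝ) : 0 ≤ holderNorm ζ φ :=
  add_nonneg (NNReal.coe_nonneg _) (supNorm_nonneg φ)

lemma supNorm_le_holderNorm (ζ : ℝ≥0) (φ : M → ℝ) : supNorm φ ≤ holderNorm ζ φ :=
  le_add_of_nonneg_left (NNReal.coe_nonneg _)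

lemma nnHolderNorm_le_holderNorm (ζ : ℝ≥0) (φ : M → ℝ) :
    (nnHolderNorm ζ φ : ℝ) ≤ holderNorm ζ φ :=
  le_add_of_nonneg_right (supNorm_nonneg φ)

lemma holderNorm_le_add {H B : ℝ} (hH : 0 ≤ H) (hB : 0 ≤ B)
    (h : ∀ x y, |φ x - φ y| ≤ H * dist x y ^ (ζ : ℝ)) (hb : ∀ x, |φ x| ≤ B) :
    holderNorm ζ φ ≤ H + B :=
  add_le_add (nnHolderNorm_le_of_abs_sub_le hH h) (supNorm_le_of_abs_le hB hb)

lemma holderNorm_smul (c : ℝ) (h : MemHolder ζ φ) :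
    holderNorm ζ (c • φ) = |c| * holderNorm ζ φ := by
  have h2 : supNorm (c • φ) = |c| * supNorm φ := by
    simp only [supNorm, Pi.smul_apply, smul_eq_mul, abs_mul]
    exact (Real.mul_iSup_of_nonneg (abs_nonneg c) _).symm
  simp only [holderNorm, h2, h.nnHolderNorm_smul]
  simp only [NNReal.coe_mul, coe_nnnorm, Real.norm_eq_abs]
  ring

/-- At distances of at least δ the trivial bound 2B is itself a Hölder bound, with constant 2B/δ^ζ.
Globalising thus costs only a multiple of the sup norm and does not affect the contraction rate of
the Hölder constant. -/
lemma abs_sub_le_of_local {δ H B : ℝ} (hδ : 0 < δ) (hH : 0 ≤ H) (hB : 0 ≤ B)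
    (h : ∀ x y, dist x y < δ → |φ x - φ y| ≤ H * dist x y ^ (ζ : ℝ)) (hb : ∀ x, |φ x| ≤ B)
    (x y : M) : |φ x - φ y| ≤ (H + 2 * B / δ ^ (ζ : ℝ)) * dist x y ^ (ζ : ℝ) := by
  have hδ' : 0 < δ ^ (ζ : ℝ) := Real.rpow_pos_of_pos hδ _
  rcases lt_or_ge (dist x y) δ with hxy | hxy
  · refine (h x y hxy).trans (mul_le_mul_of_nonneg_right ?_ (by positivity))
    linarith [show 0 ≤ 2 * B / δ ^ (ζ : ℝ) by positivity]
  · have h1 : δ ^ (ζ : ℝ) ≤ dist x y ^ (ζ : ℝ) := Real.rpow_le_rpow hδ.le hxy ζ.coe_nonneg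
    calc |φ x - φ y| ≤ |φ x| + |φ y| := abs_sub _ _
      _ ≤ 2 * B := by linarith [hb x, hb y]
      _ = 2 * B / δ ^ (ζ : ℝ) * δ ^ (ζ : ℝ) := by field_simp
      _ ≤ 2 * B / δ ^ (ζ : ℝ) * dist x y ^ (ζ : ℝ) := by gcongr
      _ ≤ _ := by
        refine mul_le_mul_of_nonneg_right ?_ (by positivity)
        linarith

end HolderNorms

/-! ### Linearity and positivity of the Perron–Frobenius operator -/

section Operator

variable {M : Type*} {f : M → M} {ρ : M → ℝ}

lemma perronFrobenius_eq_sum (hfin : ∀ x, (f ⁻¹' {x}).Finite) (φ : M → ℝ) (x : M) :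
    perronFrobenius f ρ φ x = ∑ u ∈ (hfin x).toFinset, φ u * ρ u :=
  finsum_mem_eq_finite_toFinset_sum _ (hfin x)

lemma perronFrobenius_add (hfin : ∀ x, (f ⁻¹' {x}).Finite) (φ ψ : M → ℝ) :
    perronFrobenius f ρ (φ + ψ) = perronFrobenius f ρ φ + perronFrobenius f ρ ψ := by
  funext x
  simp only [Pi.add_apply, perronFrobenius_eq_sum hfin, add_mul, Finset.sum_add_distrib]

lemma perronFrobenius_smul (hfin : ∀ x, (f ⁻¹' {x}).Finite) (c : ℝ) (φ : M → ℝ) :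
    perronFrobenius f ρ (c • φ) = c • perronFrobenius f ρ φ := by
  funext x
  simp only [Pi.smul_apply, perronFrobenius_eq_sum hfin, smul_eq_mul, Finset.mul_sum, mul_assoc]

lemma perronFrobenius_iterate_add (hfin : ∀ x, (f ⁻¹' {x}).Finite) (φ ψ : M → ℝ) (n : ℕ) :
    (perronFrobenius f ρ)^[n] (φ + ψ) =
      (perronFrobenius f ρ)^[n] φ + (perronFrobenius f ρ)^[n] ψ := by
  induction n with
  | zero => rfl
  | succ n ih => simp only [Function.iterate_succ_apply', ih, perronFrobenius_add hfin]

lemma perronFrobenius_iterate_smul (hfin : ∀ x, (f ⁻¹' {x}).Finite) (c : ℝ) (φ : M → ℝ) (n : ℕ) :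
    (perronFrobenius f ρ)^[n] (c • φ) = c • (perronFrobenius f ρ)^[n] φ := by
  induction n with
  | zero => rfl
  | succ n ih => simp only [Function.iterate_succ_apply', ih, perronFrobenius_smul hfin]

/-- If `φ` is nonnegative on a backward invariant set, then so is its image, and each branch gives
a lower bound. -/
lemma mul_le_perronFrobenius (hfin : ∀ x, (f ⁻¹' {x}).Finite) {c : ℝ} (hc : 0 ≤ c)
    (hρ : ∀ x, c ≤ ρ x) {S : Set M} (hS : ∀ u, f u ∈ S → u ∈ S) {φ : M → ℝ}
    (hφ : ∀ x ∈ S, 0 ≤ φ x) {u : M} (hu : f u ∈ S) : c * φ u ≤ perronFrobenius f ρ φ (f u) := by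
  rw [perronFrobenius_eq_sum hfin]
  have hnn : ∀ v ∈ (hfin (f u)).toFinset, 0 ≤ φ v * ρ v := fun v hv => by
    have hv' : f v = f u := by simpa using hv
    exact mul_nonneg (hφ v (hS v (hv' ▸ hu))) (hc.trans (hρ v))
  refine le_trans ?_ (Finset.single_le_sum hnn (a := u) (by simp))
  rw [mul_comm]
  exact mul_le_mul_of_nonneg_left (hρ u) (hφ u (hS u hu))

lemma perronFrobenius_nonneg_on (hfin : ∀ x, (f ⁻¹' {x}).Finite)
    (hρ : ∀ x, 0 ≤ ρ x) {S : Set M} (hS : ∀ u, f u ∈ S → u ∈ S) {φ : M → ℝ}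
    (hφ : ∀ x ∈ S, 0 ≤ φ x) {x : M} (hx : x ∈ S) : 0 ≤ perronFrobenius f ρ φ x := by
  rw [perronFrobenius_eq_sum hfin]
  refine Finset.sum_nonneg fun v hv => ?_
  have hv' : f v = x := by simpa using hv
  exact mul_nonneg (hφ v (hS v (hv' ▸ hx))) (hρ v)

lemma perronFrobenius_iterate_nonneg_on (hfin : ∀ x, (f ⁻¹' {x}).Finite)
    (hρ : ∀ x, 0 ≤ ρ x) {S : Set M} (hS : ∀ u, f u ∈ S → u ∈ S) {φ : M → ℝ}
    (hφ : ∀ x ∈ S, 0 ≤ φ x) (n : ℕ) : ∀ x ∈ S, 0 ≤ (perronFrobenius f ρ)^[n] φ x := by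
  induction n with
  | zero => exact hφ
  | succ n ih =>
    intro x hx
    rw [Function.iterate_succ_apply']
    exact perronFrobenius_nonneg_on hfin hρ hS ih hx

/-- Since S is backward invariant, the iterates on S depend only on the values on S; there
positivity and linearity give monotonicity. -/
lemma perronFrobenius_iterate_mono_on (hfin : ∀ x, (f ⁻¹' {x}).Finite)
    (hρ : ∀ x, 0 ≤ ρ x) {S : Set M} (hS : ∀ u, f u ∈ S → u ∈ S) {φ ψ : M → ℝ}
    (h : ∀ x ∈ S, φ x ≤ ψ x) (n : ℕ) {x : M} (hx : x ∈ S) :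
    (perronFrobenius f ρ)^[n] φ x ≤ (perronFrobenius f ρ)^[n] ψ x := by
  have h1 := perronFrobenius_iterate_nonneg_on hfin hρ hS (φ := ψ + (-1 : ℝ) • φ)
    (fun y hy => by simpa using h y hy) n x hx
  rw [perronFrobenius_iterate_add hfin, perronFrobenius_iterate_smul hfin] at h1
  simpa using h1

lemma perronFrobenius_iterate_mono (hfin : ∀ x, (f ⁻¹' {x}).Finite)
    (hρ : ∀ x, 0 ≤ ρ x) {φ ψ : M → ℝ} (h : ∀ x, φ x ≤ ψ x) (n : ℕ) (x : M) :
    (perronFrobenius f ρ)^[n] φ x ≤ (perronFrobenius f ρ)^[n] ψ x :=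
  perronFrobenius_iterate_mono_on hfin hρ (S := univ) (fun _ _ => trivial) (fun x _ => h x) n
    (mem_univ x)

lemma abs_perronFrobenius_iterate_le (hfin : ∀ x, (f ⁻¹' {x}).Finite)
    (hρ : ∀ x, 0 ≤ ρ x) {φ ψ : M → ℝ} (h : ∀ x, |φ x| ≤ ψ x) (n : ℕ) (x : M) :
    |(perronFrobenius f ρ)^[n] φ x| ≤ (perronFrobenius f ρ)^[n] ψ x := by
  refine abs_le.2 ⟨?_, perronFrobenius_iterate_mono hfin hρ (fun x => (abs_le.1 (h x)).2) n x⟩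
  have := perronFrobenius_iterate_mono hfin hρ (φ := (-1 : ℝ) • ψ) (ψ := φ)
    (fun x => by simpa using (abs_le.1 (h x)).1) n x
  rw [perronFrobenius_iterate_smul hfin] at this
  simpa using this

/-- All terms of the n-fold sum over branches are nonnegative. Only the one at u is kept, and its
weight is at least c^n. -/
lemma pow_mul_le_perronFrobenius_iterate (hfin : ∀ x, (f ⁻¹' {x}).Finite) {c : ℝ} (hc : 0 ≤ c)
    (hρ : ∀ x, c ≤ ρ x) {S : Set M} (hS : ∀ u, f u ∈ S → u ∈ S) {φ : M → ℝ}
    (hφ : ∀ x ∈ S, 0 ≤ φ x) (n : ℕ) {u : M} (hu : f^[n] u ∈ S) :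
    c ^ n * φ u ≤ (perronFrobenius f ρ)^[n] φ (f^[n] u) := by
  induction n generalizing φ u with
  | zero => simp
  | succ n ih =>
    rw [Function.iterate_succ_apply] at hu ⊢
    have hρ0 : ∀ x, 0 ≤ ρ x := fun x => hc.trans (hρ x)
    have hmem : ∀ (k : ℕ) (v : M), f^[k] v ∈ S → v ∈ S := by
      intro k
      induction k with
      | zero => exact fun v hv => hv
      | succ k ihk => exact fun v hv => hS v (ihk _ (by rwa [Function.iterate_succ_apply] at hv))
    have h1 := ih (φ := perronFrobenius f ρ φ)
      (fun x hx => perronFrobenius_nonneg_on hfin hρ0 hS hφ hx) hu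
    have h2 := mul_le_perronFrobenius hfin hc hρ hS hφ (hmem n _ hu)
    calc c ^ (n + 1) * φ u = c ^ n * (c * φ u) := by ring
      _ ≤ c ^ n * perronFrobenius f ρ φ (f u) := by gcongr
      _ ≤ _ := h1

end Operator

/-! ### Abstract base dynamics: bounded iterates and the Lasota–Yorke inequality -/

section Transfer

variable {M : Type*} [MetricSpace M]

/-- The properties of the base dynamics on which the spectral analysis of the Perron–Frobenius
operator rests: a local Lasota–Yorke inequality, an average contraction of the distance to the
closed backward invariant set `S`, and a contracting pair of branches over any two points. -/
structure TransferSystem (ζ : ℝ≥0) (f : M → M) (ρ : M → ℝ) (S : Set M) (δ θ κ c C₀ C₁ : ℝ) :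
    Prop where
  finite_fibre : ∀ x, (f ⁻¹' {x}).Finite
  c_pos : 0 < c
  le_weight : ∀ x, c ≤ ρ x
  δ_pos : 0 < δ
  θ_pos : 0 < θ
  θ_lt_one : θ < 1
  κ_nonneg : 0 ≤ κ
  κ_lt_one : κ < 1
  C₀_nonneg : 0 ≤ C₀
  abs_sub_le : ∀ (φ : M → ℝ) (H B : ℝ), 0 ≤ H → 0 ≤ B →
    (∀ x y, dist x y < δ → |φ x - φ y| ≤ H * dist x y ^ (ζ : ℝ)) → (∀ x, |φ x| ≤ B) →
    ∀ x y, dist x y < δ →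
      |perronFrobenius f ρ φ x - perronFrobenius f ρ φ y| ≤ (θ * H + C₀ * B) * dist x y ^ (ζ : ℝ)
  apply_one_le : ∀ x, perronFrobenius f ρ 1 x ≤ C₁
  isClosed : IsClosed S
  nonempty : S.Nonempty
  backward : ∀ u, f u ∈ S → u ∈ S
  apply_one_eq : ∀ x ∈ S, perronFrobenius f ρ 1 x = 1
  apply_infDist_le : ∀ x, perronFrobenius f ρ (Metric.infDist · S) x ≤ θ * Metric.infDist x S
  exists_branches : ∀ x y, ∃ u v, f u = x ∧ f v = y ∧ dist u v ≤ κ * dist x y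

namespace TransferSystem

variable {ζ : ℝ≥0} {f : M → M} {ρ : M → ℝ} {S : Set M} {δ θ κ c C₀ C₁ : ℝ}

lemma weight_nonneg (h : TransferSystem ζ f ρ S δ θ κ c C₀ C₁) (x : M) : 0 ≤ ρ x :=
  h.c_pos.le.trans (h.le_weight x)

lemma iterate_infDist_le (h : TransferSystem ζ f ρ S δ θ κ c C₀ C₁) (n : ℕ) (x : M) :
    (perronFrobenius f ρ)^[n] (Metric.infDist · S) x ≤ θ ^ n * Metric.infDist x S := by
  induction n generalizing x with
  | zero => simp
  | succ n ih =>
    rw [Function.iterate_succ_apply']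
    have h1 := perronFrobenius_iterate_mono h.finite_fibre h.weight_nonneg
      (ψ := θ ^ n • (Metric.infDist · S)) (fun y => by simpa using ih y) 1 x
    simp only [Function.iterate_one, perronFrobenius_smul h.finite_fibre, Pi.smul_apply,
      smul_eq_mul] at h1
    refine h1.trans ((mul_le_mul_of_nonneg_left (h.apply_infDist_le x)
      (pow_nonneg h.θ_pos.le n)).trans (le_of_eq (by ring)))

/-- Preimages of points of S stay in S, so on S the operator is an averaging operator at every step.
-/
lemma iterate_one_eq (h : TransferSystem ζ f ρ S δ θ κ c C₀ C₁) (n : ℕ) {x : M} (hx : x ∈ S) :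
    (perronFrobenius f ρ)^[n] 1 x = 1 := by
  induction n generalizing x with
  | zero => rfl
  | succ n ih =>
    rw [Function.iterate_succ_apply']
    rw [← h.apply_one_eq x hx, perronFrobenius_eq_sum h.finite_fibre,
      perronFrobenius_eq_sum h.finite_fibre]
    refine Finset.sum_congr rfl fun u hu => ?_
    have hu' : f u = x := by simpa using hu
    rw [ih (h.backward u (hu' ▸ hx))]
    rfl

lemma iterate_one_nonneg (h : TransferSystem ζ f ρ S δ θ κ c C₀ C₁) (n : ℕ) (x : M) :
    0 ≤ (perronFrobenius f ρ)^[n] 1 x :=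
  perronFrobenius_iterate_nonneg_on h.finite_fibre h.weight_nonneg (S := univ)
    (fun _ _ => trivial) (fun _ _ => by simp) n x (mem_univ x)

/-- Interpolation between the constant `t ^ ζ` and the linear bound. -/
lemma rpow_le_rpow_add_mul {ζ : ℝ} (hζ0 : 0 ≤ ζ) (hζ1 : ζ ≤ 1) {t s : ℝ} (ht : 0 < t) (hs : 0 ≤ s) :
    s ^ ζ ≤ t ^ ζ + t ^ ζ * (t⁻¹ * s) := by
  have ht' : 0 < t ^ ζ := Real.rpow_pos_of_pos ht ζ
  rcases le_total s t with hst | hst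
  · exact (Real.rpow_le_rpow hs hst hζ0).trans (le_add_of_nonneg_right (by positivity))
  · have h1 : 1 ≤ t⁻¹ * s := by rwa [← div_eq_inv_mul, one_le_div ht]
    have h2 : s ^ ζ = t ^ ζ * (t⁻¹ * s) ^ ζ := by
      rw [← Real.mul_rpow ht.le (by positivity)]
      congr 1
      field_simp
    have h3 : (t⁻¹ * s) ^ ζ ≤ t⁻¹ * s := by
      simpa using Real.rpow_le_rpow_of_exponent_le h1 hζ1
    rw [h2]
    exact (mul_le_mul_of_nonneg_left h3 ht'.le).trans (le_add_of_nonneg_left ht'.le)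

/-- The assumed contraction concerns the distance d to S, not d^ζ. With t = θ^n,
`rpow_le_rpow_add_mul` gives d^ζ ≤ t^ζ (1 + d/t); the n-th iterate of d is at most t times the
diameter, so both terms become of order t^ζ = (θ^ζ)^n. -/
lemma abs_iterate_le [CompactSpace M] (h : TransferSystem ζ f ρ S δ θ κ c C₀ C₁) (hζ1 : ζ ≤ 1)
    {φ : M → ℝ} {B H : ℝ} (hH : 0 ≤ H)
    (hφ : ∀ x, |φ x| ≤ B + H * Metric.infDist x S ^ (ζ : ℝ)) (n : ℕ) (x : M) :
    |(perronFrobenius f ρ)^[n] φ x| ≤ B * (perronFrobenius f ρ)^[n] 1 x +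
      H * (θ ^ (ζ : ℝ)) ^ n * ((perronFrobenius f ρ)^[n] 1 x + Metric.diam (univ : Set M)) := by
  set t := θ ^ n with ht
  have htpos : 0 < t := pow_pos h.θ_pos n
  have htζ : t ^ (ζ : ℝ) = (θ ^ (ζ : ℝ)) ^ n := by
    rw [ht, ← Real.rpow_natCast, ← Real.rpow_natCast, ← Real.rpow_mul h.θ_pos.le,
      ← Real.rpow_mul h.θ_pos.le, mul_comm]
  have h1 := abs_perronFrobenius_iterate_le h.finite_fibre h.weight_nonneg (φ := φ)
    (ψ := (B + H * t ^ (ζ : ℝ)) • (1 : M → ℝ) + (H * t ^ (ζ : ℝ) * t⁻¹) • (Metric.infDist · S))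
    (fun y => by
      refine (hφ y).trans ?_
      have := rpow_le_rpow_add_mul ζ.coe_nonneg (by exact_mod_cast hζ1) htpos
        (Metric.infDist_nonneg (x := y) (s := S))
      have := mul_le_mul_of_nonneg_left this hH
      simp only [Pi.add_apply, Pi.smul_apply, Pi.one_apply, smul_eq_mul]
      linarith) n x
  rw [perronFrobenius_iterate_add h.finite_fibre, perronFrobenius_iterate_smul h.finite_fibre,
    perronFrobenius_iterate_smul h.finite_fibre] at h1
  refine h1.trans ?_
  simp only [Pi.add_apply, Pi.smul_apply, smul_eq_mul]
  have h2 : (perronFrobenius f ρ)^[n] (Metric.infDist · S) x ≤ t * Metric.diam (univ : Set M) := by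
    refine (h.iterate_infDist_le n x).trans (mul_le_mul_of_nonneg_left ?_ htpos.le)
    obtain ⟨s, hs⟩ := h.nonempty
    exact (Metric.infDist_le_dist_of_mem hs).trans
      (Metric.dist_le_diam_of_mem isCompact_univ.isBounded (mem_univ _) (mem_univ _))
  have h3 : 0 ≤ H * t ^ (ζ : ℝ) * t⁻¹ := by positivity
  have h4 := mul_le_mul_of_nonneg_left h2 h3
  rw [show H * t ^ (ζ : ℝ) * t⁻¹ * (t * Metric.diam (univ : Set M)) =
    H * t ^ (ζ : ℝ) * Metric.diam (univ : Set M) by field_simp] at h4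
  rw [← htζ]
  linarith

lemma rpow_θ_lt_one (h : TransferSystem ζ f ρ S δ θ κ c C₀ C₁) (hζ0 : 0 < ζ) :
    θ ^ (ζ : ℝ) < 1 :=
  Real.rpow_lt_one h.θ_pos.le h.θ_lt_one (by exact_mod_cast hζ0)

/-- Off S the weights of the branches need not sum to 1. However, P1 - 1 is Hölder and vanishes on
S, hence is at most H₁ d(·, S)^ζ, and `abs_iterate_le` bounds P^(n+1) 1 - P^n 1 by a multiple of τ^n
with τ = θ^ζ. Each step multiplies the bound by at most 1 + E τ^n, and the infinite product
converges. -/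
lemma exists_iterate_one_le [CompactSpace M] (h : TransferSystem ζ f ρ S δ θ κ c C₀ C₁)
    (hζ0 : 0 < ζ) (hζ1 : ζ ≤ 1) : ∃ Λ, 1 ≤ Λ ∧ ∀ n x, (perronFrobenius f ρ)^[n] 1 x ≤ Λ := by
  have hC₁ : 1 ≤ C₁ := by
    obtain ⟨s, hs⟩ := h.nonempty
    exact (h.apply_one_eq s hs).ge.trans (h.apply_one_le s)
  set H₁ := C₀ + 2 * C₁ / δ ^ (ζ : ℝ) with hH₁
  have hδ' : 0 < δ ^ (ζ : ℝ) := Real.rpow_pos_of_pos h.δ_pos _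
  have hH₁0 : 0 ≤ H₁ := by have := h.C₀_nonneg; positivity
  have hhol : ∀ x y, |perronFrobenius f ρ 1 x - perronFrobenius f ρ 1 y| ≤
      H₁ * dist x y ^ (ζ : ℝ) := by
    refine abs_sub_le_of_local h.δ_pos h.C₀_nonneg (by linarith) (fun x y hxy => ?_) fun x => ?_
    · simpa using h.abs_sub_le 1 0 1 le_rfl zero_le_one (by simp) (by simp) x y hxy
    · exact (abs_of_nonneg (h.iterate_one_nonneg 1 x)).le.trans (h.apply_one_le x)
  have hone : ∀ x, |(perronFrobenius f ρ 1 + (-1 : ℝ) • (1 : M → ℝ)) x| ≤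
      0 + H₁ * Metric.infDist x S ^ (ζ : ℝ) := fun x => by
    obtain ⟨s, hs, hd⟩ := h.isClosed.isCompact.exists_infDist_eq_dist h.nonempty x
    have := hhol x s
    rw [h.apply_one_eq s hs] at this
    rw [hd, zero_add]
    simpa [sub_eq_add_neg] using this
  set τ := θ ^ (ζ : ℝ) with hτ
  have hτ0 : 0 < τ := Real.rpow_pos_of_pos h.θ_pos _
  have hτ1 : τ < 1 := h.rpow_θ_lt_one hζ0
  set D := Metric.diam (univ : Set M) with hD
  have hD0 : 0 ≤ D := Metric.diam_nonneg
  set E := H₁ * (1 + D) with hE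
  have hE0 : 0 ≤ E := by positivity
  have hind : ∀ n x, (perronFrobenius f ρ)^[n] 1 x ≤ Real.exp (E * ∑ k ∈ Finset.range n, τ ^ k) := by
    intro n
    induction n with
    | zero => intro x; simp
    | succ n ih =>
      intro x
      set s := Real.exp (E * ∑ k ∈ Finset.range n, τ ^ k) with hs
      have hs1 : 1 ≤ s := Real.one_le_exp (by positivity)
      have h1 := (abs_le.1 (h.abs_iterate_le hζ1 hH₁0 hone n x)).2
      rw [perronFrobenius_iterate_add h.finite_fibre, perronFrobenius_iterate_smul h.finite_fibre,
        ← Function.iterate_succ_apply] at h1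
      simp only [Pi.add_apply, Pi.smul_apply, smul_eq_mul, zero_mul, zero_add] at h1
      have h2 := ih x
      have h3 : H₁ * τ ^ n * ((perronFrobenius f ρ)^[n] 1 x + D) ≤ s * (E * τ ^ n) := by
        calc H₁ * τ ^ n * ((perronFrobenius f ρ)^[n] 1 x + D) ≤ H₁ * τ ^ n * (s + s * D) := by
              gcongr
              exact le_mul_of_one_le_left hD0 hs1
          _ = s * (E * τ ^ n) := by rw [hE]; ring
      have h4 : 1 + E * τ ^ n ≤ Real.exp (E * τ ^ n) := by
        linarith [Real.add_one_le_exp (E * τ ^ n)]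
      calc (perronFrobenius f ρ)^[n + 1] 1 x ≤ s * (1 + E * τ ^ n) := by linarith
        _ ≤ s * Real.exp (E * τ ^ n) := by gcongr
        _ = _ := by rw [hs, ← Real.exp_add, Finset.sum_range_succ, mul_add]
  refine ⟨Real.exp (E * (1 - τ)⁻¹), Real.one_le_exp ?_, fun n x => (hind n x).trans ?_⟩
  · have : 0 < 1 - τ := by linarith
    positivity
  · refine Real.exp_le_exp.2 (mul_le_mul_of_nonneg_left ?_ hE0)
    rw [← tsum_geometric_of_lt_one hτ0.le hτ1]
    exact (summable_geometric_of_lt_one hτ0.le hτ1).sum_le_tsum _ fun k _ => by positivity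

/-- The Lasota–Yorke inequality for all iterates. -/
lemma exists_lasotaYorke [CompactSpace M] (h : TransferSystem ζ f ρ S δ θ κ c C₀ C₁)
    (hζ0 : 0 < ζ) (hζ1 : ζ ≤ 1) : ∃ C, 0 < C ∧ ∀ φ : M → ℝ, MemHolder ζ φ → ∀ n,
      MemHolder ζ ((perronFrobenius f ρ)^[n] φ) ∧
      holderNorm ζ ((perronFrobenius f ρ)^[n] φ) ≤ θ ^ n * holderNorm ζ φ + C * supNorm φ := by
  obtain ⟨Λ, hΛ1, hΛ⟩ := h.exists_iterate_one_le hζ0 hζ1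
  have hδ' : 0 < δ ^ (ζ : ℝ) := Real.rpow_pos_of_pos h.δ_pos _
  have hθ : 0 < 1 - θ := by linarith [h.θ_lt_one]
  have hC₀ := h.C₀_nonneg
  have hΛ0 : 0 < Λ := by linarith
  refine ⟨C₀ * Λ / (1 - θ) + 2 * Λ / δ ^ (ζ : ℝ) + Λ, by positivity, fun φ hφ n => ?_⟩
  set B := supNorm φ with hB
  have hB0 : 0 ≤ B := supNorm_nonneg φ
  have hsup : ∀ n x, |(perronFrobenius f ρ)^[n] φ x| ≤ Λ * B := fun n x => by
    have h1 := abs_perronFrobenius_iterate_le h.finite_fibre h.weight_nonneg (φ := φ)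
      (ψ := B • (1 : M → ℝ)) (fun y => by simpa using hφ.abs_le_supNorm hζ0 y) n x
    rw [perronFrobenius_iterate_smul h.finite_fibre] at h1
    refine h1.trans ?_
    rw [Pi.smul_apply, smul_eq_mul, mul_comm]
    exact mul_le_mul_of_nonneg_right (hΛ n x) hB0
  set H := (nnHolderNorm ζ φ : ℝ) with hH
  have hH0 : 0 ≤ H := NNReal.coe_nonneg _
  -- The local inequality is iterated before globalising, so the rate θ is kept. The constant C₀ Λ /
  -- (1 - θ) is the fixed point of a ↦ θ a + C₀ Λ.
  have hloc : ∀ n x y, dist x y < δ →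
      |(perronFrobenius f ρ)^[n] φ x - (perronFrobenius f ρ)^[n] φ y| ≤
        (θ ^ n * H + C₀ * Λ / (1 - θ) * B) * dist x y ^ (ζ : ℝ) := by
    intro n
    induction n with
    | zero =>
      intro x y _
      refine (hφ.abs_sub_le x y).trans (mul_le_mul_of_nonneg_right ?_ (by positivity))
      have : 0 ≤ C₀ * Λ / (1 - θ) * B := by positivity
      simp only [pow_zero, one_mul]
      linarith
    | succ n ih =>
      intro x y hxy
      rw [Function.iterate_succ_apply']
      have hnn : 0 ≤ θ ^ n * H + C₀ * Λ / (1 - θ) * B := by have := h.θ_pos; positivity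
      refine (h.abs_sub_le _ _ (Λ * B) hnn (by positivity) ih (hsup n) x y hxy).trans (le_of_eq ?_)
      congr 1
      field_simp
      ring
  have hH' : 0 ≤ θ ^ n * H + C₀ * Λ / (1 - θ) * B := by have := h.θ_pos; positivity
  have hglob := abs_sub_le_of_local h.δ_pos hH' (by positivity) (hloc n) (hsup n)
  have hpos : 0 ≤ θ ^ n * H + C₀ * Λ / (1 - θ) * B + 2 * (Λ * B) / δ ^ (ζ : ℝ) := by positivity
  refine ⟨memHolder_of_abs_sub_le hpos hglob, ?_⟩
  refine (holderNorm_le_add hpos (by positivity) hglob (hsup n)).trans ?_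
  have h5 : θ ^ n * H ≤ θ ^ n * holderNorm ζ φ :=
    mul_le_mul_of_nonneg_left (nnHolderNorm_le_holderNorm ζ φ) (pow_nonneg h.θ_pos.le n)
  have h6 : 2 * (Λ * B) / δ ^ (ζ : ℝ) = 2 * Λ / δ ^ (ζ : ℝ) * B := by ring
  rw [h6]
  linarith

end TransferSystem

end Transfer

/-! ### Decay on zero-average functions by a Doeblin argument -/

section Mixing

namespace TransferSystem

variable {M : Type*} [MetricSpace M]
variable {ζ : ℝ≥0} {f : M → M} {ρ : M → ℝ} {S : Set M} {δ θ κ c C₀ C₁ : ℝ}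

lemma exists_iterate_branches (h : TransferSystem ζ f ρ S δ θ κ c C₀ C₁) (n : ℕ) (x y : M) :
    ∃ u v, f^[n] u = x ∧ f^[n] v = y ∧ dist u v ≤ κ ^ n * dist x y := by
  induction n with
  | zero => exact ⟨x, y, rfl, rfl, by simp⟩
  | succ n ih =>
    obtain ⟨u, v, hu, hv, huv⟩ := ih
    obtain ⟨u', v', hu', hv', h'⟩ := h.exists_branches u v
    refine ⟨u', v', by rw [Function.iterate_succ_apply, hu', hu],
      by rw [Function.iterate_succ_apply, hv', hv], h'.trans ?_⟩
    calc κ * dist u v ≤ κ * (κ ^ n * dist x y) := mul_le_mul_of_nonneg_left huv h.κ_nonneg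
      _ = _ := by ring

lemma mem_of_iterate_mem (h : TransferSystem ζ f ρ S δ θ κ c C₀ C₁) (n : ℕ) {u : M}
    (hu : f^[n] u ∈ S) : u ∈ S := by
  induction n generalizing u with
  | zero => exact hu
  | succ n ih => exact h.backward u (ih (by rwa [Function.iterate_succ_apply] at hu))

lemma iterate_const_add (h : TransferSystem ζ f ρ S δ θ κ c C₀ C₁) (a b : ℝ) (φ : M → ℝ) (n : ℕ)
    {x : M} (hx : x ∈ S) :
    (perronFrobenius f ρ)^[n] (a • (1 : M → ℝ) + b • φ) x =
      a + b * (perronFrobenius f ρ)^[n] φ x := by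
  rw [perronFrobenius_iterate_add h.finite_fibre, perronFrobenius_iterate_smul h.finite_fibre,
    perronFrobenius_iterate_smul h.finite_fibre]
  simp [h.iterate_one_eq n hx]

/-- A Doeblin-type argument: the oscillation on `S` of a function that is nearly constant along
pairs of contracting branches decreases. -/
lemma oscillation_iterate_le [CompactSpace M] (h : TransferSystem ζ f ρ S δ θ κ c C₀ C₁)
    {φ : M → ℝ} (hφc : Continuous φ) {o : ℝ} {n : ℕ}
    (hosc : ∀ x ∈ S, ∀ y ∈ S, φ x - φ y ≤ o)
    (hbranch : ∀ u v, dist u v ≤ κ ^ n * Metric.diam (univ : Set M) → |φ u - φ v| ≤ o / 4) :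
    ∀ x ∈ S, ∀ y ∈ S,
      (perronFrobenius f ρ)^[n] φ x - (perronFrobenius f ρ)^[n] φ y ≤ (1 - c ^ n / 4) * o := by
  intro x hx y hy
  obtain ⟨w, hw, hmin⟩ := h.isClosed.isCompact.exists_isMinOn h.nonempty hφc.continuousOn
  have ho : 0 ≤ o := by simpa using hosc x hx x hx
  have hcn : 0 ≤ c ^ n := pow_nonneg h.c_pos.le n
  obtain ⟨u, v, hu, hv, huv⟩ := h.exists_iterate_branches n x y
  have huS : u ∈ S := h.mem_of_iterate_mem n (hu ▸ hx)
  have hvS : v ∈ S := h.mem_of_iterate_mem n (hv ▸ hy)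
  have hclose := abs_le.1 (hbranch u v (huv.trans (mul_le_mul_of_nonneg_left
    (Metric.dist_le_diam_of_mem isCompact_univ.isBounded (mem_univ _) (mem_univ _))
    (pow_nonneg h.κ_nonneg n))))
  have hlow : ∀ z ∈ S, 0 ≤ ((-φ w) • (1 : M → ℝ) + (1 : ℝ) • φ) z := fun z hz => by
    have : φ w ≤ φ z := hmin hz
    simp only [Pi.add_apply, Pi.smul_apply, Pi.one_apply, smul_eq_mul]
    linarith
  have hupp : ∀ z ∈ S, 0 ≤ ((o + φ w) • (1 : M → ℝ) + (-1 : ℝ) • φ) z := fun z hz => by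
    have := hosc z hz w hw
    simp only [Pi.add_apply, Pi.smul_apply, Pi.one_apply, smul_eq_mul]
    linarith
  -- The branch through v keeps the image at y above the minimum φ w, the branch through u keeps the
  -- image at x below φ w + o. As φ u and φ v differ by at most o/4, the two gains add up to at
  -- least c^n · 3o/4, of which a third is enough.
  have ey := pow_mul_le_perronFrobenius_iterate h.finite_fibre h.c_pos.le h.le_weight h.backward
    hlow n (u := v) (hv ▸ hy)
  have ex := pow_mul_le_perronFrobenius_iterate h.finite_fibre h.c_pos.le h.le_weight h.backward
    hupp n (u := u) (hu ▸ hx)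
  rw [hv, h.iterate_const_add _ _ _ _ hy] at ey
  rw [hu, h.iterate_const_add _ _ _ _ hx] at ex
  simp only [Pi.add_apply, Pi.smul_apply, Pi.one_apply, smul_eq_mul] at ex ey
  have hlu := hlow u huS
  have hlv := hlow v hvS
  have huu := hupp u huS
  simp only [Pi.add_apply, Pi.smul_apply, Pi.one_apply, smul_eq_mul] at hlu hlv huu
  have hsum : c ^ n * (o / 4) ≤ c ^ n * (-φ w * 1 + 1 * φ v) + c ^ n * ((o + φ w) * 1 + -1 * φ u) := by
    rw [← mul_add]
    refine mul_le_mul_of_nonneg_left ?_ hcn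
    linarith
  linarith

/-- All iterates have Hölder constant at most 1 + C by the Lasota–Yorke inequality, so a single n
makes each of them vary by at most η/4 along contracting pairs of n-th branches. As long as the
bound on the oscillation is at least η, `oscillation_iterate_le` applies with this n and improves it
by the factor 1 - c^n/4; this accounts for the maximum with η in the induction. -/
lemma exists_oscillation_le [CompactSpace M] (h : TransferSystem ζ f ρ S δ θ κ c C₀ C₁)
    (hζ0 : 0 < ζ) (hζ1 : ζ ≤ 1) {η : ℝ} (hη : 0 < η) :
    ∃ k, ∀ φ : M → ℝ, MemHolder ζ φ → holderNorm ζ φ ≤ 1 → ∀ x ∈ S, ∀ y ∈ S,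
      (perronFrobenius f ρ)^[k] φ x - (perronFrobenius f ρ)^[k] φ y ≤ η := by
  obtain ⟨C, hC, hLY⟩ := h.exists_lasotaYorke hζ0 hζ1
  set D := Metric.diam (univ : Set M)
  have hζ0' : (0 : ℝ) < ζ := by exact_mod_cast hζ0
  have htend : Tendsto (fun n : ℕ => (1 + C) * (κ ^ n * D) ^ (ζ : ℝ)) atTop (𝓝 0) := by
    have h1 : Tendsto (fun n : ℕ => κ ^ n * D) atTop (𝓝 0) := by
      simpa using (tendsto_pow_atTop_nhds_zero_of_lt_one h.κ_nonneg h.κ_lt_one).mul_const D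
    have h2 := (h1.rpow_const (p := (ζ : ℝ)) (Or.inr hζ0'.le)).const_mul (1 + C)
    simpa [Real.zero_rpow hζ0'.ne'] using h2
  obtain ⟨n, hn⟩ := (htend.eventually_le_const (show (0 : ℝ) < η / 4 by positivity)).exists
  have hcn : 0 < c ^ n := pow_pos h.c_pos n
  -- At a point of S the weights of the branches sum to 1, so none exceeds 1. This makes the factor
  -- 1 - c^n/4 nonnegative.
  have hc1 : c ≤ 1 := by
    obtain ⟨s, hs⟩ := h.nonempty
    obtain ⟨u, -, hu, -⟩ := h.exists_branches s s
    have := mul_le_perronFrobenius h.finite_fibre h.c_pos.le h.le_weight h.backward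
      (φ := 1) (fun _ _ => by simp) (u := u) (hu ▸ hs)
    rw [hu, h.apply_one_eq s hs] at this
    simpa using this
  have hcn1 : c ^ n ≤ 1 := pow_le_one₀ h.c_pos.le hc1
  have hγ0 : 0 ≤ 1 - c ^ n / 4 := by linarith
  have hγ1 : 1 - c ^ n / 4 < 1 := by linarith
  obtain ⟨j, hj⟩ := (((tendsto_pow_atTop_nhds_zero_of_lt_one hγ0 hγ1).mul_const
    (2 : ℝ)).eventually_le_const (show (0 : ℝ) * 2 < η by simpa using hη)).exists
  refine ⟨n * j, fun φ hφ hφ1 => ?_⟩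
  have hbound : ∀ k, MemHolder ζ ((perronFrobenius f ρ)^[k] φ) ∧
      (nnHolderNorm ζ ((perronFrobenius f ρ)^[k] φ) : ℝ) ≤ 1 + C := fun k => by
    obtain ⟨h1, h2⟩ := hLY φ hφ k
    refine ⟨h1, (nnHolderNorm_le_holderNorm ζ _).trans (h2.trans (add_le_add ?_ ?_))⟩
    · exact mul_le_one₀ (pow_le_one₀ h.θ_pos.le h.θ_lt_one.le) (holderNorm_nonneg _ _) hφ1
    · exact mul_le_of_le_one_right hC.le ((supNorm_le_holderNorm ζ φ).trans hφ1)
  have key : ∀ i, ∀ x ∈ S, ∀ y ∈ S,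
      (perronFrobenius f ρ)^[n * i] φ x - (perronFrobenius f ρ)^[n * i] φ y ≤
        max η ((1 - c ^ n / 4) ^ i * 2) := by
    intro i
    induction i with
    | zero =>
      intro x _ y _
      refine le_max_of_le_right ?_
      have h1 := abs_le.1 ((hφ.abs_le_supNorm hζ0 x).trans (supNorm_le_holderNorm ζ φ))
      have h2 := abs_le.1 ((hφ.abs_le_supNorm hζ0 y).trans (supNorm_le_holderNorm ζ φ))
      simp only [mul_zero, Function.iterate_zero, id_eq, pow_zero]
      linarith
    | succ i ih =>
      intro x hx y hy
      obtain ⟨hm, hnorm⟩ := hbound (n * i)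
      have := h.oscillation_iterate_le (hm.continuous hζ0) (n := n) ih (fun u v huv => by
        refine (hm.abs_sub_le u v).trans ?_
        calc (nnHolderNorm ζ ((perronFrobenius f ρ)^[n * i] φ) : ℝ) * dist u v ^ (ζ : ℝ)
            ≤ (1 + C) * (κ ^ n * D) ^ (ζ : ℝ) := by gcongr
          _ ≤ η / 4 := hn
          _ ≤ _ := by gcongr; exact le_max_left _ _) x hx y hy
      rw [← Function.iterate_add_apply, show n + n * i = n * (i + 1) by ring] at this
      refine this.trans ?_
      rw [mul_max_of_nonneg _ _ hγ0]
      refine max_le_max (mul_le_of_le_one_left hη.le hγ1.le) (le_of_eq (by ring))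
  intro x hx y hy
  exact (key j x hx y hy).trans (max_le le_rfl hj)

/-- Zero-average Hölder functions are contracted by some iterate. -/
lemma exists_half_contraction [CompactSpace M] [MeasurableSpace M] [BorelSpace M]
    (h : TransferSystem ζ f ρ S δ θ κ c C₀ C₁)
    (hζ0 : 0 < ζ) (hζ1 : ζ ≤ 1) (m : Measure M) [IsProbabilityMeasure m] (hS : ∀ᵐ x ∂m, x ∈ S)
    (hint : ∀ φ : M → ℝ, Continuous φ → ∫ x, perronFrobenius f ρ φ x ∂m = ∫ x, φ x ∂m) :
    (∀ φ : M → ℝ, MemHolder ζ φ → ∀ n,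
      ∫ x, (perronFrobenius f ρ)^[n] φ x ∂m = ∫ x, φ x ∂m) ∧
    ∃ N, 1 ≤ N ∧ ∀ φ : M → ℝ, MemHolder ζ φ → ∫ x, φ x ∂m = 0 → holderNorm ζ φ ≤ 1 →
      holderNorm ζ ((perronFrobenius f ρ)^[N] φ) ≤ 1 / 2 := by
  obtain ⟨C, hC, hLY⟩ := h.exists_lasotaYorke hζ0 hζ1
  obtain ⟨Λ, hΛ1, hΛ⟩ := h.exists_iterate_one_le hζ0 hζ1
  have hmean : ∀ φ : M → ℝ, MemHolder ζ φ → ∀ n,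
      ∫ x, (perronFrobenius f ρ)^[n] φ x ∂m = ∫ x, φ x ∂m := by
    intro φ hφ n
    induction n with
    | zero => rfl
    | succ n ih =>
      rw [← ih, Function.iterate_succ_apply']
      exact hint _ ((hLY φ hφ n).1.continuous hζ0)
  refine ⟨hmean, ?_⟩
  set D := Metric.diam (univ : Set M)
  have hD0 : 0 ≤ D := Metric.diam_nonneg
  -- Three waiting times: k makes the function small on S, n carries this smallness to the sup norm
  -- on M, and l lets the Hölder part decay. The thresholds are set so that the last Lasota–Yorke
  -- estimate reads 1/4 + 1/4.
  obtain ⟨n, hn⟩ := (((tendsto_pow_atTop_nhds_zero_of_lt_one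
    (Real.rpow_nonneg h.θ_pos.le _) (h.rpow_θ_lt_one hζ0)).const_mul
    ((1 + C) * (Λ + D))).eventually_le_const (show (1 + C) * (Λ + D) * 0 < 1 / (8 * C) by
      rw [mul_zero]; positivity)).exists
  obtain ⟨l, hl1, hl⟩ := ((eventually_ge_atTop 1).and (((tendsto_pow_atTop_nhds_zero_of_lt_one
    h.θ_pos.le h.θ_lt_one).mul_const (1 + C)).eventually_le_const
      (show (0 : ℝ) * (1 + C) < 1 / 4 by norm_num))).exists
  obtain ⟨k, hk⟩ := h.exists_oscillation_le hζ0 hζ1 (η := 1 / (8 * C * Λ)) (by positivity)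
  refine ⟨l + (n + k), by omega, fun φ hφ hzero hφ1 => ?_⟩
  have hbound : ∀ k, MemHolder ζ ((perronFrobenius f ρ)^[k] φ) ∧
      holderNorm ζ ((perronFrobenius f ρ)^[k] φ) ≤ 1 + C := fun k => by
    obtain ⟨h1, h2⟩ := hLY φ hφ k
    refine ⟨h1, h2.trans (add_le_add ?_ ?_)⟩
    · exact mul_le_one₀ (pow_le_one₀ h.θ_pos.le h.θ_lt_one.le) (holderNorm_nonneg _ _) hφ1
    · exact mul_le_of_le_one_right hC.le ((supNorm_le_holderNorm ζ φ).trans hφ1)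
  obtain ⟨hmk, hnk⟩ := hbound k
  have hik : Integrable ((perronFrobenius f ρ)^[k] φ) m :=
    (hmk.continuous hζ0).integrable_of_hasCompactSupport (HasCompactSupport.of_compactSpace _)
  -- A function of mean zero for a measure carried by S is bounded on S by its oscillation there.
  have hSsmall : ∀ x ∈ S, |(perronFrobenius f ρ)^[k] φ x| ≤ 1 / (8 * C * Λ) := by
    intro x hx
    have hz : ∫ y, (perronFrobenius f ρ)^[k] φ y ∂m = 0 := (hmean φ hφ k).trans hzero
    refine abs_le.2 ⟨?_, ?_⟩
    · have := integral_mono_ae hik (integrable_const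
        ((perronFrobenius f ρ)^[k] φ x + 1 / (8 * C * Λ))) (by
          filter_upwards [hS] with y hy
          linarith [hk φ hφ hφ1 y hy x hx])
      rw [hz] at this
      simp only [integral_const, probReal_univ, one_smul] at this
      linarith
    · have := integral_mono_ae (integrable_const
        ((perronFrobenius f ρ)^[k] φ x - 1 / (8 * C * Λ))) hik (by
          filter_upwards [hS] with y hy
          linarith [hk φ hφ hφ1 x hx y hy])
      rw [hz] at this
      simp only [integral_const, probReal_univ, one_smul] at this
      linarith
  have hpt : ∀ x, |(perronFrobenius f ρ)^[k] φ x| ≤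
      1 / (8 * C * Λ) + (1 + C) * Metric.infDist x S ^ (ζ : ℝ) := fun x => by
    obtain ⟨s, hs, hd⟩ := h.isClosed.isCompact.exists_infDist_eq_dist h.nonempty x
    have h1 := (hmk.abs_sub_le x s).trans (mul_le_mul_of_nonneg_right
      ((nnHolderNorm_le_holderNorm ζ _).trans hnk) (by positivity))
    rw [hd]
    have h2 := abs_add_le ((perronFrobenius f ρ)^[k] φ s)
      ((perronFrobenius f ρ)^[k] φ x - (perronFrobenius f ρ)^[k] φ s)
    rw [add_sub_cancel] at h2
    linarith [hSsmall s hs]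
  have hsup : supNorm ((perronFrobenius f ρ)^[n + k] φ) ≤ 1 / (4 * C) := by
    refine supNorm_le_of_abs_le (by positivity) fun x => ?_
    rw [Function.iterate_add_apply]
    refine (h.abs_iterate_le hζ1 (by positivity) hpt n x).trans ?_
    have e1 : 1 / (8 * C * Λ) * (perronFrobenius f ρ)^[n] 1 x ≤ 1 / (8 * C) := by
      calc 1 / (8 * C * Λ) * (perronFrobenius f ρ)^[n] 1 x ≤ 1 / (8 * C * Λ) * Λ := by
            gcongr
            exact hΛ n x
        _ = _ := by field_simp
    have e2 : (1 + C) * (θ ^ (ζ : ℝ)) ^ n * ((perronFrobenius f ρ)^[n] 1 x + D) ≤ 1 / (8 * C) := by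
      refine le_trans ?_ hn
      have := Real.rpow_nonneg h.θ_pos.le (ζ : ℝ)
      calc (1 + C) * (θ ^ (ζ : ℝ)) ^ n * ((perronFrobenius f ρ)^[n] 1 x + D)
          ≤ (1 + C) * (θ ^ (ζ : ℝ)) ^ n * (Λ + D) := by
            gcongr
            exact hΛ n x
        _ = _ := by ring
    calc _ ≤ 1 / (8 * C) + 1 / (8 * C) := add_le_add e1 e2
      _ = _ := by field_simp; norm_num
  obtain ⟨hmnk, hnnk⟩ := hbound (n + k)
  rw [Function.iterate_add_apply _ l]
  refine ((hLY _ hmnk l).2).trans ?_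
  have e1 : θ ^ l * holderNorm ζ ((perronFrobenius f ρ)^[n + k] φ) ≤ 1 / 4 :=
    (mul_le_mul_of_nonneg_left hnnk (pow_nonneg h.θ_pos.le l)).trans hl
  have e2 : C * supNorm ((perronFrobenius f ρ)^[n + k] φ) ≤ 1 / 4 := by
    refine (mul_le_mul_of_nonneg_left hsup hC.le).trans (le_of_eq ?_)
    field_simp
  linarith

/-- Exponential decay of the iterates on zero-average Hölder functions. -/
lemma exists_isBaseDecayRate [CompactSpace M] [MeasurableSpace M] [BorelSpace M]
    (h : TransferSystem ζ f ρ S δ θ κ c C₀ C₁)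
    (hζ0 : 0 < ζ) (hζ1 : ζ ≤ 1) (m : Measure M) [IsProbabilityMeasure m] (hS : ∀ᵐ x ∂m, x ∈ S)
    (hint : ∀ φ : M → ℝ, Continuous φ → ∫ x, perronFrobenius f ρ φ x ∂m = ∫ x, φ x ∂m) :
    ∃ r : ℝ, 0 < r ∧ r < 1 ∧ IsBaseDecayRate ζ m f ρ r := by
  obtain ⟨C, hC, hLY⟩ := h.exists_lasotaYorke hζ0 hζ1
  obtain ⟨hmean, N, hN1, hN⟩ := h.exists_half_contraction hζ0 hζ1 m hS hint
  have hNpos : (0 : ℝ) < N := by exact_mod_cast hN1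
  have hhalf : ∀ φ : M → ℝ, MemHolder ζ φ → ∫ x, φ x ∂m = 0 →
      holderNorm ζ ((perronFrobenius f ρ)^[N] φ) ≤ 1 / 2 * holderNorm ζ φ := by
    intro φ hφ hz
    -- Normalising by any a > 0 not below the norm, instead of the norm itself, also covers
    -- functions of norm zero.
    have haux : ∀ a > 0, holderNorm ζ φ ≤ a →
        holderNorm ζ ((perronFrobenius f ρ)^[N] φ) ≤ 1 / 2 * a := by
      intro a ha hφa
      have h1 := hN (a⁻¹ • φ) hφ.smul (by simp [integral_const_mul, hz]) (by
        rw [holderNorm_smul _ hφ, abs_of_pos (inv_pos.2 ha), inv_mul_le_one₀ ha]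
        exact hφa)
      rw [perronFrobenius_iterate_smul h.finite_fibre, holderNorm_smul _ (hLY φ hφ N).1,
        abs_of_pos (inv_pos.2 ha), inv_mul_le_iff₀ ha] at h1
      linarith
    refine le_of_forall_pos_le_add fun η hη => ?_
    have := haux (holderNorm ζ φ + 2 * η) (by linarith [holderNorm_nonneg ζ φ]) (by linarith)
    linarith
  have hpow : ∀ j, ∀ φ : M → ℝ, MemHolder ζ φ → ∫ x, φ x ∂m = 0 →
      holderNorm ζ ((perronFrobenius f ρ)^[N * j] φ) ≤ (1 / 2) ^ j * holderNorm ζ φ := by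
    intro j φ hφ hz
    induction j with
    | zero => simp
    | succ j ih =>
      have h1 := hhalf _ (hLY φ hφ (N * j)).1 ((hmean φ hφ _).trans hz)
      rw [← Function.iterate_add_apply, show N + N * j = N * (j + 1) by ring] at h1
      refine h1.trans ?_
      rw [pow_succ']
      linarith
  -- Here r^N = 1/2. Rounding n down to a multiple of N costs the factor 2, and the n % N leftover
  -- iterates cost the factor 1 + C.
  set r := (1 / 2 : ℝ) ^ (1 / (N : ℝ)) with hr
  have hr0 : 0 < r := Real.rpow_pos_of_pos (by norm_num) _
  have hr1 : r < 1 := Real.rpow_lt_one (by norm_num) (by norm_num) (by positivity)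
  have hrN : r ^ N = 1 / 2 := by
    rw [hr, ← Real.rpow_natCast, ← Real.rpow_mul (by norm_num), one_div_mul_cancel hNpos.ne',
      Real.rpow_one]
  refine ⟨r, hr0, hr1, 2 * (1 + C), by positivity, fun φ hφ hz n _ => ?_⟩
  have hn : n = n % N + N * (n / N) := (Nat.mod_add_div n N).symm
  have hr2 : (1 / 2 : ℝ) ^ (n / N) ≤ 2 * r ^ n := by
    have h1 : r ^ (N * (n / N + 1)) ≤ r ^ n := by
      refine pow_le_pow_of_le_one hr0.le hr1.le ?_
      have := Nat.mod_lt n hN1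
      rw [mul_add, mul_one]
      omega
    rw [pow_mul, hrN, pow_succ] at h1
    linarith
  have h1 := (hLY _ (hLY φ hφ (N * (n / N))).1 (n % N)).2
  rw [← Function.iterate_add_apply, ← hn] at h1
  have h2 := hpow (n / N) φ hφ hz
  set A := holderNorm ζ ((perronFrobenius f ρ)^[N * (n / N)] φ)
  have hA0 : 0 ≤ A := holderNorm_nonneg _ _
  calc holderNorm ζ ((perronFrobenius f ρ)^[n] φ)
      ≤ 1 * A + C * A := h1.trans (add_le_add (mul_le_mul_of_nonneg_right
        (pow_le_one₀ h.θ_pos.le h.θ_lt_one.le) hA0)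
        (mul_le_mul_of_nonneg_left (supNorm_le_holderNorm ζ _) hC.le))
    _ = (1 + C) * A := by ring
    _ ≤ (1 + C) * (2 * r ^ n * holderNorm ζ φ) := by
        refine mul_le_mul_of_nonneg_left (h2.trans ?_) (by positivity)
        exact mul_le_mul_of_nonneg_right hr2 (holderNorm_nonneg _ _)
    _ = _ := by ring

end TransferSystem

end Mixing

/-! ### From fibre pairings to the abstract base system -/

section Verification

variable {M : Type*} {f : M → M} {ρ : M → ℝ}

lemma perronFrobenius_eq_sum_subtype (φ : M → ℝ) (x : M) [Fintype (f ⁻¹' {x})] :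
    perronFrobenius f ρ φ x = ∑ u : f ⁻¹' {x}, φ u * ρ u := by
  rw [perronFrobenius, ← finsum_set_coe_eq_finsum_mem, finsum_eq_sum_of_fintype]

/-- As a ≤ b, counting exactly q exceptional indices instead of at most q only increases the bound.
-/
lemma sum_le_of_card_le {ι : Type*} [Fintype ι] (T : Finset ι) {q : ℕ} (hT : T.card ≤ q)
    {g : ι → ℝ} {a b : ℝ} (hab : a ≤ b) (hb : ∀ u ∈ T, g u ≤ b) (ha : ∀ u ∉ T, g u ≤ a) :
    ∑ u, g u ≤ ((Fintype.card ι : ℝ) - q) * a + q * b := by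
  classical
  rw [← Finset.sum_add_sum_compl T]
  have h1 : ∑ u ∈ T, g u ≤ T.card * b := by
    simpa using Finset.sum_le_card_nsmul T g b hb
  have h2 : ∑ u ∈ Tᶜ, g u ≤ (Tᶜ.card : ℝ) * a := by
    simpa using Finset.sum_le_card_nsmul Tᶜ g a fun u hu => ha u (Finset.mem_compl.1 hu)
  have h3 : (T.card : ℝ) + Tᶜ.card = Fintype.card ι := by
    exact_mod_cast Finset.card_add_card_compl T
  have h4 : (T.card : ℝ) ≤ q := by exact_mod_cast hT
  have h5 : (Tᶜ.card : ℝ) = Fintype.card ι - T.card := by linarith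
  rw [h5] at h2
  nlinarith [mul_nonneg (sub_nonneg.2 h4) (sub_nonneg.2 hab)]

variable [MetricSpace M]

/-- Concatenating local pairings along a geodesic gives a bijection of any two fibres which
contracts the distance on average. -/
lemma exists_fibre_equiv_sum_dist_le
    (hgeo : ∀ (x y : M) (a : ℝ), 0 ≤ a → a ≤ 1 →
      ∃ z, dist x z ≤ a * dist x y ∧ dist z y ≤ (1 - a) * dist x y)
    (hfin : ∀ x, (f ⁻¹' {x}).Finite) {D q : ℕ} (hcard : ∀ x, (f ⁻¹' {x}).ncard = D)
    {a b δ : ℝ} (hδ : 0 < δ) (hab : a ≤ b) (ha : 0 ≤ a) (hqD : q ≤ D)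
    (hpair : ∀ x y, dist x y < δ → FibrePairing f q a b x y) (x y : M) :
    ∃ e : f ⁻¹' {x} ≃ f ⁻¹' {y}, ∑ᶠ u : f ⁻¹' {x}, dist (u : M) (e u) ≤
      (((D : ℝ) - q) * a + q * b) * dist x y := by
  have hft : ∀ x, Fintype (f ⁻¹' {x}) := fun x => (hfin x).fintype
  set W := ((D : ℝ) - q) * a + q * b with hW
  have hW0 : 0 ≤ W := by
    have : (q : ℝ) ≤ D := by exact_mod_cast hqD
    have : 0 ≤ b := ha.trans hab
    have : 0 ≤ (D : ℝ) - q := by linarith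
    positivity
  suffices h : ∀ (n : ℕ) (x y : M), dist x y < (n + 1) * δ →
      ∃ e : f ⁻¹' {x} ≃ f ⁻¹' {y}, ∑ᶠ u : f ⁻¹' {x}, dist (u : M) (e u) ≤ W * dist x y by
    obtain ⟨n, hn⟩ := exists_nat_gt (dist x y / δ)
    refine h n x y ?_
    rw [div_lt_iff₀ hδ] at hn
    linarith
  intro n
  induction n with
  | zero =>
    intro x y hxy
    obtain ⟨e, T, hT, hTb, hTa⟩ := hpair x y (by simpa using hxy)
    refine ⟨e, ?_⟩
    rw [finsum_eq_sum_of_fintype]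
    refine (sum_le_of_card_le T hT (mul_le_mul_of_nonneg_right hab dist_nonneg) hTb hTa).trans
      (le_of_eq ?_)
    have : (Fintype.card (f ⁻¹' {x}) : ℝ) = D := by
      rw [← hcard x, Set.ncard_eq_toFinset_card', Set.toFinset_card]
    rw [this, hW]
    ring
  | succ n ih =>
    intro x y hxy
    have hn : (0 : ℝ) < n + 2 := by positivity
    push_cast at hxy
    -- A distance below (n + 2) δ is cut at the fraction 1/(n + 2): the first piece is shorter than
    -- δ, the second shorter than (n + 1) δ.
    obtain ⟨z, hz1, hz2⟩ := hgeo x y (1 / (n + 2)) (by positivity)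
      (by rw [div_le_one hn]; linarith [(Nat.cast_nonneg n : (0 : ℝ) ≤ n)])
    have hDn : 1 / ((n : ℝ) + 2) * dist x y < δ := by
      rw [one_div_mul_eq_div, div_lt_iff₀ hn]; linarith
    have hDn2 : (1 - 1 / ((n : ℝ) + 2)) * dist x y < (n + 1) * δ := by
      have : (1 - 1 / ((n : ℝ) + 2)) = (n + 1) / (n + 2) := by field_simp; ring
      rw [this, div_mul_eq_mul_div, div_lt_iff₀ hn]
      have hn1 : (0 : ℝ) < n + 1 := by positivity
      nlinarith
    obtain ⟨e₂, he₂⟩ := ih z y (hz2.trans_lt hDn2)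
    obtain ⟨e₁, T, hT, hTb, hTa⟩ := hpair x z (hz1.trans_lt hDn)
    have he₁ : ∑ u : f ⁻¹' {x}, dist (u : M) (e₁ u) ≤ W * dist x z := by
      refine (sum_le_of_card_le T hT (mul_le_mul_of_nonneg_right hab dist_nonneg) hTb hTa).trans
        (le_of_eq ?_)
      have : (Fintype.card (f ⁻¹' {x}) : ℝ) = D := by
        rw [← hcard x, Set.ncard_eq_toFinset_card', Set.toFinset_card]
      rw [this, hW]
      ring
    rw [finsum_eq_sum_of_fintype] at he₂
    refine ⟨e₁.trans e₂, ?_⟩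
    rw [finsum_eq_sum_of_fintype]
    calc ∑ u : f ⁻¹' {x}, dist (u : M) (e₂ (e₁ u))
        ≤ ∑ u : f ⁻¹' {x}, (dist (u : M) (e₁ u) + dist (e₁ u : M) (e₂ (e₁ u))) :=
          Finset.sum_le_sum fun u _ => dist_triangle _ _ _
      _ = ∑ u : f ⁻¹' {x}, dist (u : M) (e₁ u) +
            ∑ v : f ⁻¹' {z}, dist (v : M) (e₂ v) := by
          rw [Finset.sum_add_distrib, Equiv.sum_comp e₁ fun v => dist (v : M) (e₂ v)]
      _ ≤ W * dist x z + W * dist z y := add_le_add he₁ he₂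
      _ ≤ W * dist x y := by
          rw [← mul_add]
          refine mul_le_mul_of_nonneg_left ?_ hW0
          linarith

/-- A displacement up to L t may leave the range δ in which the Hölder bound is known. It is split
into pieces of length at most t and (L - 1) t, both below δ because L ≤ 2; this produces 1 + (L -
1)^ζ. The extra factor L^ζ ≥ 1 is slack that matches the smallness condition. -/
lemma abs_sub_le_of_local_of_split {ζ : ℝ≥0}
    (hgeo : ∀ (x y : M) (a : ℝ), 0 ≤ a → a ≤ 1 →
      ∃ z, dist x z ≤ a * dist x y ∧ dist z y ≤ (1 - a) * dist x y)
    {φ : M → ℝ} {δ H L t : ℝ} (hH : 0 ≤ H) (hL1 : 1 ≤ L) (hL2 : L ≤ 2) (ht : t < δ) (ht0 : 0 ≤ t)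
    (hφ : ∀ x y, dist x y < δ → |φ x - φ y| ≤ H * dist x y ^ (ζ : ℝ)) {u v : M}
    (huv : dist u v ≤ L * t) :
    |φ u - φ v| ≤ H * (L ^ (ζ : ℝ) * (1 + (L - 1) ^ (ζ : ℝ))) * t ^ (ζ : ℝ) := by
  have hL0 : 0 < L := by linarith
  obtain ⟨z, hz1, hz2⟩ := hgeo u v (1 / L) (by positivity) (by rw [div_le_one hL0]; exact hL1)
  have h1 : dist u z ≤ t := hz1.trans (by rw [one_div_mul_eq_div, div_le_iff₀ hL0]; linarith)
  have h2 : dist z v ≤ (L - 1) * t := by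
    refine hz2.trans ?_
    calc (1 - 1 / L) * dist u v = (L - 1) / L * dist u v := by field_simp
      _ ≤ (L - 1) / L * (L * t) := by
        refine mul_le_mul_of_nonneg_left huv (div_nonneg (by linarith) hL0.le)
      _ = (L - 1) * t := by field_simp
  have h3 : (L - 1) * t ≤ t := by nlinarith
  have e1 := hφ u z (h1.trans_lt ht)
  have e2 := hφ z v ((h2.trans h3).trans_lt ht)
  have hLm : 0 ≤ L - 1 := by linarith
  have e3 : dist u z ^ (ζ : ℝ) ≤ t ^ (ζ : ℝ) := Real.rpow_le_rpow dist_nonneg h1 ζ.coe_nonneg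
  have e4 : dist z v ^ (ζ : ℝ) ≤ (L - 1) ^ (ζ : ℝ) * t ^ (ζ : ℝ) := by
    rw [← Real.mul_rpow hLm ht0]
    exact Real.rpow_le_rpow dist_nonneg h2 ζ.coe_nonneg
  have hLζ : 1 ≤ L ^ (ζ : ℝ) := Real.one_le_rpow hL1 ζ.coe_nonneg
  calc |φ u - φ v| ≤ |φ u - φ z| + |φ z - φ v| := abs_sub_le _ _ _
    _ ≤ H * t ^ (ζ : ℝ) + H * ((L - 1) ^ (ζ : ℝ) * t ^ (ζ : ℝ)) :=
      add_le_add (e1.trans (mul_le_mul_of_nonneg_left e3 hH))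
        (e2.trans (mul_le_mul_of_nonneg_left e4 hH))
    _ = 1 * (H * (1 + (L - 1) ^ (ζ : ℝ)) * t ^ (ζ : ℝ)) := by ring
    _ ≤ L ^ (ζ : ℝ) * (H * (1 + (L - 1) ^ (ζ : ℝ)) * t ^ (ζ : ℝ)) := by
      refine mul_le_mul_of_nonneg_right hLζ ?_
      have := Real.rpow_nonneg hLm (ζ : ℝ)
      positivity
    _ = _ := by ring

/-- The hypotheses on the base map give a `TransferSystem`. -/
lemma transferSystem_of_fibrePairing [CompactSpace M] {ζ : ℝ≥0} (hζ0 : 0 < ζ) (hζ1 : ζ ≤ 1)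
    (hgeo : ∀ (x y : M) (a : ℝ), 0 ≤ a → a ≤ 1 →
      ∃ z, dist x z ≤ a * dist x y ∧ dist z y ≤ (1 - a) * dist x y)
    (hfin : ∀ x, (f ⁻¹' {x}).Finite) {D q : ℕ} (hcard : ∀ x, (f ⁻¹' {x}).ncard = D)
    (hqD : q < D) {σ L δ ε c : ℝ} (hδ : 0 < δ) (hσ : 1 < σ) (hL1 : 1 ≤ L) (hL2 : L ≤ 2)
    (hε : 0 < ε) (hpair : ∀ x y, dist x y < δ → FibrePairing f q σ⁻¹ L x y)
    (hsmall : SmallnessCond ζ D q σ L ε) (hρ : MemHolder ζ ρ) (hc : 0 < c) (hcρ : ∀ x, c ≤ ρ x)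
    (hρle : ∀ x, ρ x ≤ Real.exp ε / D) {S : Set M} (hS : IsClosed S) (hSne : S.Nonempty)
    (hback : ∀ u, f u ∈ S → u ∈ S) (hone : ∀ x ∈ S, perronFrobenius f ρ 1 x = 1) :
    ∃ θ κ C₀ C₁ : ℝ, TransferSystem ζ f ρ S δ θ κ c C₀ C₁ := by
  have hft : ∀ x, Fintype (f ⁻¹' {x}) := fun x => (hfin x).fintype
  have hcardF : ∀ x, (Fintype.card (f ⁻¹' {x}) : ℝ) = D := fun x => by
    rw [← hcard x, Set.ncard_eq_toFinset_card', Set.toFinset_card]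
  have hζ0' : (0 : ℝ) < ζ := by exact_mod_cast hζ0
  have hζ1' : (ζ : ℝ) ≤ 1 := by exact_mod_cast hζ1
  have hD : (0 : ℝ) < D := by exact_mod_cast (Nat.zero_le q).trans_lt hqD
  have hqD' : (q : ℝ) < D := by exact_mod_cast hqD
  have hq0 : (0 : ℝ) ≤ q := Nat.cast_nonneg q
  have hσ0 : 0 < σ := by linarith
  have hL0 : 0 < L := by linarith
  have hLm : 0 ≤ L - 1 := by linarith
  set w := L ^ (ζ : ℝ) * (1 + (L - 1) ^ (ζ : ℝ)) with hw
  set s := σ ^ (-(ζ : ℝ)) with hs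
  have hs0 : 0 < s := Real.rpow_pos_of_pos hσ0 _
  have hsinv : s = σ⁻¹ ^ (ζ : ℝ) := by rw [hs, Real.rpow_neg hσ0.le, Real.inv_rpow hσ0.le]
  have hσinv1 : σ⁻¹ ≤ 1 := inv_le_one_of_one_le₀ hσ.le
  have hs1 : s ≤ 1 := by
    rw [hsinv]; exact Real.rpow_le_one (by positivity) hσinv1 hζ0'.le
  have hLζ : 1 ≤ L ^ (ζ : ℝ) := Real.one_le_rpow hL1 hζ0'.le
  have hLm0 : 0 ≤ (L - 1) ^ (ζ : ℝ) := Real.rpow_nonneg hLm _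
  have hw2 : 1 + (L - 1) ^ (ζ : ℝ) ≤ w := le_mul_of_one_le_left (by positivity) hLζ
  have hw1 : 1 ≤ w := by linarith
  set R := Real.exp ε / D with hR
  have hR0 : 0 < R := by positivity
  set θ := R * (((D : ℝ) - q) * s + q * w) with hθ
  have hDq : 0 < (D : ℝ) - q := by linarith
  have hθ0 : 0 < θ := by positivity
  have hθ1 : θ < 1 := by
    refine lt_of_eq_of_lt ?_ hsmall
    rw [hθ, hR, hw, hs]
    ring
  set W := ((D : ℝ) - q) * σ⁻¹ + q * L with hW
  have hW0 : 0 ≤ W := by positivity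
  -- Because ζ ≤ 1, the weights σ⁻¹ and L of displacements are dominated by the weights s and w of
  -- Hölder constants. The smallness condition therefore also controls the average displacement W/D.
  have hsσ : σ⁻¹ ≤ s := by
    rw [hsinv]
    exact Real.self_le_rpow_of_le_one (by positivity) hσinv1 hζ1'
  have hLw : L ≤ w := by
    have : L - 1 ≤ (L - 1) ^ (ζ : ℝ) := Real.self_le_rpow_of_le_one hLm (by linarith) hζ1'
    linarith
  have hWle : W ≤ ((D : ℝ) - q) * s + q * w :=
    add_le_add (mul_le_mul_of_nonneg_left hsσ hDq.le) (mul_le_mul_of_nonneg_left hLw hq0)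
  have hRW : R * W ≤ θ := mul_le_mul_of_nonneg_left hWle hR0.le
  have hRD : 1 / D ≤ R := by
    rw [hR]; gcongr; exact Real.one_le_exp hε.le
  have hκ1 : W / D < 1 := by
    calc W / D = 1 / D * W := by ring
      _ ≤ R * W := mul_le_mul_of_nonneg_right hRD hW0
      _ < 1 := hRW.trans_lt hθ1
  have hequiv := exists_fibre_equiv_sum_dist_le hgeo hfin hcard hδ (hσinv1.trans hL1)
    (inv_nonneg.2 hσ0.le) hqD.le hpair
  have hρ0 : ∀ x, 0 ≤ ρ x := fun x => hc.le.trans (hcρ x)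
  set Hρ := (nnHolderNorm ζ ρ : ℝ) with hHρ
  have hHρ0 : 0 ≤ Hρ := NNReal.coe_nonneg _
  refine ⟨θ, W / D, D * Hρ * L ^ (ζ : ℝ), Real.exp ε,
    { finite_fibre := hfin
      c_pos := hc
      le_weight := hcρ
      δ_pos := hδ
      θ_pos := hθ0
      θ_lt_one := hθ1
      κ_nonneg := by positivity
      κ_lt_one := hκ1
      C₀_nonneg := by positivity
      abs_sub_le := ?_
      apply_one_le := ?_
      isClosed := hS
      nonempty := hSne
      backward := hback
      apply_one_eq := hone
      apply_infDist_le := ?_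
      exists_branches := ?_ }⟩
  · intro φ H B hH hB hφ hφB x y hxy
    obtain ⟨e, T, hT, hTb, hTa⟩ := hpair x y hxy
    set t := dist x y with ht
    have ht0 : 0 ≤ t := dist_nonneg
    have htζ : 0 ≤ t ^ (ζ : ℝ) := Real.rpow_nonneg ht0 _
    have hsum : ∑ u : f ⁻¹' {x}, |φ u - φ (e u)| ≤
        ((D : ℝ) - q) * (H * s * t ^ (ζ : ℝ)) + q * (H * w * t ^ (ζ : ℝ)) := by
      rw [← hcardF x]
      refine sum_le_of_card_le T hT ?_ (fun u hu => ?_) (fun u hu => ?_)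
      · have : s ≤ w := hs1.trans hw1
        gcongr
      · exact abs_sub_le_of_local_of_split hgeo hH hL1 hL2 hxy ht0 hφ (hTb u hu)
      · have h1 := hTa u hu
        have h2 : dist (u : M) (e u) < δ :=
          (h1.trans (mul_le_of_le_one_left ht0 hσinv1)).trans_lt hxy
        refine (hφ _ _ h2).trans ?_
        rw [mul_assoc]
        refine mul_le_mul_of_nonneg_left ?_ hH
        rw [hsinv, ← Real.mul_rpow (by positivity) ht0]
        exact Real.rpow_le_rpow dist_nonneg h1 hζ0'.le
    have hsumρ : ∀ u : f ⁻¹' {x}, |ρ u - ρ (e u)| ≤ Hρ * (L ^ (ζ : ℝ) * t ^ (ζ : ℝ)) := by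
      intro u
      refine (hρ.abs_sub_le _ _).trans (mul_le_mul_of_nonneg_left ?_ hHρ0)
      rw [← Real.mul_rpow hL0.le ht0]
      refine Real.rpow_le_rpow dist_nonneg ?_ hζ0'.le
      by_cases hu : u ∈ T
      · exact hTb u hu
      · exact (hTa u hu).trans (mul_le_mul_of_nonneg_right (hσinv1.trans hL1) ht0)
    rw [perronFrobenius_eq_sum_subtype φ x, perronFrobenius_eq_sum_subtype φ y,
      ← Equiv.sum_comp e, ← Finset.sum_sub_distrib]
    calc |∑ u : f ⁻¹' {x}, (φ u * ρ u - φ (e u) * ρ (e u))|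
        ≤ ∑ u : f ⁻¹' {x}, |φ u * ρ u - φ (e u) * ρ (e u)| := Finset.abs_sum_le_sum_abs _ _
      _ ≤ ∑ u : f ⁻¹' {x}, (R * |φ u - φ (e u)| + B * (Hρ * (L ^ (ζ : ℝ) * t ^ (ζ : ℝ)))) := by
          refine Finset.sum_le_sum fun u _ => ?_
          calc |φ u * ρ u - φ (e u) * ρ (e u)|
              = |ρ u * (φ u - φ (e u)) + φ (e u) * (ρ u - ρ (e u))| := by ring_nf
            _ ≤ |ρ u * (φ u - φ (e u))| + |φ (e u) * (ρ u - ρ (e u))| := abs_add_le _ _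
            _ ≤ _ := by
              rw [abs_mul, abs_mul, abs_of_nonneg (hρ0 _)]
              exact add_le_add (mul_le_mul_of_nonneg_right (hρle _) (abs_nonneg _))
                (mul_le_mul (hφB _) (hsumρ u) (abs_nonneg _) hB)
      _ = R * ∑ u : f ⁻¹' {x}, |φ u - φ (e u)| +
            D * (B * (Hρ * (L ^ (ζ : ℝ) * t ^ (ζ : ℝ)))) := by
          rw [Finset.sum_add_distrib, ← Finset.mul_sum, Finset.sum_const, nsmul_eq_mul,
            Finset.card_univ, hcardF]
      _ ≤ R * (((D : ℝ) - q) * (H * s * t ^ (ζ : ℝ)) + q * (H * w * t ^ (ζ : ℝ))) +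
            D * (B * (Hρ * (L ^ (ζ : ℝ) * t ^ (ζ : ℝ)))) := by gcongr
      _ = _ := by rw [hθ]; ring
  · intro x
    rw [perronFrobenius_eq_sum_subtype]
    calc ∑ u : f ⁻¹' {x}, (1 : M → ℝ) u * ρ u ≤ ∑ _u : f ⁻¹' {x}, R :=
          Finset.sum_le_sum fun u _ => by simpa using hρle u
      _ = Real.exp ε := by
          rw [Finset.sum_const, nsmul_eq_mul, Finset.card_univ, hcardF, hR]; field_simp
  · intro x
    -- The fibre over z lies in S by backward invariance, so the matching with it bounds the
    -- distances of the points over x to S.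
    obtain ⟨z, hz, hd⟩ := hS.isCompact.exists_infDist_eq_dist hSne x
    obtain ⟨e, he⟩ := hequiv x z
    rw [finsum_eq_sum_of_fintype] at he
    rw [perronFrobenius_eq_sum_subtype, hd]
    calc ∑ u : f ⁻¹' {x}, Metric.infDist (u : M) S * ρ u
        ≤ ∑ u : f ⁻¹' {x}, dist (u : M) (e u) * R := by
          refine Finset.sum_le_sum fun u _ => mul_le_mul ?_ (hρle _) (hρ0 _) dist_nonneg
          refine Metric.infDist_le_dist_of_mem (hback _ ?_)
          rwa [show f (e u) = z from (e u).2]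
      _ = R * ∑ u : f ⁻¹' {x}, dist (u : M) (e u) := by rw [← Finset.sum_mul, mul_comm]
      _ ≤ R * (W * dist x z) := mul_le_mul_of_nonneg_left he hR0.le
      _ ≤ θ * dist x z := by rw [← mul_assoc]; exact mul_le_mul_of_nonneg_right hRW dist_nonneg
  · intro x y
    obtain ⟨e, he⟩ := hequiv x y
    rw [finsum_eq_sum_of_fintype] at he
    have hne : (Finset.univ : Finset (f ⁻¹' {x})).Nonempty := by
      rw [← Finset.card_pos, Finset.card_univ]
      have := hcardF x
      exact_mod_cast this ▸ hD
    -- Some matched pair is no farther apart than the average.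
    obtain ⟨u, -, hu⟩ := Finset.exists_le_of_sum_le (f := fun u : f ⁻¹' {x} => dist (u : M) (e u))
      (g := fun _ => W / D * dist x y) hne (by
        rw [Finset.sum_const, nsmul_eq_mul, Finset.card_univ, hcardF]
        refine he.trans (le_of_eq ?_)
        rw [← hW]
        field_simp)
    exact ⟨u, e u, u.2, (e u).2, hu⟩

end Verification

/-! ### Change of variables for a map with a Jacobian -/

section ChangeOfVariables

variable {M : Type*} [MeasurableSpace M] {f : M → M} {m : Measure M} {J : M → ℝ}

lemma map_withDensity_restrict_of_hasJacobian (hf : Measurable f) (hJ : HasJacobian f m J)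
    {E : Set M} (hE : MeasurableSet E) (hinj : InjOn f E) :
    ((m.restrict E).withDensity fun x => ENNReal.ofReal (J x)).map f = m.restrict (f '' E) := by
  ext B hB
  rw [Measure.map_apply hf hB, withDensity_apply _ (hf hB), Measure.restrict_restrict (hf hB),
    Measure.restrict_apply hB, ← hJ _ ((hf hB).inter hE) (hinj.mono inter_subset_right),
    image_preimage_inter]

/-- A fibre meets a domain of injectivity in at most one point, so the sum has at most one nonzero
term. -/
lemma tsum_fibre_indicator_eq_extend {M : Type*} {f : M → M} {E : Set M} (hinj : InjOn f E) (ψ : M → ℝ≥0∞) (x : M) :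
    ∑' u : f ⁻¹' {x}, E.indicator ψ u =
      Function.extend (fun e : E => f e) (fun e : E => ψ e) 0 x := by
  have hinj' : Function.Injective fun e : E => f e := fun e e' h => Subtype.ext (hinj e.2 e'.2 h)
  by_cases hx : ∃ e : E, f e = x
  · obtain ⟨e, rfl⟩ := hx
    rw [hinj'.extend_apply (fun e : E => ψ e) 0 e,
      tsum_eq_single (⟨e, rfl⟩ : f ⁻¹' {f e}) fun u hu => ?_]
    · simp [e.2]
    · refine indicator_of_notMem (fun huE => hu (Subtype.ext ?_)) _
      exact hinj huE e.2 u.2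
  · rw [Function.extend_apply' _ _ _ hx]
    simp only [Pi.zero_apply, ENNReal.tsum_eq_zero]
    exact fun u => indicator_of_notMem (fun huE => hx ⟨⟨u, huE⟩, u.2⟩) _

/-- By the Lusin–Souslin theorem f is a measurable embedding on E, so the function transported by f
and extended by zero is measurable. Its integral then follows from the Jacobian identity on subsets
of E. -/
lemma lintegral_tsum_fibre_indicator [StandardBorelSpace M] (hf : Measurable f)
    (hJ : HasJacobian f m J) (hJm : Measurable J) {E : Set M} (hE : MeasurableSet E)
    (hinj : InjOn f E) {ψ : M → ℝ≥0∞} (hψ : Measurable ψ) :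
    Measurable (fun x => ∑' u : f ⁻¹' {x}, E.indicator ψ u) ∧
    ∫⁻ x, ∑' u : f ⁻¹' {x}, E.indicator ψ u ∂m =
      ∫⁻ x in E, ENNReal.ofReal (J x) * ψ x ∂m := by
  have := hE.standardBorel
  have hinj' : Function.Injective fun e : E => f e := fun e e' h => Subtype.ext (hinj e.2 e'.2 h)
  have hemb : MeasurableEmbedding fun e : E => f e :=
    (hf.comp measurable_subtype_coe).measurableEmbedding hinj'
  simp_rw [tsum_fibre_indicator_eq_extend hinj ψ]
  have hmeas : Measurable (Function.extend (fun e : E => f e) (fun e : E => ψ e) 0) :=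
    hemb.measurable_extend (hψ.comp measurable_subtype_coe) measurable_zero
  refine ⟨hmeas, ?_⟩
  have himg : MeasurableSet (f '' E) := by
    have := hemb.measurableSet_range
    rwa [show range (fun e : E => f e) = f '' E by rw [image_eq_range]] at this
  have h1 : ∫⁻ x, Function.extend (fun e : E => f e) (fun e : E => ψ e) 0 x ∂m =
      ∫⁻ x in f '' E, Function.extend (fun e : E => f e) (fun e : E => ψ e) 0 x ∂m := by
    rw [← lintegral_indicator himg]
    congr 1
    funext x
    by_cases hx : x ∈ f '' E
    · rw [indicator_of_mem hx]
    · rw [indicator_of_notMem hx, Function.extend_apply']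
      · rfl
      · rintro ⟨e, rfl⟩
        exact hx ⟨e, e.2, rfl⟩
  rw [h1, ← map_withDensity_restrict_of_hasJacobian hf hJ hE hinj, lintegral_map hmeas hf,
    lintegral_withDensity_eq_lintegral_mul (m.restrict E) hJm.ennreal_ofReal
      (g := fun a => Function.extend (fun e : E => f e) (fun e : E => ψ e) 0 (f a))
      (hmeas.comp hf)]
  refine setLIntegral_congr_fun hE fun x hx => ?_
  simp only [Pi.mul_apply]
  congr 1
  exact hinj'.extend_apply (fun e : E => ψ e) 0 ⟨x, hx⟩

/-- A countable measurable partition into domains of injectivity. -/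
def HasInjectivityPartition (f : M → M) : Prop :=
  ∃ E : ℕ → Set M, (∀ k, MeasurableSet (E k) ∧ InjOn f (E k)) ∧
    Pairwise (Function.onFun Disjoint E) ∧ ⋃ k, E k = univ

/-- The finite open cover is padded with empty sets to a sequence and then made disjoint. -/
lemma CondF2.hasInjectivityPartition {X : Type*} [TopologicalSpace X] [MeasurableSpace X]
    [OpensMeasurableSpace X] {f : X → X} {A : Set X} {q : ℕ} (h : CondF2 f A q) :
    HasInjectivityPartition f := by
  obtain ⟨-, 𝒰, h𝒰, hcov, -⟩ := h
  let U : ℕ → Set X := fun k => if h : k < 𝒰.card then (𝒰.equivFin.symm ⟨k, h⟩ : Set X) else ∅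
  have hU : ∀ k, MeasurableSet (U k) ∧ InjOn f (U k) := by
    intro k
    by_cases hk : k < 𝒰.card
    · simp only [U, hk, dif_pos]
      have := h𝒰 _ (𝒰.equivFin.symm ⟨k, hk⟩).2
      exact ⟨this.1.measurableSet, this.2⟩
    · simp [U, hk]
  refine ⟨disjointed U, fun k => ⟨.disjointed (fun i => (hU i).1) k,
    (hU k).2.mono (disjointed_subset U k)⟩, disjoint_disjointed U, ?_⟩
  rw [iUnion_disjointed, eq_univ_iff_forall]
  intro x
  obtain ⟨V, hV, hxV⟩ := mem_iUnion₂.1 (hcov ▸ mem_univ x)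
  refine mem_iUnion.2 ⟨𝒰.equivFin ⟨V, hV⟩, ?_⟩
  simp [U, hxV]

lemma tsum_fibre_eq_tsum {M : Type*} {f : M → M} {E : ℕ → Set M} (hdisj : Pairwise (Function.onFun Disjoint E))
    (hcov : ⋃ k, E k = univ) (ψ : M → ℝ≥0∞) (x : M) :
    ∑' u : f ⁻¹' {x}, ψ u = ∑' k, ∑' u : f ⁻¹' {x}, (E k).indicator ψ u := by
  rw [ENNReal.tsum_comm]
  refine tsum_congr fun u => ?_
  obtain ⟨k, hk⟩ := mem_iUnion.1 (hcov ▸ mem_univ (u : M))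
  rw [tsum_eq_single k fun j hj => indicator_of_notMem
    (fun h => Set.disjoint_left.1 (hdisj hj) h hk) _, indicator_of_mem hk]

lemma lintegral_tsum_fibre [StandardBorelSpace M] (hf : Measurable f)
    (hJ : HasJacobian f m J) (hJm : Measurable J) (hp : HasInjectivityPartition f)
    {ψ : M → ℝ≥0∞} (hψ : Measurable ψ) :
    Measurable (fun x => ∑' u : f ⁻¹' {x}, ψ u) ∧
    ∫⁻ x, ∑' u : f ⁻¹' {x}, ψ u ∂m = ∫⁻ x, ENNReal.ofReal (J x) * ψ x ∂m := by
  obtain ⟨E, hE, hdisj, hcov⟩ := hp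
  have h := fun k => lintegral_tsum_fibre_indicator hf hJ hJm (hE k).1 (hE k).2 hψ
  simp_rw [tsum_fibre_eq_tsum hdisj hcov ψ]
  refine ⟨Measurable.tsum fun k => (h k).1, ?_⟩
  rw [lintegral_tsum fun k => (h k).1.aemeasurable]
  simp_rw [fun k => (h k).2]
  rw [← lintegral_iUnion (fun k => (hE k).1) hdisj, hcov, setLIntegral_univ]

/-- The change of variables applied to the indicator of a null set shows that almost no fibre meets
it. Almost sure properties can thus be used at all preimages of a point at once. -/
lemma ae_forall_fibre [StandardBorelSpace M] (hf : Measurable f)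
    (hJ : HasJacobian f m J) (hJm : Measurable J) (hp : HasInjectivityPartition f)
    {p : M → Prop} (h : ∀ᵐ y ∂m, p y) : ∀ᵐ x ∂m, ∀ u, f u = x → p u := by
  obtain ⟨N, hN, hNm, hN0⟩ := exists_measurable_superset_of_null (ae_iff.1 h)
  obtain ⟨h1, h2⟩ := lintegral_tsum_fibre hf hJ hJm hp
    (ψ := N.indicator 1) (measurable_one.indicator hNm)
  have h3 : ∫⁻ x, ENNReal.ofReal (J x) * N.indicator 1 x ∂m = 0 := by
    refine (lintegral_eq_zero_iff (f := fun x => ENNReal.ofReal (J x) * N.indicator 1 x)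
      (hJm.ennreal_ofReal.mul (measurable_one.indicator hNm))).2 ?_
    have : ∀ᵐ x ∂m, x ∉ N := measure_eq_zero_iff_ae_notMem.1 hN0
    filter_upwards [this] with x hx
    simp [hx]
  rw [h3, lintegral_eq_zero_iff h1] at h2
  filter_upwards [h2] with x hx u hu
  by_contra hpu
  have := ENNReal.tsum_eq_zero.1 hx ⟨u, hu⟩
  simp [hN hpu] at this

variable {ρ : M → ℝ}

/-- The weight ρ cancels the Jacobian 1/ρ, so the transfer operator preserves integrals. -/
lemma lintegral_tsum_fibre_weight [StandardBorelSpace M] (hf : Measurable f)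
    (hJ : HasJacobian f m fun x => 1 / ρ x) (hρ : ∀ x, 0 < ρ x) (hρm : Measurable ρ)
    (hp : HasInjectivityPartition f) {ψ : M → ℝ≥0∞} (hψ : Measurable ψ) :
    Measurable (fun x => ∑' u : f ⁻¹' {x}, ENNReal.ofReal (ρ u) * ψ u) ∧
    ∫⁻ x, ∑' u : f ⁻¹' {x}, ENNReal.ofReal (ρ u) * ψ u ∂m = ∫⁻ x, ψ x ∂m := by
  have h := lintegral_tsum_fibre hf hJ (hρm.const_div 1) hp
    (ψ := fun u => ENNReal.ofReal (ρ u) * ψ u) (hρm.ennreal_ofReal.mul hψ)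
  refine ⟨h.1, h.2.trans (lintegral_congr fun x => ?_)⟩
  rw [← mul_assoc, ← ENNReal.ofReal_mul (by have := hρ x; positivity),
    one_div_mul_cancel (hρ x).ne', ENNReal.ofReal_one, one_mul]

/-- Integrated over A, the sum of the weights gives the measure of f⁻¹(A), which is that of A by
invariance. -/
lemma ae_tsum_fibre_weight_eq_one [StandardBorelSpace M] [IsFiniteMeasure m]
    (hinv : MeasurePreserving f m m)
    (hJ : HasJacobian f m fun x => 1 / ρ x) (hρ : ∀ x, 0 < ρ x) (hρm : Measurable ρ)
    (hp : HasInjectivityPartition f) :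
    ∀ᵐ x ∂m, ∑' u : f ⁻¹' {x}, ENNReal.ofReal (ρ u) = 1 := by
  have hf := hinv.measurable
  have h1 := (lintegral_tsum_fibre_weight hf hJ hρ hρm hp (ψ := 1) measurable_one).1
  simp only [Pi.one_apply, mul_one] at h1
  refine ae_eq_of_forall_setLIntegral_eq_of_sigmaFinite (g := fun _ => 1) h1 measurable_const
    fun A hA _ => ?_
  have h2 := (lintegral_tsum_fibre_weight hf hJ hρ hρm hp (ψ := (f ⁻¹' A).indicator 1)
    (measurable_one.indicator (hf hA))).2
  rw [lintegral_indicator_one (hf hA), hinv.measure_preimage hA.nullMeasurableSet] at h2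
  rw [setLIntegral_const, one_mul, ← h2, ← lintegral_indicator hA]
  refine lintegral_congr fun x => ?_
  by_cases hx : x ∈ A
  · rw [indicator_of_mem hx]
    refine tsum_congr fun u => ?_
    have : f u = x := u.2
    simp [this, hx]
  · rw [indicator_of_notMem hx]
    refine (ENNReal.tsum_eq_zero.2 fun u => ?_).symm
    have : f u = x := u.2
    simp [this, hx]

lemma ofReal_perronFrobenius {M : Type*} {f : M → M} {ρ : M → ℝ}
    (hfin : ∀ x, (f ⁻¹' {x}).Finite) (hρ : ∀ x, 0 < ρ x) {φ : M → ℝ}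
    (hφ : ∀ x, 0 ≤ φ x) (x : M) : ENNReal.ofReal (perronFrobenius f ρ φ x) =
      ∑' u : f ⁻¹' {x}, ENNReal.ofReal (ρ u) * ENNReal.ofReal (φ u) := by
  have := (hfin x).fintype
  rw [perronFrobenius_eq_sum_subtype, tsum_fintype,
    ENNReal.ofReal_sum_of_nonneg fun (u : f ⁻¹' {x}) _ => mul_nonneg (hφ u) (hρ u).le]
  refine Finset.sum_congr rfl fun u _ => ?_
  rw [ENNReal.ofReal_mul (hφ u), mul_comm]

lemma integrable_perronFrobenius_of_nonneg [StandardBorelSpace M] [IsFiniteMeasure m]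
    (hf : Measurable f)
    (hJ : HasJacobian f m fun x => 1 / ρ x) (hρ : ∀ x, 0 < ρ x) (hρm : Measurable ρ)
    (hp : HasInjectivityPartition f) (hfin : ∀ x, (f ⁻¹' {x}).Finite) {φ : M → ℝ}
    (hφm : Measurable φ) (hφ : ∀ x, 0 ≤ φ x) (hφi : Integrable φ m) :
    Integrable (perronFrobenius f ρ φ) m ∧
      ∫ x, perronFrobenius f ρ φ x ∂m = ∫ x, φ x ∂m := by
  obtain ⟨h1, h2⟩ := lintegral_tsum_fibre_weight hf hJ hρ hρm hp hφm.ennreal_ofReal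
  have hnn : ∀ x, 0 ≤ perronFrobenius f ρ φ x := fun x =>
    perronFrobenius_nonneg_on hfin (fun x => (hρ x).le) (S := univ) (fun _ _ => trivial)
      (fun x _ => hφ x) (mem_univ x)
  simp_rw [← ofReal_perronFrobenius hfin hρ hφ] at h1 h2
  have hm : Measurable (perronFrobenius f ρ φ) := by
    convert! h1.ennreal_toReal using 1
    funext x
    rw [ENNReal.toReal_ofReal (hnn x)]
  have hint : ∫ x, perronFrobenius f ρ φ x ∂m = ∫ x, φ x ∂m := by
    rw [integral_eq_lintegral_of_nonneg_ae (Eventually.of_forall hnn) hm.aestronglyMeasurable,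
      integral_eq_lintegral_of_nonneg_ae (Eventually.of_forall hφ) hφm.aestronglyMeasurable, h2]
  refine ⟨⟨hm.aestronglyMeasurable, ?_⟩, hint⟩
  rw [hasFiniteIntegral_iff_ofReal (Eventually.of_forall hnn), h2,
    ← hasFiniteIntegral_iff_ofReal (Eventually.of_forall hφ)]
  exact hφi.2

lemma integral_perronFrobenius [StandardBorelSpace M] [IsFiniteMeasure m] (hf : Measurable f)
    (hJ : HasJacobian f m fun x => 1 / ρ x) (hρ : ∀ x, 0 < ρ x) (hρm : Measurable ρ)
    (hp : HasInjectivityPartition f) (hfin : ∀ x, (f ⁻¹' {x}).Finite) {φ : M → ℝ}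
    (hφm : Measurable φ) (hφi : Integrable φ m) :
    ∫ x, perronFrobenius f ρ φ x ∂m = ∫ x, φ x ∂m := by
  obtain ⟨h1, h1'⟩ := integrable_perronFrobenius_of_nonneg hf hJ hρ hρm hp hfin
    (φ := fun x => max (φ x) 0) (hφm.max measurable_const) (fun x => le_max_right _ _) hφi.pos_part
  obtain ⟨h2, h2'⟩ := integrable_perronFrobenius_of_nonneg hf hJ hρ hρm hp hfin
    (φ := fun x => max (-φ x) 0) (hφm.neg.max measurable_const) (fun x => le_max_right _ _)
    hφi.neg_part
  have hdec : φ = (fun x => max (φ x) 0) + (-1 : ℝ) • fun x => max (-φ x) 0 := by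
    funext x
    simp only [Pi.add_apply, Pi.smul_apply, smul_eq_mul]
    rcases le_total (φ x) 0 with h | h
    · rw [max_eq_right h, max_eq_left (by linarith)]; ring
    · rw [max_eq_left h, max_eq_right (by linarith)]; ring
  have hP : perronFrobenius f ρ φ = fun x => perronFrobenius f ρ (fun x => max (φ x) 0) x -
      perronFrobenius f ρ (fun x => max (-φ x) 0) x := by
    funext x
    conv_lhs => rw [hdec, perronFrobenius_add hfin, perronFrobenius_smul hfin]
    simp [sub_eq_add_neg]
  rw [hP, integral_sub h1 h2, h1', h2', ← integral_sub hφi.pos_part hφi.neg_part]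
  refine integral_congr_ae (Eventually.of_forall fun x => ?_)
  conv_rhs => rw [hdec]
  simp [sub_eq_add_neg]

end ChangeOfVariables

/-! ### The support of the invariant measure; continuity of images -/

section Support

variable {M : Type*} [MetricSpace M] [MeasurableSpace M] [BorelSpace M] {f : M → M}
  {m : Measure M} {ρ : M → ℝ}

/-- A null neighbourhood of u on which f is injective is mapped to an open neighbourhood of f u,
null by the Jacobian identity. -/
lemma mem_support_of_apply_mem_support (hf : IsLocalHomeomorph f) {J : M → ℝ}
    (hJ : HasJacobian f m J) {u : M} (hu : f u ∈ m.support) : u ∈ m.support := by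
  by_contra hcon
  obtain ⟨U, hU, hU0⟩ := Measure.notMem_support_iff_exists.1 hcon
  obtain ⟨e, he, rfl⟩ := hf u
  let V := interior U ∩ e.source
  have hVo : IsOpen V := isOpen_interior.inter e.open_source
  have hV0 : m V = 0 := measure_mono_null (inter_subset_left.trans interior_subset) hU0
  have h1 := hJ V hVo.measurableSet (e.injOn.mono inter_subset_right)
  rw [Measure.restrict_eq_zero.2 hV0, lintegral_zero_measure] at h1
  have h2 : e '' V ∈ 𝓝 (e u) :=
    (hf.isOpenMap V hVo).mem_nhds ⟨u, ⟨mem_interior_iff_mem_nhds.2 hU, he⟩, rfl⟩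
  exact ((Measure.mem_support_iff_forall _).1 hu _ h2).ne' h1

/-- Nearby fibres are matched with the fibre over c by `exists_nhds_fibre_equiv`, so the sums are
compared term by term. The tolerance η/(k + 1) for k terms keeps the total strictly below η. -/
lemma continuous_perronFrobenius {M : Type*} [MetricSpace M] [CompactSpace M] {f : M → M}
    {ρ : M → ℝ} (hf : IsLocalHomeomorph f) {φ : M → ℝ}
    (hφ : Continuous φ) (hρ : Continuous ρ) : Continuous (perronFrobenius f ρ φ) := by
  rw [Metric.continuous_iff']
  intro c η hη
  have hfin := fun c => (exists_nhds_fibre_equiv hf (fun _ => univ) (fun _ => univ_mem) c).1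
  have := fun x => (hfin x).fintype
  set k := Fintype.card (f ⁻¹' {c}) with hk
  obtain ⟨-, V, hV, h⟩ := exists_nhds_fibre_equiv hf
    (fun u => {v | dist (φ v * ρ v) (φ u * ρ u) < η / (k + 1)})
    (fun u => (Metric.tendsto_nhds.1 (hφ.mul hρ).continuousAt) _ (by positivity)) c
  filter_upwards [hV] with x hx
  obtain ⟨e, he⟩ := h x hx
  rw [perronFrobenius_eq_sum_subtype, perronFrobenius_eq_sum_subtype, ← Equiv.sum_comp e]
  calc dist (∑ u, φ (e u) * ρ (e u)) (∑ u : f ⁻¹' {c}, φ u * ρ u)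
      ≤ ∑ u : f ⁻¹' {c}, dist (φ (e u) * ρ (e u)) (φ u * ρ u) := dist_sum_sum_le _ _ _
    _ ≤ ∑ _u : f ⁻¹' {c}, η / (k + 1) := Finset.sum_le_sum fun u _ => (he u).le
    _ = k * (η / (k + 1)) := by rw [Finset.sum_const, nsmul_eq_mul, Finset.card_univ]
    _ < η := by
      rw [mul_div_assoc', div_lt_iff₀ (by positivity)]
      nlinarith

end Support

/-! ### The base map satisfies the abstract hypotheses -/

section BaseAssembly

lemma CondF3.le_exp_mul {M : Type*} [MetricSpace M] [CompactSpace M] {ζ : ℝ≥0} (hζ0 : 0 < ζ)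
    {ρ : M → ℝ} {ε : ℝ} (h : CondF3 ζ ρ ε) (hρ : ∀ x, 0 < ρ x) (x y : M) :
    ρ x ≤ Real.exp ε * ρ y := by
  obtain ⟨hosc, hmem, -⟩ := h
  have hc : Continuous fun x => Real.log (ρ x) :=
    (hmem.continuous hζ0).log fun x => (hρ x).ne'
  have h1 := le_ciSup (isCompact_range hc).bddAbove x
  have h2 := ciInf_le (isCompact_range hc).bddBelow y
  have h3 : Real.log (ρ x) ≤ ε + Real.log (ρ y) := by linarith
  calc ρ x = Real.exp (Real.log (ρ x)) := (Real.exp_log (hρ x)).symm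
    _ ≤ Real.exp (ε + Real.log (ρ y)) := Real.exp_le_exp.2 h3
    _ = _ := by rw [Real.exp_add, Real.exp_log (hρ y)]

/-- Under the hypotheses on the base map, the Perron–Frobenius operator fits the abstract setting,
the distinguished set being the support of the invariant measure. -/
lemma exists_transferSystem {M : Type*} [MetricSpace M] [CompactSpace M] [ConnectedSpace M]
    [MeasurableSpace M] [BorelSpace M] {ζ : ℝ≥0} (hζ0 : 0 < ζ) (hζ1 : ζ ≤ 1)
    (hgeo : ∀ (x y : M) (a : ℝ), 0 ≤ a → a ≤ 1 →
      ∃ z, dist x z ≤ a * dist x y ∧ dist z y ≤ (1 - a) * dist x y)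
    {f : M → M} (hf : IsLocalHomeomorph f) {m : Measure M} [IsProbabilityMeasure m]
    (hinv : MeasurePreserving f m m) {ρ : M → ℝ} (hρ : ∀ x, 0 < ρ x)
    (hjac : HasJacobian f m fun x => 1 / ρ x) {Lf : M → ℝ} (hLf : LocalInverseLipschitz f Lf)
    {A : Set M} {σ L ε : ℝ} {q : ℕ} (hσ : 1 < σ) (hL1 : 1 ≤ L) (hL2 : L ≤ 2) (hε : 0 < ε)
    (hf1 : CondF1 Lf A σ L) (hf2 : CondF2 f A q) (hf3 : CondF3 ζ ρ ε)
    (hsmall : SmallnessCond ζ (mapDegree f) q σ L ε) :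
    ∃ δ θ κ c C₀ C₁ : ℝ, TransferSystem ζ f ρ m.support δ θ κ c C₀ C₁ := by
  have hfin : ∀ x, (f ⁻¹' {x}).Finite := fun x =>
    (exists_nhds_fibre_equiv hf (fun _ => univ) (fun _ => univ_mem) x).1
  have hcard := ncard_fibre_eq_mapDegree hf
  have hρc : Continuous ρ := hf3.2.1.continuous hζ0
  have hp := hf2.hasInjectivityPartition
  have hone : ∀ᵐ x ∂m, perronFrobenius f ρ 1 x = 1 := by
    filter_upwards [ae_tsum_fibre_weight_eq_one hinv hjac hρ hρc.measurable hp] with x hx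
    have h1 := ofReal_perronFrobenius hfin hρ (φ := 1) (fun _ => by simp) x
    simp only [Pi.one_apply, ENNReal.ofReal_one, mul_one, hx] at h1
    exact ENNReal.ofReal_eq_one.1 h1
  -- The almost sure identity between continuous functions holds on a closed set of full measure,
  -- which contains the support.
  have honeS : ∀ x ∈ m.support, perronFrobenius f ρ 1 x = 1 := by
    have hcl : IsClosed {x | perronFrobenius f ρ 1 x = 1} :=
      isClosed_eq (continuous_perronFrobenius hf continuous_one hρc) continuous_const
    exact fun x hx => Measure.support_subset_of_isClosed hcl hone hx
  have hSne : m.support.Nonempty := Measure.nonempty_support (IsProbabilityMeasure.ne_zero m)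
  have hD : (0 : ℝ) < mapDegree f := by exact_mod_cast (Nat.zero_le q).trans_lt hf2.1
  -- Over a point s of the support the deg(f) weights sum to 1, and each is at least e^(-ε) ρ x,
  -- wherever x lies in M.
  have hρle : ∀ x, ρ x ≤ Real.exp ε / mapDegree f := by
    intro x
    obtain ⟨s, hs⟩ := hSne
    have hsum := honeS s hs
    have := (hfin s).fintype
    rw [perronFrobenius_eq_sum_subtype] at hsum
    rw [le_div_iff₀ hD]
    have hcardF : (Fintype.card (f ⁻¹' {s}) : ℝ) = mapDegree f := by
      rw [← hcard s, Set.ncard_eq_toFinset_card', Set.toFinset_card]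
    calc ρ x * mapDegree f = ∑ _u : f ⁻¹' {s}, ρ x := by
          rw [Finset.sum_const, nsmul_eq_mul, Finset.card_univ, hcardF, mul_comm]
      _ ≤ ∑ u : f ⁻¹' {s}, Real.exp ε * ((1 : M → ℝ) u * ρ u) :=
          Finset.sum_le_sum fun u _ => by simpa using hf3.le_exp_mul hζ0 hρ x u
      _ = Real.exp ε := by rw [← Finset.mul_sum, hsum, mul_one]
  obtain ⟨x₀, hx₀⟩ := hρc.exists_forall_le_of_hasCompactSupport
    (HasCompactSupport.of_compactSpace ρ)
  obtain ⟨δ, hδ, hpair⟩ := exists_fibrePairing hf hLf hf1 hf2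
  obtain ⟨θ, κ, C₀, C₁, h⟩ := transferSystem_of_fibrePairing hζ0 hζ1 hgeo hfin hcard hf2.1 hδ hσ
    hL1 hL2 hε hpair hsmall hf3.2.1 (hρ x₀) hx₀ hρle Measure.isClosed_support hSne
    (fun u hu => mem_support_of_apply_mem_support hf hjac hu) honeS
  exact ⟨δ, θ, κ, ρ x₀, C₀, C₁, h⟩

end BaseAssembly

/-! ### Action of the push-forward on fibre restrictions -/

section LeafPush

variable {M K : Type*} [MeasurableSpace M] [MeasurableSpace K]

lemma measurable_skewProduct {f : M → M} (hf : Measurable f) {G : M × K → K} (hG : Measurable G) :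
    Measurable (skewProduct f G) :=
  (hf.comp measurable_fst).prodMk hG

lemma fst_map_skewProduct {f : M → M} (hf : Measurable f) {G : M × K → K} (hG : Measurable G)
    (μ : Measure (M × K)) : (μ.map (skewProduct f G)).fst = μ.fst.map f := by
  rw [Measure.fst, Measure.fst, Measure.map_map measurable_fst (measurable_skewProduct hf hG),
    Measure.map_map hf measurable_fst]
  rfl

lemma fst_map_skewProduct_absolutelyContinuous {f : M → M} {m : Measure M}
    (hinv : MeasurePreserving f m m) {G : M × K → K} (hG : Measurable G) {μ : Measure (M × K)}
    (hμ : μ.fst ≪ m) : (μ.map (skewProduct f G)).fst ≪ m := by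
  rw [fst_map_skewProduct hinv.measurable hG]
  exact (hμ.map hinv.measurable).trans (by rw [hinv.map_eq])

/-- Bounded measurable functions. -/
def BoundedMeasurable (g : K → ℝ) : Prop := Measurable g ∧ ∃ B, ∀ z, |g z| ≤ B

lemma BoundedMeasurable.integrable {g : K → ℝ} (hg : BoundedMeasurable g) (μ : Measure K)
    [IsFiniteMeasure μ] : Integrable g μ :=
  Integrable.of_bound hg.1.aestronglyMeasurable hg.2.choose
    (Eventually.of_forall hg.2.choose_spec)

lemma map_eq_sub {X Y : Type*} [MeasurableSpace X] [MeasurableSpace Y] (s : SignedMeasure X)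
    {F : X → Y} (hF : Measurable F) :
    s.map F = (s.toJordanDecomposition.posPart.map F).toSignedMeasure -
      (s.toJordanDecomposition.negPart.map F).toSignedMeasure := by
  ext B hB
  rw [VectorMeasure.map_apply _ hF hB, Measure.toSignedMeasure_sub_apply hB,
    map_measureReal_apply hF hB, map_measureReal_apply hF hB]
  conv_lhs => rw [eq_posPart_sub_negPart s]
  rw [Measure.toSignedMeasure_sub_apply (hF hB)]

lemma MemAB.map_skewProduct {f : M → M} {m : Measure M} (hinv : MeasurePreserving f m m)
    {G : M × K → K} (hG : Measurable G) {s : SignedMeasure (M × K)} (hs : MemAB m s) :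
    MemAB m (s.map (skewProduct f G)) :=
  memAB_of_eq_sub _ _ _ (fst_map_skewProduct_absolutelyContinuous hinv hG hs.1)
    (fst_map_skewProduct_absolutelyContinuous hinv hG hs.2)
    (map_eq_sub s (measurable_skewProduct hinv.measurable hG))

lemma integral_sum_smul_map_eq {f : M → M} (hfin : ∀ x, (f ⁻¹' {x}).Finite) {ρ : M → ℝ}
    (hρ : ∀ x, 0 < ρ x) {G : M × K → K} (hG : Measurable G) (κ : M → Measure K) (x : M)
    (hκ : ∀ u, f u = x → IsFiniteMeasure (κ u)) {g : K → ℝ} (hg : BoundedMeasurable g) :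
    ∫ z, g z ∂(Measure.sum fun u : f ⁻¹' {x} => ENNReal.ofReal (ρ u) •
      (κ u).map fun z => G (u, z)) =
      perronFrobenius f ρ (fun u => ∫ z, g (G (u, z)) ∂(κ u)) x := by
  have := (hfin x).fintype
  have hGu : ∀ u, Measurable fun z => G (u, z) := fun u => hG.comp measurable_prodMk_left
  have hfinu : ∀ u : f ⁻¹' {x}, IsFiniteMeasure (κ u) := fun u => hκ u u.2
  rw [Measure.sum_fintype, integral_finsetSum_measure, perronFrobenius_eq_sum_subtype]
  · refine Finset.sum_congr rfl fun u _ => ?_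
    rw [integral_smul_measure, ENNReal.toReal_ofReal (hρ u).le, smul_eq_mul, mul_comm,
      integral_map (hGu u).aemeasurable hg.1.aestronglyMeasurable]
  · exact fun u _ => (hg.integrable _).smul_measure ENNReal.ofReal_ne_top

/-- The Perron–Frobenius operator acts on almost everywhere classes. -/
lemma perronFrobenius_congr_ae [StandardBorelSpace M] {f : M → M} {m : Measure M}
    (hf : Measurable f) {ρ : M → ℝ} (hJ : HasJacobian f m fun x => 1 / ρ x) (hρm : Measurable ρ)
    (hp : HasInjectivityPartition f) (hfin : ∀ x, (f ⁻¹' {x}).Finite) {φ ψ : M → ℝ}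
    (h : φ =ᵐ[m] ψ) : perronFrobenius f ρ φ =ᵐ[m] perronFrobenius f ρ ψ := by
  filter_upwards [ae_forall_fibre hf hJ (hρm.const_div 1) hp h] with x hx
  rw [perronFrobenius_eq_sum hfin, perronFrobenius_eq_sum hfin]
  refine Finset.sum_congr rfl fun u hu => ?_
  rw [hx u (by simpa using hu)]

variable [StandardBorelSpace K] [Nonempty K]

lemma measurable_leafMeasure_slice (m : Measure M) (μ : Measure (M × K)) [IsFiniteMeasure μ]
    {E : Set (M × K)} (hE : MeasurableSet E) :
    Measurable fun x => leafMeasure m μ x (Prod.mk x ⁻¹' E) := by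
  simp only [leafMeasure, Measure.smul_apply, smul_eq_mul]
  exact (Measure.measurable_rnDeriv _ _).mul
    (ProbabilityTheory.Kernel.measurable_kernel_prodMk_left hE)

lemma lintegral_leafMeasure_slice (m : Measure M) [IsFiniteMeasure m] (μ : Measure (M × K))
    [IsFiniteMeasure μ] (hμ : μ.fst ≪ m) {E : Set (M × K)} (hE : MeasurableSet E) :
    ∫⁻ x, leafMeasure m μ x (Prod.mk x ⁻¹' E) ∂m = μ E := by
  have h1 := lintegral_withDensity_eq_lintegral_mul m (Measure.measurable_rnDeriv μ.fst m)
    (ProbabilityTheory.Kernel.measurable_kernel_prodMk_left (κ := μ.condKernel) hE)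
  rw [Measure.withDensity_rnDeriv_eq _ _ hμ] at h1
  have h2 := Measure.compProd_apply (μ := μ.fst) (κ := μ.condKernel) hE
  rw [Measure.disintegrate] at h2
  rw [h2, h1]
  rfl

/-- The fibre restrictions of the push-forward by the skew product. -/
lemma leafMeasure_map_skewProduct [StandardBorelSpace M] {f : M → M} {m : Measure M}
    [IsFiniteMeasure m] (hinv : MeasurePreserving f m m) {ρ : M → ℝ}
    (hJ : HasJacobian f m fun x => 1 / ρ x) (hρ : ∀ x, 0 < ρ x) (hρm : Measurable ρ)
    (hp : HasInjectivityPartition f) {G : M × K → K} (hG : Measurable G)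
    (μ : Measure (M × K)) [IsFiniteMeasure μ] (hμ : μ.fst ≪ m) :
    ∀ᵐ x ∂m, leafMeasure m (μ.map (skewProduct f G)) x =
      Measure.sum fun u : f ⁻¹' {x} =>
        ENNReal.ofReal (ρ u) • (leafMeasure m μ u).map fun z => G (u, z) := by
  have hf := hinv.measurable
  have hF := measurable_skewProduct hf hG
  have hGu : ∀ u, Measurable fun z => G (u, z) := fun u => hG.comp measurable_prodMk_left
  have hval : ∀ (x : M) {B : Set K}, MeasurableSet B →
      (Measure.sum fun u : f ⁻¹' {x} =>
        ENNReal.ofReal (ρ u) • (leafMeasure m μ u).map fun z => G (u, z)) B =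
      ∑' u : f ⁻¹' {x}, ENNReal.ofReal (ρ u) *
        leafMeasure m μ u (Prod.mk (u : M) ⁻¹' (G ⁻¹' B)) := by
    intro x B hB
    rw [Measure.sum_apply _ hB]
    refine tsum_congr fun u => ?_
    rw [Measure.smul_apply, Measure.map_apply (hGu u) hB, smul_eq_mul]
    rfl
  -- The fibre restrictions are determined by rectangles A × B. There the weighted sum over
  -- preimages integrates, by duality, to the integral of the slices of the preimage of A × B under
  -- the skew product.
  refine leafMeasure_ae_eq m _ (fst_map_skewProduct_absolutelyContinuous hinv hG hμ) _
    (fun B hB => ?_) fun A B hA hB => ?_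
  · simp_rw [fun x => hval x hB]
    exact (lintegral_tsum_fibre_weight hf hJ hρ hρm hp
      (measurable_leafMeasure_slice m μ (hG hB))).1
  · simp_rw [fun x => hval x hB]
    rw [Measure.map_apply hF (hA.prod hB), ← lintegral_leafMeasure_slice m μ hμ (hF (hA.prod hB)),
      ← (lintegral_tsum_fibre_weight hf hJ hρ hρm hp
        (measurable_leafMeasure_slice m μ (hF (hA.prod hB)))).2, ← lintegral_indicator hA]
    refine lintegral_congr fun x => ?_
    by_cases hx : x ∈ A
    · rw [indicator_of_mem hx]
      refine tsum_congr fun u => ?_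
      have hu : f u = x := u.2
      congr 2
      ext z
      simp [skewProduct, hu, hx]
    · rw [indicator_of_notMem hx]
      refine (ENNReal.tsum_eq_zero.2 fun u => ?_).symm
      have hu : f u = x := u.2
      have : Prod.mk (u : M) ⁻¹' (skewProduct f G ⁻¹' A ×ˢ B) = ∅ := by
        ext z
        simp [skewProduct, hu, hx]
      rw [this]
      simp

/-- The integral of `g` with respect to the signed fibre restriction of `s`. -/
def leafIntegral (m : Measure M) (s : SignedMeasure (M × K)) (x : M) (g : K → ℝ) : ℝ :=
  ∫ z, g z ∂(leafMeasure m s.toJordanDecomposition.posPart x) -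
    ∫ z, g z ∂(leafMeasure m s.toJordanDecomposition.negPart x)

lemma leafIntegral_of_eq_sub (m : Measure M) [IsFiniteMeasure m] (s : SignedMeasure (M × K))
    (μ ν : Measure (M × K)) [IsFiniteMeasure μ] [IsFiniteMeasure ν] (hμ : μ.fst ≪ m)
    (hν : ν.fst ≪ m) (h : s = μ.toSignedMeasure - ν.toSignedMeasure) :
    ∀ᵐ x ∂m, ∀ g, BoundedMeasurable g →
      leafIntegral m s x g = ∫ z, g z ∂(leafMeasure m μ x) - ∫ z, g z ∂(leafMeasure m ν x) := by
  filter_upwards [leafMeasure_of_eq_sub m s μ ν hμ hν h, ae_isFiniteMeasure_leafMeasure m μ,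
    ae_isFiniteMeasure_leafMeasure m ν,
    ae_isFiniteMeasure_leafMeasure m s.toJordanDecomposition.posPart,
    ae_isFiniteMeasure_leafMeasure m s.toJordanDecomposition.negPart] with x hx h1 h2 h3 h4 g hg
  have := congrArg (fun κ : Measure K => ∫ z, g z ∂κ) hx
  rw [integral_add_measure (hg.integrable _) (hg.integrable _),
    integral_add_measure (hg.integrable _) (hg.integrable _)] at this
  rw [leafIntegral]
  linarith

/-- Linearity of the fibre integrals in the integrand. -/
lemma leafIntegral_const_add (m : Measure M) (s : SignedMeasure (M × K)) :
    ∀ᵐ x ∂m, ∀ g, BoundedMeasurable g → ∀ a b : ℝ,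
      leafIntegral m s x (fun z => a + b * g z) =
        a * marginalDensity m s x + b * leafIntegral m s x g := by
  filter_upwards [ae_isFiniteMeasure_leafMeasure m s.toJordanDecomposition.posPart,
    ae_isFiniteMeasure_leafMeasure m s.toJordanDecomposition.negPart] with x h3 h4 g hg a b
  rw [leafIntegral, leafIntegral, marginalDensity, ← leafMeasure_univ, ← leafMeasure_univ,
    integral_add (integrable_const _) ((hg.integrable _).const_mul _),
    integral_add (integrable_const _) ((hg.integrable _).const_mul _), integral_const,
    integral_const, integral_const_mul, integral_const_mul]
  simp only [smul_eq_mul, Measure.real]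
  ring

/-- The two parts of the Jordan decomposition are pushed separately. Their images need not be
mutually singular, hence the appeal to `leafIntegral_of_eq_sub`, which accepts any decomposition.
The exceptional null set does not depend on g, as a supremum over g requires. -/
lemma leafIntegral_map_skewProduct [StandardBorelSpace M] {f : M → M} {m : Measure M}
    [IsFiniteMeasure m] (hinv : MeasurePreserving f m m) {ρ : M → ℝ}
    (hJ : HasJacobian f m fun x => 1 / ρ x) (hρ : ∀ x, 0 < ρ x) (hρm : Measurable ρ)
    (hp : HasInjectivityPartition f) (hfin : ∀ x, (f ⁻¹' {x}).Finite)
    {G : M × K → K} (hG : Measurable G)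
    {s : SignedMeasure (M × K)} (hs : MemAB m s) :
    ∀ᵐ x ∂m, ∀ g, BoundedMeasurable g → leafIntegral m (s.map (skewProduct f G)) x g =
      perronFrobenius f ρ (fun u => leafIntegral m s u fun z => g (G (u, z))) x := by
  have hae : ∀ (μ : Measure (M × K)) [IsFiniteMeasure μ],
      ∀ᵐ x ∂m, ∀ u, f u = x → IsFiniteMeasure (leafMeasure m μ u) := fun μ _ =>
    ae_forall_fibre hinv.measurable hJ (hρm.const_div 1) hp (ae_isFiniteMeasure_leafMeasure m μ)
  filter_upwards [leafIntegral_of_eq_sub m _ _ _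
      (fst_map_skewProduct_absolutelyContinuous hinv hG hs.1)
      (fst_map_skewProduct_absolutelyContinuous hinv hG hs.2)
      (map_eq_sub s (measurable_skewProduct hinv.measurable hG)),
    leafMeasure_map_skewProduct hinv hJ hρ hρm hp hG _ hs.1,
    leafMeasure_map_skewProduct hinv hJ hρ hρm hp hG _ hs.2,
    hae s.toJordanDecomposition.posPart, hae s.toJordanDecomposition.negPart]
    with x h1 h2 h3 h4 h5 g hg
  rw [h1 g hg, h2, h3, integral_sum_smul_map_eq hfin hρ hG _ x h4 hg,
    integral_sum_smul_map_eq hfin hρ hG _ x h5 hg]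
  have := (hfin x).fintype
  rw [perronFrobenius_eq_sum_subtype, perronFrobenius_eq_sum_subtype,
    perronFrobenius_eq_sum_subtype, ← Finset.sum_sub_distrib]
  refine Finset.sum_congr rfl fun u _ => ?_
  rw [leafIntegral, sub_mul]

/-- The marginal density is the fibre integral of the constant 1, which composition with G leaves
unchanged. -/
lemma marginalDensity_map_skewProduct [StandardBorelSpace M] {f : M → M} {m : Measure M}
    [IsFiniteMeasure m] (hinv : MeasurePreserving f m m) {ρ : M → ℝ}
    (hJ : HasJacobian f m fun x => 1 / ρ x) (hρ : ∀ x, 0 < ρ x) (hρm : Measurable ρ)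
    (hp : HasInjectivityPartition f) (hfin : ∀ x, (f ⁻¹' {x}).Finite)
    {G : M × K → K} (hG : Measurable G)
    {s : SignedMeasure (M × K)} (hs : MemAB m s) :
    marginalDensity m (s.map (skewProduct f G)) =ᵐ[m]
      perronFrobenius f ρ (marginalDensity m s) := by
  have hone : BoundedMeasurable fun _ : K => (1 : ℝ) := ⟨measurable_const, 1, by simp⟩
  filter_upwards [leafIntegral_map_skewProduct hinv hJ hρ hρm hp hfin hG hs,
    leafIntegral_const_add m (s.map (skewProduct f G)),
    ae_forall_fibre hinv.measurable hJ (hρm.const_div 1) hp (leafIntegral_const_add m s)]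
    with x h1 h2 h3
  have e1 := h2 _ hone 1 0
  simp only [zero_mul, add_zero, one_mul] at e1
  rw [← e1, h1 _ hone, perronFrobenius_eq_sum hfin, perronFrobenius_eq_sum hfin]
  refine Finset.sum_congr rfl fun u hu => ?_
  have e3 := h3 u (by simpa using hu) _ hone 1 0
  simp only [zero_mul, add_zero, one_mul] at e3
  rw [e3]

end LeafPush

/-! ### Norms of Hölder versions of a density -/

section HolderVersions

variable {M : Type*} [MetricSpace M] [MeasurableSpace M] {ζ : ℝ≥0} {m : Measure M}

lemma aeHolderNorm_nonneg (ζ : ℝ≥0) (m : Measure M) (φ : M → ℝ) : 0 ≤ aeHolderNorm ζ m φ := by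
  refine Real.sInf_nonneg ?_
  rintro _ ⟨h, -, -, rfl⟩
  exact holderNorm_nonneg ζ h

lemma aeHolderNorm_le {φ h : M → ℝ} (hh : MemHolder ζ h) (hφ : φ =ᵐ[m] h) :
    aeHolderNorm ζ m φ ≤ holderNorm ζ h := by
  refine csInf_le ⟨0, ?_⟩ ⟨h, hh, hφ, rfl⟩
  rintro _ ⟨k, -, -, rfl⟩
  exact holderNorm_nonneg ζ k

/-- A bound affine in the Hölder norm and valid for every version passes to the infimum. A version
has to exist, as the real infimum of the empty set is 0. -/
lemma le_mul_aeHolderNorm_add {φ : M → ℝ} (hφ : ∃ h, MemHolder ζ h ∧ φ =ᵐ[m] h) {X A B : ℝ}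
    (hA : 0 ≤ A) (hX : ∀ h, MemHolder ζ h → φ =ᵐ[m] h → X ≤ A * holderNorm ζ h + B) :
    X ≤ A * aeHolderNorm ζ m φ + B := by
  refine le_of_forall_pos_le_add fun η hη => ?_
  obtain ⟨h₀, h₀m, h₀φ⟩ := hφ
  obtain ⟨_, ⟨h, hh, hφh, rfl⟩, hlt⟩ := Real.lt_sInf_add_pos
    (s := {c | ∃ h : M → ℝ, MemHolder ζ h ∧ φ =ᵐ[m] h ∧ c = holderNorm ζ h})
    ⟨_, h₀, h₀m, h₀φ, rfl⟩ (show 0 < η / (A + 1) by positivity)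
  have h1 := hX h hh hφh
  have h2 : A * holderNorm ζ h ≤ A * (aeHolderNorm ζ m φ + η / (A + 1)) :=
    mul_le_mul_of_nonneg_left hlt.le hA
  have h3 : A * (η / (A + 1)) ≤ η := by
    rw [mul_div_assoc', div_le_iff₀ (by positivity)]
    nlinarith
  linarith

lemma holderNorm_add_le {M : Type*} [MetricSpace M] [CompactSpace M] {ζ : ℝ≥0}
    (hζ0 : 0 < ζ) {φ ψ : M → ℝ} (hφ : MemHolder ζ φ)
    (hψ : MemHolder ζ ψ) : holderNorm ζ (φ + ψ) ≤ holderNorm ζ φ + holderNorm ζ ψ := by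
  have h1 : ((nnHolderNorm ζ (φ + ψ) : ℝ≥0) : ℝ) ≤ nnHolderNorm ζ φ + nnHolderNorm ζ ψ := by
    exact_mod_cast hφ.nnHolderNorm_add_le hψ
  have h2 : supNorm (φ + ψ) ≤ supNorm φ + supNorm ψ :=
    supNorm_le_of_abs_le (add_nonneg (supNorm_nonneg _) (supNorm_nonneg _)) fun x =>
      (abs_add_le _ _).trans (add_le_add (hφ.abs_le_supNorm hζ0 x) (hψ.abs_le_supNorm hζ0 x))
  simp only [holderNorm]
  linarith

end HolderVersions

/-! ### Fibrewise bounds and the norm of the space -/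

section LeafBounds

variable {M K : Type*} [MeasurableSpace M] [MeasurableSpace K] [StandardBorelSpace K] [Nonempty K]

lemma leafIntegral_add (m : Measure M) [IsFiniteMeasure m] {s t : SignedMeasure (M × K)}
    (hs : MemAB m s) (ht : MemAB m t) :
    ∀ᵐ x ∂m, ∀ g, BoundedMeasurable g →
      leafIntegral m (s + t) x g = leafIntegral m s x g + leafIntegral m t x g := by
  have hst : s + t =
      (s.toJordanDecomposition.posPart + t.toJordanDecomposition.posPart).toSignedMeasure -
      (s.toJordanDecomposition.negPart + t.toJordanDecomposition.negPart).toSignedMeasure := by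
    rw [Measure.toSignedMeasure_add, Measure.toSignedMeasure_add]
    nth_rewrite 1 [eq_posPart_sub_negPart s, eq_posPart_sub_negPart t]
    abel
  filter_upwards [leafIntegral_of_eq_sub m _ _ _
      (by rw [Measure.fst_add]; exact hs.1.add_left ht.1)
      (by rw [Measure.fst_add]; exact hs.2.add_left ht.2) hst,
    leafMeasure_add m _ _ hs.1 ht.1, leafMeasure_add m _ _ hs.2 ht.2,
    ae_isFiniteMeasure_leafMeasure m s.toJordanDecomposition.posPart,
    ae_isFiniteMeasure_leafMeasure m s.toJordanDecomposition.negPart,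
    ae_isFiniteMeasure_leafMeasure m t.toJordanDecomposition.posPart,
    ae_isFiniteMeasure_leafMeasure m t.toJordanDecomposition.negPart]
    with x h1 h2 h3 h4 h5 h6 h7 g hg
  rw [h1 g hg, h2, h3, integral_add_measure (hg.integrable _) (hg.integrable _),
    integral_add_measure (hg.integrable _) (hg.integrable _), leafIntegral, leafIntegral]
  ring

lemma leafIntegral_nnreal_smul (m : Measure M) [IsFiniteMeasure m] {s : SignedMeasure (M × K)}
    (hs : MemAB m s) (c : ℝ≥0) :
    ∀ᵐ x ∂m, ∀ g, BoundedMeasurable g →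
      leafIntegral m ((c : ℝ) • s) x g = c * leafIntegral m s x g := by
  have hst : (c : ℝ) • s = (c • s.toJordanDecomposition.posPart).toSignedMeasure -
      (c • s.toJordanDecomposition.negPart).toSignedMeasure := by
    ext i hi
    have h1 := congrArg (fun v : SignedMeasure (M × K) => v i) (eq_posPart_sub_negPart s)
    simp only [Measure.toSignedMeasure_sub_apply hi] at h1
    rw [Measure.toSignedMeasure_sub_apply hi, _root_.smul_apply, h1]
    simp [mul_sub]
  filter_upwards [leafIntegral_of_eq_sub m _ _ _ (fst_smul_absolutelyContinuous hs.1 c)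
      (fst_smul_absolutelyContinuous hs.2 c) hst,
    leafMeasure_smul m _ hs.1 c, leafMeasure_smul m _ hs.2 c] with x h1 h2 h3 g hg
  rw [h1 g hg, h2, h3, integral_smul_nnreal_measure, integral_smul_nnreal_measure, leafIntegral,
    ← smul_sub, NNReal.smul_def, smul_eq_mul]

lemma leafIntegral_neg (m : Measure M) (s : SignedMeasure (M × K)) (x : M) (g : K → ℝ) :
    leafIntegral m (-s) x g = -leafIntegral m s x g := by
  simp [leafIntegral, SignedMeasure.toJordanDecomposition_neg]

lemma MemAB.neg {M K : Type*} [MeasurableSpace M] [MeasurableSpace K] {m : Measure M}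
    {s : SignedMeasure (M × K)} (hs : MemAB m s) : MemAB m (-s) :=
  ⟨by simpa [SignedMeasure.toJordanDecomposition_neg] using hs.2,
    by simpa [SignedMeasure.toJordanDecomposition_neg] using hs.1⟩

lemma leafIntegral_smul (m : Measure M) [IsFiniteMeasure m] {s : SignedMeasure (M × K)}
    (hs : MemAB m s) (c : ℝ) :
    ∀ᵐ x ∂m, ∀ g, BoundedMeasurable g →
      leafIntegral m (c • s) x g = c * leafIntegral m s x g := by
  rcases le_total 0 c with hc | hc
  · exact leafIntegral_nnreal_smul m hs ⟨c, hc⟩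
  · have h2 : c • s = (-c) • (-s) := by
      ext i hi
      simp
    filter_upwards [leafIntegral_nnreal_smul m hs.neg ⟨-c, neg_nonneg.2 hc⟩] with x hx g hg
    rw [h2]
    refine (hx g hg).trans ?_
    rw [leafIntegral_neg]
    change -c * -leafIntegral m s x g = _
    ring

lemma marginalDensity_eq_leafIntegral (m : Measure M) (s : SignedMeasure (M × K)) (x : M) :
    marginalDensity m s x = leafIntegral m s x fun _ => 1 := by
  simp [marginalDensity, leafIntegral, leafMeasure_univ, Measure.real]

lemma boundedMeasurable_one {K : Type*} [MeasurableSpace K] :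
    BoundedMeasurable fun _ : K => (1 : ℝ) :=
  ⟨measurable_const, 1, by simp⟩

lemma marginalDensity_add (m : Measure M) [IsFiniteMeasure m] {s t : SignedMeasure (M × K)}
    (hs : MemAB m s) (ht : MemAB m t) :
    marginalDensity m (s + t) =ᵐ[m] marginalDensity m s + marginalDensity m t := by
  filter_upwards [leafIntegral_add m hs ht] with x hx
  simp only [Pi.add_apply, marginalDensity_eq_leafIntegral]
  exact hx _ boundedMeasurable_one

lemma marginalDensity_smul (m : Measure M) [IsFiniteMeasure m] {s : SignedMeasure (M × K)}
    (hs : MemAB m s) (c : ℝ) :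
    marginalDensity m (c • s) =ᵐ[m] c • marginalDensity m s := by
  filter_upwards [leafIntegral_smul m hs c] with x hx
  simp only [Pi.smul_apply, smul_eq_mul, marginalDensity_eq_leafIntegral]
  exact hx _ boundedMeasurable_one

lemma integral_marginalDensity {M K : Type*} [MeasurableSpace M] [MeasurableSpace K]
    (m : Measure M) [IsFiniteMeasure m] {s : SignedMeasure (M × K)}
    (hs : MemAB m s) : ∫ x, marginalDensity m s x ∂m = s univ := by
  have h : ∀ (μ : Measure (M × K)) [IsFiniteMeasure μ], μ.fst ≪ m →
      ∫ x, (μ.fst.rnDeriv m x).toReal ∂m = μ.real univ := fun μ _ hμ => by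
    rw [Measure.integral_toReal_rnDeriv hμ, Measure.real, Measure.fst_univ, Measure.real]
  unfold marginalDensity
  rw [integral_sub Measure.integrable_toReal_rnDeriv Measure.integrable_toReal_rnDeriv,
    h _ hs.1, h _ hs.2]
  conv_rhs => rw [eq_posPart_sub_negPart s, Measure.toSignedMeasure_sub_apply MeasurableSet.univ]

variable [MetricSpace K]

/-- A bound, uniform in the fibre, for the integrals of Hölder functions bounded by `R`. -/
def LeafBound (ζ : ℝ≥0) (m : Measure M) (R : ℝ) (s : SignedMeasure (M × K)) (c : ℝ) : Prop :=
  ∀ᵐ x ∂m, ∀ g : K → ℝ, HolderWith 1 ζ g → (∀ z, |g z| ≤ R) → |leafIntegral m s x g| ≤ c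

lemma LeafBound.mono {ζ : ℝ≥0} {m : Measure M} {R R' c c' : ℝ} {s : SignedMeasure (M × K)}
    (h : LeafBound ζ m R s c) (hR : R' ≤ R) (hc : c ≤ c') : LeafBound ζ m R' s c' := by
  filter_upwards [h] with x hx g hg hgR
  exact (hx g hg fun z => (hgR z).trans hR).trans hc

lemma LeafBound.eLInftyNorm_le {ζ : ℝ≥0} {m : Measure M} {c : ℝ} {s : SignedMeasure (M × K)}
    (h : LeafBound ζ m 1 s c) : eLInftyNorm ζ m s ≤ ENNReal.ofReal c := by
  refine essSup_le_of_ae_le _ ?_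
  filter_upwards [h] with x hx
  exact iSup₂_le fun g hg => ENNReal.ofReal_le_ofReal (hx g hg.2.1 hg.2.2)

lemma LeafBound.lInftyNorm_le {ζ : ℝ≥0} {m : Measure M} {c : ℝ} {s : SignedMeasure (M × K)}
    (h : LeafBound ζ m 1 s c) (hc : 0 ≤ c) : lInftyNorm ζ m s ≤ c :=
  ENNReal.toReal_le_of_le_ofReal hc h.eLInftyNorm_le

lemma leafBound_lInftyNorm {ζ : ℝ≥0} (hζ0 : 0 < ζ) {m : Measure M} {s : SignedMeasure (M × K)}
    (hs : eLInftyNorm ζ m s < ⊤) : LeafBound ζ m 1 s (lInftyNorm ζ m s) := by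
  filter_upwards [ENNReal.ae_le_essSup (μ := m) (leafNorm ζ m s)] with x hx g hg hg1
  have h1 : ENNReal.ofReal |leafIntegral m s x g| ≤ leafNorm ζ m s x :=
    le_iSup₂_of_le (f := fun (g : K → ℝ) (_ : Continuous g ∧ HolderWith 1 ζ g ∧ ∀ z, |g z| ≤ 1) =>
      ENNReal.ofReal |leafIntegral m s x g|) g ⟨hg.continuous hζ0, hg, hg1⟩ le_rfl
  exact (ENNReal.ofReal_le_iff_le_toReal hs.ne).1 (h1.trans hx)

lemma lInftyNorm_nonneg (ζ : ℝ≥0) (m : Measure M) (s : SignedMeasure (M × K)) :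
    0 ≤ lInftyNorm ζ m s := ENNReal.toReal_nonneg

/-- Dividing a test function by R ≥ 1 makes it bounded by 1 without increasing its Hölder constant.
-/
lemma LeafBound.scale {ζ : ℝ≥0} {m : Measure M} {R c : ℝ} (hR : 1 ≤ R)
    {s : SignedMeasure (M × K)} (h : LeafBound ζ m 1 s c) : LeafBound ζ m R s (R * c) := by
  have hR0 : 0 < R := by linarith
  filter_upwards [h] with x hx g hg hgR
  have h1 := hx (fun z => R⁻¹ * g z) (holderWith_of_abs_sub_le fun z w => by
      rw [← mul_sub, abs_mul, abs_of_pos (inv_pos.2 hR0)]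
      exact (mul_le_of_le_one_left (abs_nonneg _) (inv_le_one_of_one_le₀ hR)).trans
        (hg.abs_sub_le z w)) (fun z => by
      rw [abs_mul, abs_of_pos (inv_pos.2 hR0), inv_mul_le_one₀ hR0]
      exact hgR z)
  have h2 : leafIntegral m s x (fun z => R⁻¹ * g z) = R⁻¹ * leafIntegral m s x g := by
    rw [leafIntegral, leafIntegral, integral_const_mul, integral_const_mul, mul_sub]
  rwa [h2, abs_mul, abs_of_pos (inv_pos.2 hR0), inv_mul_le_iff₀ hR0] at h1

/-- For R ≥ 1 the constant 1 is an admissible test function. The fibrewise norm thus dominates the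
essential supremum of the marginal density. -/
lemma LeafBound.abs_marginalDensity_le {ζ : ℝ≥0} {m : Measure M} {R c : ℝ} (hR : 1 ≤ R)
    {s : SignedMeasure (M × K)} (h : LeafBound ζ m R s c) :
    ∀ᵐ x ∂m, |marginalDensity m s x| ≤ c := by
  filter_upwards [h] with x hx
  rw [marginalDensity_eq_leafIntegral]
  exact hx _ (holderWith_of_abs_sub_le fun z w => by simp; positivity) fun z => by simpa using hR

lemma HolderWith.boundedMeasurable {K : Type*} [MeasurableSpace K] [MetricSpace K] [BorelSpace K]
    {ζ : ℝ≥0} (hζ0 : 0 < ζ) {g : K → ℝ} {C : ℝ≥0} {R : ℝ}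
    (hg : HolderWith C ζ g) (hR : ∀ z, |g z| ≤ R) : BoundedMeasurable g :=
  ⟨(hg.continuous hζ0).measurable, R, hR⟩

lemma LeafBound.add [BorelSpace K] {ζ : ℝ≥0} (hζ0 : 0 < ζ) {m : Measure M} [IsFiniteMeasure m]
    {R c c' : ℝ} {s t : SignedMeasure (M × K)} (hs : MemAB m s) (ht : MemAB m t)
    (h : LeafBound ζ m R s c) (h' : LeafBound ζ m R t c') : LeafBound ζ m R (s + t) (c + c') := by
  filter_upwards [h, h', leafIntegral_add m hs ht] with x h1 h2 h3 g hg hgR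
  rw [h3 g (hg.boundedMeasurable hζ0 hgR)]
  exact (abs_add_le _ _).trans (add_le_add (h1 g hg hgR) (h2 g hg hgR))

lemma LeafBound.smul [BorelSpace K] {ζ : ℝ≥0} (hζ0 : 0 < ζ) {m : Measure M} [IsFiniteMeasure m]
    {R c : ℝ} {s : SignedMeasure (M × K)} (hs : MemAB m s) (h : LeafBound ζ m R s c) (a : ℝ) :
    LeafBound ζ m R (a • s) (|a| * c) := by
  filter_upwards [h, leafIntegral_smul m hs a] with x h1 h3 g hg hgR
  rw [h3 g (hg.boundedMeasurable hζ0 hgR), abs_mul]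
  exact mul_le_mul_of_nonneg_left (h1 g hg hgR) (abs_nonneg _)

variable [MetricSpace M]

lemma sInftyNorm_nonneg (ζ : ℝ≥0) (m : Measure M) (s : SignedMeasure (M × K)) :
    0 ≤ sInftyNorm ζ m s :=
  add_nonneg (aeHolderNorm_nonneg _ _ _) (lInftyNorm_nonneg _ _ _)

lemma aeHolderNorm_le_sInftyNorm (ζ : ℝ≥0) (m : Measure M) (s : SignedMeasure (M × K)) :
    aeHolderNorm ζ m (marginalDensity m s) ≤ sInftyNorm ζ m s :=
  le_add_of_nonneg_right (lInftyNorm_nonneg _ _ _)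

lemma sInftyNorm_add_le [CompactSpace M] [BorelSpace K] {ζ : ℝ≥0} (hζ0 : 0 < ζ) {m : Measure M}
    [IsFiniteMeasure m] {s t : SignedMeasure (M × K)} (hs : MemSInfty ζ m s)
    (ht : MemSInfty ζ m t) : sInftyNorm ζ m (s + t) ≤ sInftyNorm ζ m s + sInftyNorm ζ m t := by
  have h1 := ((leafBound_lInftyNorm hζ0 hs.2.1).add hζ0 hs.1 ht.1
    (leafBound_lInftyNorm hζ0 ht.2.1)).lInftyNorm_le
    (add_nonneg (lInftyNorm_nonneg _ _ _) (lInftyNorm_nonneg _ _ _))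
  have h2 : aeHolderNorm ζ m (marginalDensity m (s + t)) ≤
      1 * aeHolderNorm ζ m (marginalDensity m s) + aeHolderNorm ζ m (marginalDensity m t) := by
    refine le_mul_aeHolderNorm_add hs.2.2 zero_le_one fun h hh hsh => ?_
    rw [add_comm (1 * _), ← one_mul (aeHolderNorm ζ m (marginalDensity m t))]
    refine le_mul_aeHolderNorm_add ht.2.2 zero_le_one fun k hk htk => ?_
    have := aeHolderNorm_le (hh.add hk) ((marginalDensity_add m hs.1 ht.1).trans (hsh.add htk))
    linarith [holderNorm_add_le hζ0 hh hk]
  simp only [sInftyNorm]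
  linarith

lemma sInftyNorm_smul_le [BorelSpace K] {ζ : ℝ≥0} (hζ0 : 0 < ζ) {m : Measure M}
    [IsFiniteMeasure m] {s : SignedMeasure (M × K)} (hs : MemSInfty ζ m s) (c : ℝ) :
    sInftyNorm ζ m (c • s) ≤ |c| * sInftyNorm ζ m s := by
  have h1 := ((leafBound_lInftyNorm hζ0 hs.2.1).smul hζ0 hs.1 c).lInftyNorm_le
    (mul_nonneg (abs_nonneg _) (lInftyNorm_nonneg _ _ _))
  have h2 : aeHolderNorm ζ m (marginalDensity m (c • s)) ≤
      |c| * aeHolderNorm ζ m (marginalDensity m s) + 0 := by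
    refine le_mul_aeHolderNorm_add hs.2.2 (abs_nonneg c) fun h hh hsh => ?_
    rw [add_zero, ← holderNorm_smul c hh]
    exact aeHolderNorm_le hh.smul ((marginalDensity_smul m hs.1 c).trans (hsh.const_smul c))
  simp only [sInftyNorm]
  linarith

/-- The total mass is bounded by the norm. -/
lemma abs_apply_univ_le [CompactSpace M] [BorelSpace M] {ζ : ℝ≥0} (hζ0 : 0 < ζ)
    {m : Measure M} [IsProbabilityMeasure m] {s : SignedMeasure (M × K)} (hs : MemSInfty ζ m s) :
    |s univ| ≤ sInftyNorm ζ m s := by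
  refine le_trans ?_ (aeHolderNorm_le_sInftyNorm ζ m s)
  have : |s univ| ≤ 1 * aeHolderNorm ζ m (marginalDensity m s) + 0 := by
    refine le_mul_aeHolderNorm_add hs.2.2 zero_le_one fun h hh hsh => ?_
    rw [← integral_marginalDensity m hs.1, integral_congr_ae hsh, one_mul, add_zero]
    refine le_trans ?_ (supNorm_le_holderNorm ζ h)
    have := norm_integral_le_of_norm_le_const (μ := m) (f := h) (C := supNorm h)
      (Eventually.of_forall fun x => hh.abs_le_supNorm hζ0 x)
    simpa using this
  linarith

end LeafBounds

/-! ### Fibre contraction and convergence to equilibrium -/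

section SkewProducts

variable {M K : Type*} [MetricSpace M] [CompactSpace M] [MeasurableSpace M] [BorelSpace M]
  [MetricSpace K] [CompactSpace K] [Nonempty K] [MeasurableSpace K] [BorelSpace K]

/-- A skew product which contracts the fibres by `α`, over a base map for which the
Perron–Frobenius operator with weight `ρ` describes the action on densities and satisfies a
Lasota–Yorke inequality on Hölder functions. -/
structure SkewSystem (ζ : ℝ≥0) (f : M → M) (m : Measure M) (ρ : M → ℝ) (G : M × K → K) (α : ℝ) :
    Prop where
  ζ_pos : 0 < ζ
  measurePreserving : MeasurePreserving f m m
  hasJacobian : HasJacobian f m fun x => 1 / ρ x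
  weight_pos : ∀ x, 0 < ρ x
  measurable_weight : Measurable ρ
  partition : HasInjectivityPartition f
  finite_fibre : ∀ x, (f ⁻¹' {x}).Finite
  measurable_fibreMap : Measurable G
  α_pos : 0 < α
  α_lt_one : α < 1
  contracting : ∀ᵐ x ∂m, ∀ z₁ z₂ : K, dist (G (x, z₁)) (G (x, z₂)) ≤ α * dist z₁ z₂
  memHolder_iterate : ∀ φ : M → ℝ, MemHolder ζ φ → ∀ n,
    MemHolder ζ ((perronFrobenius f ρ)^[n] φ)

namespace SkewSystem

variable {ζ : ℝ≥0} {f : M → M} {m : Measure M} [IsProbabilityMeasure m] {ρ : M → ℝ}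
  {G : M × K → K} {α : ℝ}

lemma ae_sum_weight_eq_one (h : SkewSystem ζ f m ρ G α) :
    ∀ᵐ x ∂m, perronFrobenius f ρ 1 x = 1 := by
  filter_upwards [ae_tsum_fibre_weight_eq_one h.measurePreserving h.hasJacobian h.weight_pos
    h.measurable_weight h.partition] with x hx
  have h1 := ofReal_perronFrobenius h.finite_fibre h.weight_pos (φ := 1) (fun _ => by simp) x
  simp only [Pi.one_apply, ENNReal.ofReal_one, mul_one, hx] at h1
  exact ENNReal.ofReal_eq_one.1 h1

lemma ae_forall_fibre (h : SkewSystem ζ f m ρ G α) {p : M → Prop} (hp : ∀ᵐ y ∂m, p y) :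
    ∀ᵐ x ∂m, ∀ u, f u = x → p u :=
  _root_.ae_forall_fibre h.measurePreserving.measurable h.hasJacobian
    (h.measurable_weight.const_div 1) h.partition hp

/-- The basic inequality: the fibre contraction improves the fibrewise norm, up to the size of the
marginal density. -/
lemma leafBound_map (h : SkewSystem ζ f m ρ G α) {R : ℝ}
    (hRd : Metric.diam (univ : Set K) ^ (ζ : ℝ) ≤ R) {s : SignedMeasure (M × K)} (hs : MemAB m s)
    {b c : ℝ} (hc : LeafBound ζ m R s c) (hb : ∀ᵐ x ∂m, |marginalDensity m s x| ≤ b) :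
    LeafBound ζ m R (s.map (skewProduct f G)) (α ^ (ζ : ℝ) * c + R * b) := by
  have hαζ : 0 < α ^ (ζ : ℝ) := Real.rpow_pos_of_pos h.α_pos _
  have hGu : ∀ u, Measurable fun z => G (u, z) := fun u =>
    h.measurable_fibreMap.comp measurable_prodMk_left
  have hR0 : 0 ≤ R := (Real.rpow_nonneg Metric.diam_nonneg _).trans hRd
  filter_upwards [leafIntegral_map_skewProduct h.measurePreserving h.hasJacobian h.weight_pos
      h.measurable_weight h.partition h.finite_fibre h.measurable_fibreMap hs,
    h.ae_sum_weight_eq_one, h.ae_forall_fibre hc, h.ae_forall_fibre hb,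
    h.ae_forall_fibre h.contracting, h.ae_forall_fibre (leafIntegral_const_add m s)]
    with x h1 h2 h3 h4 h5 h6 g hg hgR
  rw [h1 g (hg.boundedMeasurable h.ζ_pos hgR), perronFrobenius_eq_sum h.finite_fibre]
  rw [perronFrobenius_eq_sum h.finite_fibre] at h2
  simp only [Pi.one_apply, one_mul] at h2
  have hterm : ∀ u, f u = x →
      |leafIntegral m s u fun z => g (G (u, z))| ≤ α ^ (ζ : ℝ) * c + R * b := by
    intro u hu
    -- On the fibre over u the test function becomes k + α^ζ g', where g' has Hölder constant at
    -- most 1 and vanishes at z₀. Hence g' is bounded by diam(K)^ζ ≤ R: with the bound R instead of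
    -- 1, the class of test functions is stable. The constant k is integrated to k times the
    -- marginal density.
    let z₀ : K := Classical.arbitrary K
    let k := g (G (u, z₀))
    let g' : K → ℝ := fun z => (α ^ (ζ : ℝ))⁻¹ * (g (G (u, z)) - k)
    have hlip : ∀ z w, |g (G (u, z)) - g (G (u, w))| ≤ α ^ (ζ : ℝ) * dist z w ^ (ζ : ℝ) := by
      intro z w
      refine (hg.abs_sub_le _ _).trans ?_
      rw [← Real.mul_rpow h.α_pos.le dist_nonneg, NNReal.coe_one, one_mul]
      exact Real.rpow_le_rpow dist_nonneg (h5 u hu z w) ζ.coe_nonneg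
    have hg' : HolderWith 1 ζ g' := holderWith_of_abs_sub_le fun z w => by
      simp only [g']
      rw [← mul_sub, sub_sub_sub_cancel_right, abs_mul, abs_of_pos (inv_pos.2 hαζ),
        inv_mul_le_iff₀ hαζ, NNReal.coe_one, one_mul]
      exact hlip z w
    have hg'R : ∀ z, |g' z| ≤ R := fun z => by
      simp only [g']
      rw [abs_mul, abs_of_pos (inv_pos.2 hαζ), inv_mul_le_iff₀ hαζ]
      refine (hlip z z₀).trans (mul_le_mul_of_nonneg_left (le_trans ?_ hRd) hαζ.le)
      exact Real.rpow_le_rpow dist_nonneg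
        (Metric.dist_le_diam_of_mem isCompact_univ.isBounded (mem_univ _) (mem_univ _))
        ζ.coe_nonneg
    have heq : (fun z => g (G (u, z))) = fun z => k + α ^ (ζ : ℝ) * g' z := by
      funext z
      simp only [g']
      field_simp
      ring
    rw [heq, h6 u hu g' (hg'.boundedMeasurable h.ζ_pos hg'R) k (α ^ (ζ : ℝ))]
    refine (abs_add_le _ _).trans ?_
    rw [abs_mul, abs_mul, abs_of_pos hαζ, add_comm]
    exact add_le_add (mul_le_mul_of_nonneg_left (h3 u hu g' hg' hg'R) hαζ.le)
      (mul_le_mul (hgR _) (h4 u hu) (abs_nonneg _) hR0)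
  calc |∑ u ∈ (h.finite_fibre x).toFinset, (leafIntegral m s u fun z => g (G (u, z))) * ρ u|
      ≤ ∑ u ∈ (h.finite_fibre x).toFinset, |(leafIntegral m s u fun z => g (G (u, z))) * ρ u| :=
        Finset.abs_sum_le_sum_abs _ _
    _ ≤ ∑ u ∈ (h.finite_fibre x).toFinset, (α ^ (ζ : ℝ) * c + R * b) * ρ u := by
        refine Finset.sum_le_sum fun u hu => ?_
        rw [abs_mul, abs_of_pos (h.weight_pos u)]
        exact mul_le_mul_of_nonneg_right (hterm u (by simpa using hu)) (h.weight_pos u).le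
    _ = α ^ (ζ : ℝ) * c + R * b := by rw [← Finset.mul_sum, h2, mul_one]

lemma marginalDensity_map (h : SkewSystem ζ f m ρ G α) {s : SignedMeasure (M × K)}
    (hs : MemAB m s) {φ : M → ℝ} (hφ : marginalDensity m s =ᵐ[m] φ) :
    marginalDensity m (s.map (skewProduct f G)) =ᵐ[m] perronFrobenius f ρ φ :=
  (marginalDensity_map_skewProduct h.measurePreserving h.hasJacobian h.weight_pos
    h.measurable_weight h.partition h.finite_fibre h.measurable_fibreMap hs).trans
    (perronFrobenius_congr_ae h.measurePreserving.measurable h.hasJacobian h.measurable_weight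
      h.partition h.finite_fibre hφ)

lemma memSInfty_map (h : SkewSystem ζ f m ρ G α) {s : SignedMeasure (M × K)}
    (hs : MemSInfty ζ m s) : MemSInfty ζ m (s.map (skewProduct f G)) := by
  obtain ⟨hAB, hfin, φ, hφ, hsφ⟩ := hs
  -- R must dominate diam(K)^ζ for `leafBound_map`, and 1 in order to pass between test functions
  -- bounded by R and by 1.
  set R := max 1 (Metric.diam (univ : Set K) ^ (ζ : ℝ))
  have hb := (leafBound_lInftyNorm h.ζ_pos hfin)
  have h1 := h.leafBound_map (le_max_right _ _) hAB (hb.scale (le_max_left 1 _))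
    (hb.abs_marginalDensity_le le_rfl)
  refine ⟨hAB.map_skewProduct h.measurePreserving h.measurable_fibreMap,
    (h1.mono (le_max_left 1 _) le_rfl).eLInftyNorm_le.trans_lt ENNReal.ofReal_lt_top,
    perronFrobenius f ρ φ, h.memHolder_iterate φ hφ 1, h.marginalDensity_map hAB hsφ⟩

lemma memSInfty_iterate (h : SkewSystem ζ f m ρ G α) {s : SignedMeasure (M × K)}
    (hs : MemSInfty ζ m s) (n : ℕ) :
    MemSInfty ζ m ((fun t => t.map (skewProduct f G))^[n] s) := by
  induction n with
  | zero => exact hs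
  | succ n ih =>
    rw [Function.iterate_succ_apply']
    exact h.memSInfty_map ih

lemma marginalDensity_iterate (h : SkewSystem ζ f m ρ G α) {s : SignedMeasure (M × K)}
    (hs : MemSInfty ζ m s) {φ : M → ℝ} (hφ : marginalDensity m s =ᵐ[m] φ) (n : ℕ) :
    marginalDensity m ((fun t => t.map (skewProduct f G))^[n] s) =ᵐ[m]
      (perronFrobenius f ρ)^[n] φ := by
  induction n with
  | zero => exact hφ
  | succ n ih =>
    rw [Function.iterate_succ_apply', Function.iterate_succ_apply']
    exact h.marginalDensity_map (h.memSInfty_iterate hs n).1 ih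

/-- Exponential convergence to equilibrium. -/
lemma isEquilibriumRate (h : SkewSystem ζ f m ρ G α) {r : ℝ} (hr0 : 0 < r) (hr1 : r < 1)
    (hr : IsBaseDecayRate ζ m f ρ r) :
    IsEquilibriumRate (K := K) ζ m (skewProduct f G) (max (√r) (√(α ^ (ζ : ℝ)))) := by
  obtain ⟨D, hD, hdecay⟩ := hr
  have hαζ : 0 < α ^ (ζ : ℝ) := Real.rpow_pos_of_pos h.α_pos _
  have hαζ1 : α ^ (ζ : ℝ) < 1 :=
    Real.rpow_lt_one h.α_pos.le h.α_lt_one (by exact_mod_cast h.ζ_pos)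
  set t := max (√r) (√(α ^ (ζ : ℝ))) with ht
  have ht0 : 0 < t := lt_max_of_lt_left (Real.sqrt_pos.2 hr0)
  have ht1 : t < 1 := max_lt (by rw [Real.sqrt_lt' one_pos]; simpa using hr1)
    (by rw [Real.sqrt_lt' one_pos]; simpa using hαζ1)
  have hrt : r ≤ t ^ 2 := by
    rw [← Real.sqrt_le_left ht0.le]; exact le_max_left _ _
  have hαt : α ^ (ζ : ℝ) ≤ t ^ 2 := by
    rw [← Real.sqrt_le_left ht0.le]; exact le_max_right _ _
  have htt : 0 < t - t ^ 2 := by nlinarith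
  set R := max 1 (Metric.diam (univ : Set K) ^ (ζ : ℝ)) with hR
  have hR1 : 1 ≤ R := le_max_left _ _
  -- The decay estimate is available from n = 1 on; the maximum with 1 covers n = 0.
  set D' := max D 1 with hD'
  have hD'0 : 0 < D' := lt_max_of_lt_left hD
  -- With Q = C (A + ‖μ‖_∞), the sequence Q t^n dominates the recursion a_{n+1} ≤ α^ζ a_n + R D' r^n
  -- A. Both α^ζ and r are at most t², so the gap t - t² > 0 pays for the source term, and C ≥ R
  -- covers the initial value.
  set C := max R (R * D' / (t - t ^ 2)) with hC
  have hC0 : 0 ≤ C := by positivity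
  refine ⟨C, fun s hs hzero n _ => ?_⟩
  have hkey : ∀ φ, MemHolder ζ φ → marginalDensity m s =ᵐ[m] φ →
      lInftyNorm ζ m ((fun t => t.map (skewProduct f G))^[n] s) ≤
        C * t ^ n * holderNorm ζ φ + C * t ^ n * lInftyNorm ζ m s := by
    intro φ hφ hsφ
    set A := holderNorm ζ φ with hA
    have hA0 : 0 ≤ A := holderNorm_nonneg _ _
    have hl0 : 0 ≤ lInftyNorm ζ m s := lInftyNorm_nonneg _ _ _
    have hmean : ∫ x, φ x ∂m = 0 := by
      rw [← integral_congr_ae hsφ, integral_marginalDensity m hs.1, hzero]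
    have hdec : ∀ n x, |(perronFrobenius f ρ)^[n] φ x| ≤ D' * r ^ n * A := by
      intro n x
      refine ((h.memHolder_iterate φ hφ n).abs_le_supNorm h.ζ_pos x).trans
        ((supNorm_le_holderNorm ζ _).trans ?_)
      rcases Nat.eq_zero_or_pos n with rfl | hn
      · simpa using le_mul_of_one_le_left hA0 (le_max_right D 1)
      · refine (hdecay φ hφ hmean n hn).trans ?_
        gcongr
        exact le_max_left _ _
    set Q := C * (A + lInftyNorm ζ m s) with hQ
    have hbound : ∀ n, LeafBound ζ m R ((fun t => t.map (skewProduct f G))^[n] s) (Q * t ^ n) := by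
      intro n
      induction n with
      | zero =>
        refine ((leafBound_lInftyNorm h.ζ_pos hs.2.1).scale hR1).mono le_rfl ?_
        rw [pow_zero, mul_one, hQ]
        exact mul_le_mul (le_max_left _ _) (by linarith) hl0 hC0
      | succ n ih =>
        rw [Function.iterate_succ_apply']
        have hb : ∀ᵐ x ∂m, |marginalDensity m ((fun t => t.map (skewProduct f G))^[n] s) x| ≤
            D' * r ^ n * A := by
          filter_upwards [h.marginalDensity_iterate hs hsφ n] with x hx
          rw [hx]
          exact hdec n x
        refine (h.leafBound_map (le_max_right _ _) (h.memSInfty_iterate hs n).1 ih hb).mono le_rfl ?_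
        have hQ0 : 0 ≤ Q := by positivity
        have hrn : r ^ n ≤ t ^ n := by
          refine pow_le_pow_left₀ hr0.le (hrt.trans ?_) n
          nlinarith
        have h1 : R * D' * A ≤ Q * (t - t ^ 2) := by
          have h2 : R * D' ≤ C * (t - t ^ 2) := by
            rw [← div_le_iff₀ htt]; exact le_max_right _ _
          calc R * D' * A ≤ C * (t - t ^ 2) * A := mul_le_mul_of_nonneg_right h2 hA0
            _ ≤ C * (t - t ^ 2) * (A + lInftyNorm ζ m s) := by
              refine mul_le_mul_of_nonneg_left (by linarith) (by positivity)
            _ = _ := by rw [hQ]; ring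
        calc α ^ (ζ : ℝ) * (Q * t ^ n) + R * (D' * r ^ n * A)
            ≤ t ^ 2 * (Q * t ^ n) + R * (D' * t ^ n * A) := by gcongr
          _ = t ^ n * (Q * t ^ 2 + R * D' * A) := by ring
          _ ≤ t ^ n * (Q * t ^ 2 + Q * (t - t ^ 2)) := by gcongr
          _ = Q * t ^ (n + 1) := by ring
    refine (((hbound n).mono hR1 le_rfl).lInftyNorm_le (by positivity)).trans (le_of_eq ?_)
    rw [hQ]
    ring
  refine (le_mul_aeHolderNorm_add hs.2.2 (by positivity) hkey).trans (le_of_eq ?_)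
  rw [sInftyNorm]
  ring

end SkewSystem

end SkewProducts

/-! ### An invariant probability over the invariant measure of the base -/

section InvariantMeasure

/-- C(K, ℝ) is separable, and membership in a closed ball is tested at a dense sequence of points of
K. Measurability of the evaluations is therefore enough. -/
lemma stronglyMeasurable_continuousMap {X K : Type*} [MeasurableSpace X] [MetricSpace K]
    [CompactSpace K] [Nonempty K] {Ψ : X → C(K, ℝ)} (h : ∀ z, Measurable fun x => Ψ x z) :
    StronglyMeasurable Ψ := by
  let : MeasurableSpace C(K, ℝ) := borel _
  have : BorelSpace C(K, ℝ) := ⟨rfl⟩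
  refine Measurable.stronglyMeasurable (measurable_of_isOpen fun U hU => ?_)
  have hball : ∀ (c : C(K, ℝ)) (r : ℝ), 0 ≤ r → MeasurableSet (Ψ ⁻¹' Metric.closedBall c r) := by
    intro c r hr
    have : Ψ ⁻¹' Metric.closedBall c r =
        ⋂ n : ℕ, {x | dist (Ψ x (TopologicalSpace.denseSeq K n))
          (c (TopologicalSpace.denseSeq K n)) ≤ r} := by
      ext x
      simp only [mem_preimage, Metric.mem_closedBall, mem_iInter, mem_ofPred_eq]
      rw [ContinuousMap.dist_le hr]
      refine ⟨fun hx n => hx _, fun hx z => ?_⟩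
      have hcl : IsClosed {z | dist (Ψ x z) (c z) ≤ r} :=
        isClosed_le ((Ψ x).continuous.dist c.continuous) continuous_const
      have hsub : closure (range (TopologicalSpace.denseSeq K)) ⊆ {z | dist (Ψ x z) (c z) ≤ r} :=
        closure_minimal (by rintro _ ⟨n, rfl⟩; exact hx n) hcl
      rw [(TopologicalSpace.denseRange_denseSeq K).closure_range] at hsub
      exact hsub (mem_univ z)
    rw [this]
    exact MeasurableSet.iInter fun n => measurableSet_le ((h _).dist measurable_const)
      measurable_const
  have hcover : Ψ ⁻¹' U = ⋃ p ∈ {p : ℕ × ℕ |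
      Metric.closedBall (TopologicalSpace.denseSeq C(K, ℝ) p.1) (1 / (p.2 + 1 : ℝ)) ⊆ U},
      Ψ ⁻¹' Metric.closedBall (TopologicalSpace.denseSeq C(K, ℝ) p.1) (1 / (p.2 + 1 : ℝ)) := by
    ext x
    simp only [mem_iUnion, mem_preimage, mem_ofPred_eq, exists_prop]
    refine ⟨fun hx => ?_, fun ⟨p, hp, hx⟩ => hp hx⟩
    obtain ⟨ε, hε, hεU⟩ := Metric.isOpen_iff.1 hU _ hx
    obtain ⟨k, hk⟩ := exists_nat_one_div_lt (half_pos hε)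
    obtain ⟨n, hn⟩ := (TopologicalSpace.denseRange_denseSeq C(K, ℝ)).exists_dist_lt (Ψ x)
      (Nat.one_div_pos_of_nat (n := k) (α := ℝ))
    refine ⟨(n, k), fun y hy => hεU ?_, by simpa using hn.le⟩
    rw [Metric.mem_closedBall] at hy
    rw [Metric.mem_ball]
    have := dist_triangle_right y (Ψ x) (TopologicalSpace.denseSeq C(K, ℝ) n)
    simp only at hy
    linarith
  rw [hcover]
  exact MeasurableSet.biUnion (to_countable _) fun p _ => hball _ _ (by positivity)

variable {M K : Type*} [MetricSpace M] [CompactSpace M] [MeasurableSpace M] [BorelSpace M]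
  [MetricSpace K] [CompactSpace K] [Nonempty K] [MeasurableSpace K] [BorelSpace K]

/-- Among the measures with a fixed marginal on the base, weak convergence is tested by functions
that are only measurable in the base variable. -/
lemma tendsto_integral_of_fst_eq {ι : Type*} {l : Filter ι} {m : Measure M} [IsProbabilityMeasure m]
    {νs : ι → ProbabilityMeasure (M × K)} {ν : ProbabilityMeasure (M × K)}
    (h : Tendsto νs l (𝓝 ν)) (hνs : ∀ i, (νs i : Measure (M × K)).fst = m)
    (hν : (ν : Measure (M × K)).fst = m) {Ψ : M → C(K, ℝ)} (hΨ : ∀ z, Measurable fun x => Ψ x z)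
    {B : ℝ} (hB : ∀ x, ‖Ψ x‖ ≤ B) :
    Tendsto (fun i => ∫ p, Ψ p.1 p.2 ∂(νs i : Measure (M × K))) l
      (𝓝 (∫ p, Ψ p.1 p.2 ∂(ν : Measure (M × K)))) := by
  have hsm := stronglyMeasurable_continuousMap hΨ
  have hint : Integrable Ψ m := Integrable.of_bound hsm.aestronglyMeasurable B
    (Eventually.of_forall hB)
  have hmeas : Measurable fun p : M × K => Ψ p.1 p.2 := by
    have := measurable_uncurry_of_continuous_of_measurable (u := fun z x => Ψ x z)
      (fun x => (Ψ x).continuous) hΨ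
    exact this.comp measurable_swap
  rw [Metric.tendsto_nhds]
  intro ε hε
  -- Ψ is approximated by a continuous g in L¹(m; C(K, ℝ)). As all the measures have marginal m,
  -- replacing Ψ by g costs each of them at most the same ε/4.
  obtain ⟨g, hg, hgi⟩ := hint.exists_boundedContinuous_integral_sub_le (show 0 < ε / 4 by positivity)
  have hgc : Continuous fun p : M × K => g p.1 p.2 := by
    have : Continuous fun p : M × K => (g p.1, p.2) := by fun_prop
    exact (ContinuousEval.continuous_eval (F := C(K, ℝ)) (X := K) (Y := ℝ)).comp this
  let gb : BoundedContinuousFunction (M × K) ℝ := BoundedContinuousFunction.mkOfCompact ⟨_, hgc⟩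
  have hΨi : ∀ κ : Measure (M × K), IsProbabilityMeasure κ →
      Integrable (fun p : M × K => Ψ p.1 p.2) κ := fun κ _ =>
    Integrable.of_bound hmeas.aestronglyMeasurable B
      (Eventually.of_forall fun p => ((Ψ p.1).norm_coe_le_norm p.2).trans (hB _))
  have hclose : ∀ κ : Measure (M × K), IsProbabilityMeasure κ → κ.fst = m →
      |∫ p, Ψ p.1 p.2 ∂κ - ∫ p, gb p ∂κ| ≤ ε / 4 := by
    intro κ hκ hκm
    have hnm : StronglyMeasurable fun x => ‖Ψ x - g x‖ :=
      (hsm.sub g.continuous.stronglyMeasurable).norm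
    have hni : Integrable (fun p : M × K => ‖Ψ p.1 - g p.1‖) κ := by
      have : Integrable (fun x => ‖Ψ x - g x‖) (κ.map Prod.fst) := by
        change Integrable _ κ.fst
        rw [hκm]
        exact (hint.sub hgi).norm
      exact this.comp_measurable measurable_fst
    rw [← integral_sub (hΨi κ hκ) (gb.integrable κ)]
    calc |∫ p, (Ψ p.1 p.2 - gb p) ∂κ| ≤ ∫ p, |Ψ p.1 p.2 - gb p| ∂κ := abs_integral_le_integral_abs
      _ ≤ ∫ p, ‖Ψ p.1 - g p.1‖ ∂κ := by
        refine integral_mono ((hΨi κ hκ).sub (gb.integrable κ)).abs hni fun p => ?_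
        exact (Ψ p.1 - g p.1).norm_coe_le_norm p.2
      _ = ∫ x, ‖Ψ x - g x‖ ∂m := by
        rw [← hκm, Measure.fst, integral_map measurable_fst.aemeasurable
          hnm.aestronglyMeasurable]
      _ ≤ ε / 4 := hg
  have htend := (ProbabilityMeasure.tendsto_iff_forall_integral_tendsto.1 h) gb
  filter_upwards [(Metric.tendsto_nhds.1 htend) (ε / 4) (by positivity)] with i hi
  have h1 := abs_le.1 (hclose _ inferInstance (hνs i))
  have h2 := abs_le.1 (hclose _ inferInstance hν)
  rw [Real.dist_eq] at hi ⊢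
  have h3 := abs_lt.1 hi
  rw [abs_lt]
  constructor <;> linarith [h1.1, h1.2, h2.1, h2.2, h3.1, h3.2]

lemma skewProduct_iterate_fst {M K : Type*} (f : M → M) (G : M × K → K) (k : ℕ) (p : M × K) :
    ((skewProduct f G)^[k] p).1 = f^[k] p.1 := by
  induction k with
  | zero => rfl
  | succ k ih => rw [Function.iterate_succ_apply', Function.iterate_succ_apply', skewProduct, ih]

/-- Invariance of m makes almost every orbit of f avoid the bad base points. Two points over the
same base point stay over a common one, so only the distance in K counts. -/
lemma ae_dist_skewProduct_iterate_le {f : M → M} {m : Measure M} (hf : MeasurePreserving f m m)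
    {G : M × K → K} {α : ℝ} (hα0 : 0 ≤ α)
    (hG : ∀ᵐ x ∂m, ∀ z₁ z₂ : K, dist (G (x, z₁)) (G (x, z₂)) ≤ α * dist z₁ z₂) :
    ∀ᵐ x ∂m, ∀ k z₁ z₂, dist ((skewProduct f G)^[k] (x, z₁)) ((skewProduct f G)^[k] (x, z₂)) ≤
      α ^ k * dist z₁ z₂ := by
  have hall : ∀ᵐ x ∂m, ∀ k : ℕ, ∀ z₁ z₂ : K,
      dist (G (f^[k] x, z₁)) (G (f^[k] x, z₂)) ≤ α * dist z₁ z₂ :=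
    ae_all_iff.2 fun k => (hf.iterate k).quasiMeasurePreserving.ae hG
  filter_upwards [hall] with x hx k z₁ z₂
  induction k with
  | zero => simp [Prod.dist_eq]
  | succ k ih =>
    have h1 := skewProduct_iterate_fst f G k (x, z₁)
    have h2 := skewProduct_iterate_fst f G k (x, z₂)
    rw [Function.iterate_succ_apply', Function.iterate_succ_apply']
    generalize (skewProduct f G)^[k] (x, z₁) = p₁ at *
    generalize (skewProduct f G)^[k] (x, z₂) = p₂ at *
    obtain ⟨x₁, w₁⟩ := p₁
    obtain ⟨x₂, w₂⟩ := p₂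
    simp only at h1 h2
    subst h1 h2
    have h3 : dist w₁ w₂ ≤ α ^ k * dist z₁ z₂ := by simpa [Prod.dist_eq] using ih
    have h4 := hx k w₁ w₂
    simp only [skewProduct, Prod.dist_eq, dist_self]
    refine max_le (by positivity) (h4.trans ?_)
    calc α * dist w₁ w₂ ≤ α * (α ^ k * dist z₁ z₂) := mul_le_mul_of_nonneg_left h3 hα0
      _ = α ^ (k + 1) * dist z₁ z₂ := by ring

lemma fst_map_skewProduct_iterate {f : M → M} {m : Measure M} (hf : MeasurePreserving f m m)
    {G : M × K → K} (hG : Measurable G) {ν : Measure (M × K)} (hν : ν.fst = m) (k : ℕ) :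
    (ν.map (skewProduct f G)^[k]).fst = m := by
  have hF := measurable_skewProduct hf.measurable hG
  rw [Measure.fst, Measure.map_map measurable_fst (hF.iterate k)]
  have : Prod.fst ∘ (skewProduct f G)^[k] = f^[k] ∘ Prod.fst := by
    funext p
    exact skewProduct_iterate_fst f G k p
  rw [this, ← Measure.map_map (hf.measurable.iterate k) measurable_fst]
  change ν.fst.map _ = m
  rw [hν, (hf.iterate k).map_eq]

/-- A skew product that contracts the fibres has an invariant probability that projects to a given
invariant probability of the base. -/
theorem exists_invariant_measure {f : M → M} {m : Measure M} [IsProbabilityMeasure m]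
    (hf : MeasurePreserving f m m) {G : M × K → K} (hG : Measurable G) {α : ℝ} (hα0 : 0 ≤ α)
    (hα1 : α < 1)
    (hcon : ∀ᵐ x ∂m, ∀ z₁ z₂ : K, dist (G (x, z₁)) (G (x, z₂)) ≤ α * dist z₁ z₂) :
    ∃ ν : Measure (M × K), IsProbabilityMeasure ν ∧ ν.fst = m ∧ ν.map (skewProduct f G) = ν := by
  have hF := measurable_skewProduct hf.measurable hG
  obtain ⟨z₀⟩ := ‹Nonempty K›
  let ν₀ : Measure (M × K) := m.prod (Measure.dirac z₀)
  have hν₀ : ν₀.fst = m := by simp [ν₀]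
  let νs : ℕ → ProbabilityMeasure (M × K) := fun k =>
    ⟨ν₀.map (skewProduct f G)^[k], Measure.isProbabilityMeasure_map (hF.iterate k).aemeasurable⟩
  have hνs : ∀ k, (νs k : Measure (M × K)).fst = m := fun k =>
    fst_map_skewProduct_iterate hf hG hν₀ k
  -- Weak compactness gives a limit of the push-forwards along an ultrafilter, with no choice of
  -- subsequence.
  let U : Ultrafilter ℕ := Ultrafilter.of atTop
  have hU : (U : Filter ℕ) ≤ atTop := Ultrafilter.of_le atTop
  obtain ⟨ν, -, hlim⟩ := isCompact_univ.ultrafilter_le_nhds (U.map νs) (by simp)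
  have hlim : Tendsto νs U (𝓝 ν) := hlim
  have htend := ProbabilityMeasure.tendsto_iff_forall_integral_tendsto.1 hlim
  have hνm : (ν : Measure (M × K)).fst = m := by
    refine ext_of_forall_integral_eq_of_IsFiniteMeasure fun a => ?_
    have h1 := htend (a.compContinuous ⟨Prod.fst, continuous_fst⟩)
    have h2 : ∀ κ : Measure (M × K), ∫ p, a.compContinuous ⟨Prod.fst, continuous_fst⟩ p ∂κ =
        ∫ x, a x ∂κ.fst := fun κ => by
      rw [Measure.fst, integral_map measurable_fst.aemeasurable
        a.continuous.measurable.aestronglyMeasurable]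
      rfl
    simp only [h2, hνs] at h1
    exact tendsto_nhds_unique tendsto_const_nhds h1 |>.symm
  refine ⟨ν, inferInstance, hνm, ?_⟩
  have := Measure.isProbabilityMeasure_map (μ := (ν : Measure (M × K))) hF.aemeasurable
  refine ext_of_forall_integral_eq_of_IsFiniteMeasure fun φ => ?_
  rw [integral_map hF.aemeasurable φ.continuous.measurable.aestronglyMeasurable]
  have hiter := ae_dist_skewProduct_iterate_le hf hα0 hcon
  have huc : UniformContinuous φ := CompactSpace.uniformContinuous_of_continuous φ.continuous
  -- the integral of `φ ∘ F` against `ν` is the limit of the integrals against `νs`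
  have hA : Tendsto (fun k => ∫ p, φ (skewProduct f G p) ∂(νs k : Measure (M × K))) U
      (𝓝 (∫ p, φ (skewProduct f G p) ∂(ν : Measure (M × K)))) := by
    classical
    obtain ⟨S, hSsub, hSm, hS0⟩ := exists_measurable_superset_of_null (ae_iff.1 hcon)
    have hcont : ∀ x, x ∉ S → Continuous fun z => φ (skewProduct f G (x, z)) := by
      intro x hx
      have hx' : ∀ z₁ z₂ : K, dist (G (x, z₁)) (G (x, z₂)) ≤ α * dist z₁ z₂ := by
        by_contra hc
        exact hx (hSsub hc)
      have hGx : Continuous fun z => G (x, z) :=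
        (LipschitzWith.of_dist_le_mul (K := ⟨α, hα0⟩) hx').continuous
      have hFx : Continuous fun z => skewProduct f G (x, z) :=
        (continuous_const (y := f x)).prodMk hGx
      exact φ.continuous.comp hFx
    -- The skew product is only measurable in x, so weak convergence does not apply directly. Off a
    -- null set of x it is continuous along the fibre, as `tendsto_integral_of_fst_eq` requires.
    let Ψ : M → C(K, ℝ) := fun x => if hx : x ∈ S then 0 else ⟨_, hcont x hx⟩
    have hΨe : ∀ x, x ∉ S → ∀ z, Ψ x z = φ (skewProduct f G (x, z)) := by
      intro x hx z
      simp only [Ψ, dif_neg hx]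
      rfl
    have hΨm : ∀ z, Measurable fun x => Ψ x z := by
      intro z
      have : (fun x => Ψ x z) = S.piecewise (fun _ => (0 : ℝ)) fun x => φ (skewProduct f G (x, z)) := by
        funext x
        by_cases hx : x ∈ S
        · simp [Ψ, hx]
        · rw [hΨe x hx]
          simp [hx]
      rw [this]
      exact Measurable.piecewise hSm measurable_const
        (φ.continuous.measurable.comp (hF.comp measurable_prodMk_right))
    have hΨb : ∀ x, ‖Ψ x‖ ≤ ‖φ‖ := by
      intro x
      rw [ContinuousMap.norm_le _ (norm_nonneg _)]
      intro z
      by_cases hx : x ∈ S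
      · simp [Ψ, hx]
      · rw [hΨe x hx]
        exact φ.norm_coe_le_norm _
    have hSae : ∀ κ : Measure (M × K), κ.fst = m →
        ∫ p, Ψ p.1 p.2 ∂κ = ∫ p, φ (skewProduct f G p) ∂κ := by
      intro κ hκ
      refine integral_congr_ae ?_
      have h1 : ∀ᵐ x ∂κ.map Prod.fst, x ∉ S := by
        change ∀ᵐ x ∂κ.fst, x ∉ S
        rw [hκ]
        exact measure_eq_zero_iff_ae_notMem.1 hS0
      filter_upwards [ae_of_ae_map measurable_fst.aemeasurable h1] with p hp
      exact hΨe p.1 hp p.2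
    have := tendsto_integral_of_fst_eq hlim hνs hνm hΨm hΨb
    rw [hSae _ hνm] at this
    simpa only [hSae _ (hνs _)] using this
  have hB := htend φ
  have hshift : ∀ k, ∫ p, φ (skewProduct f G p) ∂(νs k : Measure (M × K)) =
      ∫ p, φ ((skewProduct f G)^[k] p) ∂(ν₀.map (skewProduct f G)) := by
    intro k
    change ∫ p, _ ∂(ν₀.map (skewProduct f G)^[k]) = _
    have hm1 : Measurable fun p => φ (skewProduct f G p) := φ.continuous.measurable.comp hF
    have hm2 : Measurable fun p => φ ((skewProduct f G)^[k] p) :=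
      φ.continuous.measurable.comp (hF.iterate k)
    rw [integral_map (hF.iterate k).aemeasurable hm1.aestronglyMeasurable,
      integral_map hF.aemeasurable hm2.aestronglyMeasurable]
    simp only [← Function.iterate_succ_apply, ← Function.iterate_succ_apply']
  -- Both integrals are integrals of φ ∘ F^k, with F the skew product, against two probabilities
  -- with marginal m: the image of ν₀ and ν₀. By fibre contraction φ ∘ F^k almost depends on x
  -- alone, so both are close to the integral of `a` over M. No averaging over k is needed.
  have hC : Tendsto (fun k => ∫ p, φ (skewProduct f G p) ∂(νs k : Measure (M × K)) -
      ∫ p, φ p ∂(νs k : Measure (M × K))) atTop (𝓝 0) := by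
    rw [Metric.tendsto_atTop]
    intro ε hε
    obtain ⟨δ, hδ, hφδ⟩ := Metric.uniformContinuous_iff.1 huc (ε / 3) (by positivity)
    have hpow : Tendsto (fun k : ℕ => α ^ k * Metric.diam (univ : Set K)) atTop (𝓝 0) := by
      simpa using (tendsto_pow_atTop_nhds_zero_of_lt_one hα0 hα1).mul_const
        (Metric.diam (univ : Set K))
    obtain ⟨k₀, hk₀⟩ := eventually_atTop.1 (hpow.eventually (gt_mem_nhds hδ))
    refine ⟨k₀, fun k hk => ?_⟩
    have hk' := hk₀ k hk
    let a : M → ℝ := fun x => φ ((skewProduct f G)^[k] (x, z₀))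
    have ha : Measurable a :=
      φ.continuous.measurable.comp ((hF.iterate k).comp measurable_prodMk_right)
    have hosc : ∀ κ : Measure (M × K), IsProbabilityMeasure κ → κ.fst = m →
        |∫ p, φ ((skewProduct f G)^[k] p) ∂κ - ∫ x, a x ∂m| ≤ ε / 3 := by
      intro κ hκ hκm
      have h1 : ∫ x, a x ∂m = ∫ p, a p.1 ∂κ := by
        rw [← hκm, Measure.fst, integral_map measurable_fst.aemeasurable ha.aestronglyMeasurable]
      have hi1 : Integrable (fun p => φ ((skewProduct f G)^[k] p)) κ :=
        Integrable.of_bound (φ.continuous.measurable.comp (hF.iterate k)).aestronglyMeasurable ‖φ‖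
          (Eventually.of_forall fun p => φ.norm_coe_le_norm _)
      have hi2 : Integrable (fun p : M × K => a p.1) κ :=
        Integrable.of_bound (ha.comp measurable_fst).aestronglyMeasurable ‖φ‖
          (Eventually.of_forall fun p => φ.norm_coe_le_norm _)
      rw [h1, ← integral_sub hi1 hi2, ← Real.norm_eq_abs]
      have h2 : ∀ᵐ p ∂κ, ‖φ ((skewProduct f G)^[k] p) - a p.1‖ ≤ ε / 3 := by
        have h3 := hiter
        rw [← hκm, Measure.fst] at h3
        filter_upwards [ae_of_ae_map measurable_fst.aemeasurable h3] with p hp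
        have h4 := hp k p.2 z₀
        refine (hφδ (lt_of_le_of_lt (h4.trans ?_) hk')).le
        exact mul_le_mul_of_nonneg_left (Metric.dist_le_diam_of_mem isCompact_univ.isBounded
          (mem_univ _) (mem_univ _)) (pow_nonneg hα0 k)
      simpa using norm_integral_le_of_norm_le_const h2
    have hp1 := Measure.isProbabilityMeasure_map (μ := ν₀) hF.aemeasurable
    have h1 := abs_le.1 (hosc _ hp1 (fst_map_skewProduct_iterate hf hG hν₀ 1))
    have h2 := abs_le.1 (hosc ν₀ inferInstance hν₀)
    have h3 : ∫ p, φ p ∂(νs k : Measure (M × K)) = ∫ p, φ ((skewProduct f G)^[k] p) ∂ν₀ :=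
      integral_map (hF.iterate k).aemeasurable φ.continuous.measurable.aestronglyMeasurable
    rw [hshift, h3, Real.dist_eq, sub_zero, abs_lt]
    constructor <;> linarith [h1.1, h1.2, h2.1, h2.2]
  exact sub_eq_zero.1 (tendsto_nhds_unique (hA.sub hB) (hC.mono_left hU))

/-- A probability whose marginal is `m` belongs to `S^∞`. -/
lemma memSInfty_toSignedMeasure {ζ : ℝ≥0} (hζ0 : 0 < ζ) {m : Measure M} [IsProbabilityMeasure m]
    {ν : Measure (M × K)} [IsProbabilityMeasure ν] (hν : ν.fst = m) :
    MemSInfty ζ m ν.toSignedMeasure := by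
  have hν' : ν.fst ≪ m := by rw [hν]
  have h0 : (0 : Measure (M × K)).fst ≪ m := by simp [Measure.AbsolutelyContinuous.zero]
  have heq : ν.toSignedMeasure = ν.toSignedMeasure - (0 : Measure (M × K)).toSignedMeasure := by
    simp
  have hle : ∀ᵐ x ∂m, leafMeasure m ν x univ = 1 ∧ leafMeasure m (0 : Measure (M × K)) x = 0 := by
    have h1 := Measure.rnDeriv_self m
    have h2 := Measure.rnDeriv_zero m
    filter_upwards [h1, h2] with x hx1 hx2
    refine ⟨by rw [leafMeasure_univ, hν, hx1], ?_⟩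
    rw [← Measure.measure_univ_eq_zero, leafMeasure_univ]
    simpa using hx2
  refine ⟨memAB_of_eq_sub _ _ _ hν' h0 heq, ?_, fun _ => 1, ?_, ?_⟩
  · have hb : LeafBound ζ m 1 ν.toSignedMeasure 1 := by
      filter_upwards [leafIntegral_of_eq_sub m _ _ _ hν' h0 heq, hle] with x hx hx1 g hg hg1
      rw [hx g (hg.boundedMeasurable hζ0 hg1), hx1.2, integral_zero_measure, sub_zero]
      have hp : IsProbabilityMeasure (leafMeasure m ν x) := ⟨hx1.1⟩
      simpa using norm_integral_le_of_norm_le_const (μ := leafMeasure m ν x)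
        (Eventually.of_forall fun z => (Real.norm_eq_abs (g z)).le.trans (hg1 z))
    exact hb.eLInftyNorm_le.trans_lt ENNReal.ofReal_lt_top
  · exact memHolder_of_abs_sub_le le_rfl fun x y => by simp
  · filter_upwards [marginalDensity_of_eq_sub m _ _ _ hν' h0 heq, hle] with x hx hx1
    rw [hx, hx1.1, hx1.2]
    simp

end InvariantMeasure

/-! ### Decay on the zero-average space and the rank-one decomposition -/

section SpectralGap

lemma abs_clamp_sub_clamp_le (b u v : ℝ) :
    |max (-b) (min b u) - max (-b) (min b v)| ≤ |u - v| := by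
  refine (abs_max_sub_max_le_max _ _ _ _).trans ?_
  rw [sub_self, abs_zero, max_eq_right (abs_nonneg _)]
  refine (abs_min_sub_min_le_max _ _ _ _).trans ?_
  rw [sub_self, abs_zero, max_eq_right (abs_nonneg _)]

variable {M K : Type*} [MetricSpace M] [CompactSpace M] [MeasurableSpace M] [BorelSpace M]
  [MetricSpace K] [CompactSpace K] [Nonempty K] [MeasurableSpace K] [BorelSpace K]

namespace SkewSystem

variable {ζ : ℝ≥0} {f : M → M} {m : Measure M} [IsProbabilityMeasure m] {ρ : M → ℝ}
  {G : M × K → K} {α : ℝ}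

/-- The Lasota–Yorke inequality, with an essential bound for the iterate in place of the uniform
norm: the version of the density is truncated before the inequality is applied again. -/
lemma aeHolderNorm_iterate_le (h : SkewSystem ζ f m ρ G α) {s : SignedMeasure (M × K)}
    (hs : MemSInfty ζ m s) {lam B C : ℝ} (hlam0 : 0 < lam) (hlam1 : lam < 1) (hB : 0 < B)
    (hC : 0 < C)
    (hLY : ∀ g : M → ℝ, MemHolder ζ g → ∀ n ≥ 1,
      holderNorm ζ ((perronFrobenius f ρ)^[n] g) ≤ B * lam ^ n * holderNorm ζ g + C * supNorm g)
    {j k : ℕ} (hj : 1 ≤ j) (hk : 1 ≤ k) :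
    aeHolderNorm ζ m (marginalDensity m ((fun t => t.map (skewProduct f G))^[j + k] s)) ≤
      B * (B + C) * lam ^ j * aeHolderNorm ζ m (marginalDensity m s) +
        (B + C) * lInftyNorm ζ m ((fun t => t.map (skewProduct f G))^[k] s) := by
  have hsk := h.memSInfty_iterate hs k
  set b := lInftyNorm ζ m ((fun t => t.map (skewProduct f G))^[k] s)
  have hb : 0 ≤ b := lInftyNorm_nonneg _ _ _
  refine le_mul_aeHolderNorm_add hs.2.2 (by positivity) fun φ hφ hsφ => ?_
  set ψ := (perronFrobenius f ρ)^[k] φ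
  have hψ : MemHolder ζ ψ := h.memHolder_iterate φ hφ k
  have hψn : holderNorm ζ ψ ≤ (B + C) * holderNorm ζ φ := by
    have h1 := hLY φ hφ k hk
    have h2 : B * lam ^ k * holderNorm ζ φ ≤ B * 1 * holderNorm ζ φ := by
      gcongr
      · exact holderNorm_nonneg _ _
      · exact pow_le_one₀ hlam0.le hlam1.le
    have h3 : C * supNorm φ ≤ C * holderNorm ζ φ := by
      gcongr
      exact supNorm_le_holderNorm _ _
    linarith
  have hskψ : marginalDensity m ((fun t => t.map (skewProduct f G))^[k] s) =ᵐ[m] ψ :=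
    h.marginalDensity_iterate hs hsφ k
  -- On a null set ψ may exceed the essential bound b. Its truncation at b is another version, with
  -- no larger Hölder constant and with sup norm at most b, and it replaces ψ in the second
  -- application of the inequality.
  let χ : M → ℝ := fun x => max (-b) (min b (ψ x))
  have hχb : ∀ x, |χ x| ≤ b := fun x =>
    abs_le.2 ⟨le_max_left _ _, max_le (by linarith) (min_le_left _ _)⟩
  have hχH : ∀ x y, |χ x - χ y| ≤ nnHolderNorm ζ ψ * dist x y ^ (ζ : ℝ) := fun x y =>
    (abs_clamp_sub_clamp_le _ _ _).trans (hψ.abs_sub_le x y)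
  have hχ : MemHolder ζ χ := memHolder_of_abs_sub_le (NNReal.coe_nonneg _) hχH
  have hskχ : marginalDensity m ((fun t => t.map (skewProduct f G))^[k] s) =ᵐ[m] χ := by
    filter_upwards [hskψ, (leafBound_lInftyNorm h.ζ_pos hsk.2.1).abs_marginalDensity_le le_rfl]
      with x h1 h2
    rw [h1] at h2 ⊢
    have h3 := abs_le.1 h2
    simp only [χ]
    rw [min_eq_right h3.2, max_eq_right h3.1]
  have hχn : holderNorm ζ χ ≤ (B + C) * holderNorm ζ φ + b := by
    refine (holderNorm_le_add (NNReal.coe_nonneg _) hb hχH hχb).trans ?_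
    gcongr
    exact (nnHolderNorm_le_holderNorm ζ ψ).trans hψn
  have hfin := h.marginalDensity_iterate hsk hskχ j
  rw [← Function.iterate_add_apply] at hfin
  refine (aeHolderNorm_le (h.memHolder_iterate χ hχ j) hfin).trans ((hLY χ hχ j hj).trans ?_)
  have h1 : B * lam ^ j * holderNorm ζ χ ≤ B * lam ^ j * ((B + C) * holderNorm ζ φ + b) := by
    gcongr
  have h2 : C * supNorm χ ≤ C * b := by
    gcongr
    exact supNorm_le_of_abs_le hb hχb
  have h3 : B * lam ^ j * b ≤ B * 1 * b := by
    gcongr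
    exact pow_le_one₀ hlam0.le hlam1.le
  nlinarith [h1, h2, h3]

/-- Exponential decay on the zero-average space. -/
lemma exists_sInftyNorm_iterate_le (h : SkewSystem ζ f m ρ G α) {lam β : ℝ} (hlam0 : 0 < lam)
    (hlam1 : lam < 1) (hβ0 : 0 < β) (hβ1 : β < 1) (hLY : IsBaseLasotaYorkeRate ζ f ρ lam)
    (hE : IsEquilibriumRate (K := K) ζ m (skewProduct f G) β) :
    ∃ C, 0 < C ∧ ∀ s : SignedMeasure (M × K), MemSInfty ζ m s → s univ = 0 → ∀ n ≥ 1,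
      sInftyNorm ζ m ((fun t => t.map (skewProduct f G))^[n] s) ≤
        C * max (√lam) (√β) ^ n * sInftyNorm ζ m s := by
  obtain ⟨B, C, hB, hC, hLY⟩ := hLY
  obtain ⟨D, hE⟩ := hE
  set ξ := max (√lam) (√β)
  have hξ0 : 0 < ξ := lt_max_of_lt_left (Real.sqrt_pos.2 hlam0)
  have hξ1 : ξ < 1 := max_lt ((Real.sqrt_lt' one_pos).2 (by simpa using hlam1))
    ((Real.sqrt_lt' one_pos).2 (by simpa using hβ1))
  have hlamξ : lam ≤ ξ ^ 2 := by
    rw [← Real.sq_sqrt hlam0.le]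
    exact pow_le_pow_left₀ (Real.sqrt_nonneg _) (le_max_left _ _) 2
  have hβξ : β ≤ ξ ^ 2 := by
    rw [← Real.sq_sqrt hβ0.le]
    exact pow_le_pow_left₀ (Real.sqrt_nonneg _) (le_max_right _ _) 2
  have hβξ1 : β ≤ ξ := hβξ.trans (by nlinarith)
  have hEn : ∀ s : SignedMeasure (M × K), MemSInfty ζ m s → s univ = 0 → ∀ n ≥ 1,
      lInftyNorm ζ m ((fun t => t.map (skewProduct f G))^[n] s) ≤
        |D| * β ^ n * sInftyNorm ζ m s := fun s hs hs0 n hn =>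
    (hE s hs hs0 n hn).trans (by
      have := sInftyNorm_nonneg ζ m s
      gcongr
      exact le_abs_self D)
  refine ⟨B * (B + C) + (B + C) * |D| / ξ + (B + C) / ξ + |D|, by positivity,
    fun s hs hs0 n hn => ?_⟩
  have hN := sInftyNorm_nonneg ζ m s
  have hL : lInftyNorm ζ m ((fun t => t.map (skewProduct f G))^[n] s) ≤
      |D| * ξ ^ n * sInftyNorm ζ m s := (hEn s hs hs0 n hn).trans (by gcongr)
  have hA : aeHolderNorm ζ m (marginalDensity m ((fun t => t.map (skewProduct f G))^[n] s)) ≤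
      (B * (B + C) + (B + C) * |D| / ξ + (B + C) / ξ) * ξ ^ n * sInftyNorm ζ m s := by
    -- For n = 1 there is no splitting into two positive times; a single Lasota–Yorke step suffices.
    rcases hn.eq_or_lt with rfl | hn2
    · have h1 : aeHolderNorm ζ m (marginalDensity m ((fun t => t.map (skewProduct f G))^[1] s)) ≤
          (B + C) * aeHolderNorm ζ m (marginalDensity m s) + 0 := by
        refine le_mul_aeHolderNorm_add hs.2.2 (by positivity) fun φ hφ hsφ => ?_
        refine (aeHolderNorm_le (h.memHolder_iterate φ hφ 1)
          (h.marginalDensity_iterate hs hsφ 1)).trans ((hLY φ hφ 1 le_rfl).trans ?_)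
        have h2 : B * lam ^ 1 * holderNorm ζ φ ≤ B * 1 * holderNorm ζ φ := by
          gcongr
          · exact holderNorm_nonneg _ _
          · rw [pow_one]; exact hlam1.le
        have h3 : C * supNorm φ ≤ C * holderNorm ζ φ := by
          gcongr
          exact supNorm_le_holderNorm _ _
        linarith
      calc _ ≤ (B + C) * sInftyNorm ζ m s := by
            rw [add_zero] at h1
            refine h1.trans ?_
            gcongr
            exact aeHolderNorm_le_sInftyNorm _ _ _
        _ = ((B + C) / ξ) * ξ ^ 1 * sInftyNorm ζ m s := by field_simp
        _ ≤ _ := by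
          gcongr
          linarith [show 0 ≤ B * (B + C) + (B + C) * |D| / ξ by positivity]
    -- The time k = n / 2 is spent on the fibrewise norm and j = n - k on the Lasota–Yorke
    -- inequality. As lam and β are at most ξ², n ≤ 2j gives lam^j ≤ ξ^n, and n ≤ 2k + 1 gives β^k ≤
    -- ξ^n / ξ; the odd case explains the division by ξ.
    · obtain ⟨k, j, hk, hj, hjk, h2j, h2k⟩ : ∃ k j, 1 ≤ k ∧ 1 ≤ j ∧ n = j + k ∧ n ≤ 2 * j ∧
          n ≤ 2 * k + 1 := ⟨n / 2, n - n / 2, by omega, by omega, by omega, by omega, by omega⟩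
      have h1 := h.aeHolderNorm_iterate_le hs hlam0 hlam1 hB hC hLY hj hk
      rw [← hjk] at h1
      have hlj : lam ^ j ≤ ξ ^ n := by
        calc lam ^ j ≤ (ξ ^ 2) ^ j := pow_le_pow_left₀ hlam0.le hlamξ j
          _ = ξ ^ (2 * j) := (pow_mul _ _ _).symm
          _ ≤ ξ ^ n := pow_le_pow_of_le_one hξ0.le hξ1.le h2j
      have hβk : β ^ k ≤ ξ ^ n / ξ := by
        rw [le_div_iff₀ hξ0]
        calc β ^ k * ξ ≤ (ξ ^ 2) ^ k * ξ := by gcongr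
          _ = ξ ^ (2 * k + 1) := by rw [← pow_mul, pow_succ]
          _ ≤ ξ ^ n := pow_le_pow_of_le_one hξ0.le hξ1.le h2k
      calc _ ≤ B * (B + C) * ξ ^ n * sInftyNorm ζ m s +
            (B + C) * (|D| * (ξ ^ n / ξ) * sInftyNorm ζ m s) := by
            refine h1.trans ?_
            gcongr
            · exact aeHolderNorm_nonneg _ _ _
            · exact aeHolderNorm_le_sInftyNorm _ _ _
            · refine (hEn s hs hs0 k hk).trans ?_
              gcongr
        _ = (B * (B + C) + (B + C) * |D| / ξ) * ξ ^ n * sInftyNorm ζ m s := by ring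
        _ ≤ _ := by
          refine mul_le_mul_of_nonneg_right (mul_le_mul_of_nonneg_right ?_ (by positivity)) hN
          linarith [show 0 ≤ (B + C) / ξ by positivity]
  calc sInftyNorm ζ m ((fun t => t.map (skewProduct f G))^[n] s) ≤ _ := add_le_add hA hL
    _ = _ := by ring

/-- The push-forward by the skew product as a linear operator on `S^∞`. -/
def transfer (h : SkewSystem ζ f m ρ G α) : Module.End ℝ (SInfty (K := K) ζ m) where
  toFun μ := ⟨(μ : SignedMeasure (M × K)).map (skewProduct f G), h.memSInfty_map μ.2⟩
  map_add' _ _ := Subtype.ext <| VectorMeasure.map_add _ _ _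
  map_smul' c _ := Subtype.ext <| VectorMeasure.map_smul c

lemma coe_transfer_pow (h : SkewSystem ζ f m ρ G α) (n : ℕ) (μ : SInfty (K := K) ζ m) :
    ((h.transfer ^ n) μ : SignedMeasure (M × K)) =
      (fun t : SignedMeasure (M × K) => t.map (skewProduct f G))^[n] μ := by
  induction n with
  | zero => rfl
  | succ n ih =>
    rw [pow_succ', Function.iterate_succ_apply', ← ih]
    rfl

lemma transfer_apply_univ (h : SkewSystem ζ f m ρ G α) (μ : SInfty (K := K) ζ m) :
    (h.transfer μ : SignedMeasure (M × K)) univ = (μ : SignedMeasure (M × K)) univ := by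
  change (μ : SignedMeasure (M × K)).map (skewProduct f G) univ = _
  rw [VectorMeasure.map_apply _ (measurable_skewProduct h.measurePreserving.measurable
    h.measurable_fibreMap) MeasurableSet.univ, preimage_univ]

end SkewSystem

/-- The total mass, as a linear form on `S^∞`. -/
def totalMass (ζ : ℝ≥0) (m : Measure M) [IsFiniteMeasure m] : SInfty (K := K) ζ m →ₗ[ℝ] ℝ where
  toFun μ := (μ : SignedMeasure (M × K)) univ
  map_add' _ _ := rfl
  map_smul' _ _ := rfl

/-- The rank-one decomposition of an operator that preserves a linear form and fixes a vector
normalised by it. -/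
lemma exists_rank_one_decomposition {V : Type*} [AddCommMonoid V] [Module ℝ V]
    (T : Module.End ℝ V) (τ : V →ₗ[ℝ] ℝ) (v : V) (hτ : ∀ u, τ (T u) = τ u) (hv : T v = v)
    (hτv : τ v = 1) :
    ∃ P N : Module.End ℝ V, (∀ u, P u = τ u • v) ∧ P + N = T ∧ P * P = P ∧
      Module.finrank ℝ (LinearMap.range P) = 1 ∧ P * N = 0 ∧ N * P = 0 ∧
      ∀ n ≥ 1, ∀ u, (N ^ n) u = (T ^ n) (u + (-1 : ℝ) • P u) := by
  -- Subtraction comes from the scalar -1, which is why the statement writes u - Pu as u + (-1) • P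
  -- u.
  letI := Module.addCommMonoidToAddCommGroup ℝ (M := V)
  refine ⟨τ.smulRight v, T - τ.smulRight v, fun u => rfl, add_sub_cancel _ _, ?_, ?_, ?_, ?_, ?_⟩
  · ext u
    simp [hτv]
  · have hv0 : v ≠ 0 := by
      rintro rfl
      simp at hτv
    have : LinearMap.range (τ.smulRight v) = Submodule.span ℝ {v} := by
      ext w
      rw [LinearMap.mem_range, Submodule.mem_span_singleton]
      constructor
      · rintro ⟨u, rfl⟩
        exact ⟨τ u, rfl⟩
      · rintro ⟨c, rfl⟩
        exact ⟨c • v, by simp [hτv]⟩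
    rw [this, finrank_span_singleton hv0]
  · ext u
    simp [hτv, hτ]
  · ext u
    simp [hτv, hv]
  · intro n hn
    induction n, hn using Nat.le_induction with
    | base =>
      intro u
      simp [hv, sub_eq_add_neg]
    | succ n hn ih =>
      intro u
      -- The operator T preserves the form τ, so the iterates of u - Pu stay in its kernel, where N
      -- and T agree.
      have hmass : τ ((T ^ n) (u + (-1 : ℝ) • τ.smulRight v u)) = 0 := by
        have : ∀ k w, τ ((T ^ k) w) = τ w := by
          intro k
          induction k with
          | zero => simp
          | succ k ihk => intro w; rw [pow_succ', Module.End.mul_apply, hτ, ihk]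
        rw [this]
        simp [hτv]
      rw [pow_succ', Module.End.mul_apply, ih u, LinearMap.sub_apply,
        LinearMap.smulRight_apply (c := (T ^ n) _), hmass, zero_smul, sub_zero, pow_succ',
        Module.End.mul_apply]

end SpectralGap

end

/-! ### The spectral gap theorem -/

theorem theoremB {d : ℕ} {M K : Type*}
    -- `M` is a compact connected smooth Riemannian manifold with its Riemannian distance
    [MetricSpace M] [ChartedSpace (EuclideanSpace ℝ (Fin d)) M]
    [IsManifold 𝓘(ℝ, EuclideanSpace ℝ (Fin d)) ∞ M]
    [RiemannianBundle (fun x : M => TangentSpace 𝓘(ℝ, EuclideanSpace ℝ (Fin d)) x)]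
    [IsContMDiffRiemannianBundle 𝓘(ℝ, EuclideanSpace ℝ (Fin d)) ∞ (EuclideanSpace ℝ (Fin d))
      (fun x : M => TangentSpace 𝓘(ℝ, EuclideanSpace ℝ (Fin d)) x)]
    [IsRiemannianManifold 𝓘(ℝ, EuclideanSpace ℝ (Fin d)) M]
    [CompactSpace M] [ConnectedSpace M] [MeasurableSpace M] [BorelSpace M]
    -- `K` is a compact metric space
    [MetricSpace K] [CompactSpace K] [Nonempty K] [MeasurableSpace K] [BorelSpace K]
    (ζ : ℝ≥0) (hζ0 : 0 < ζ) (hζ1 : ζ ≤ 1)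
    -- the base map, its invariant measure, and `ρ = 1 / Jacobian`
    (f : M → M)
    (hf : IsLocalDiffeomorph 𝓘(ℝ, EuclideanSpace ℝ (Fin d)) 𝓘(ℝ, EuclideanSpace ℝ (Fin d)) 1 f)
    (m₁ : Measure M) [IsProbabilityMeasure m₁] (hinv : MeasurePreserving f m₁ m₁)
    (ρ : M → ℝ) (hρ : ∀ x, 0 < ρ x) (hjac : HasJacobian f m₁ fun x => 1 / ρ x)
    -- the hypotheses on `f`
    (Lf : M → ℝ) (hLc : Continuous Lf) (hLf : LocalInverseLipschitz f Lf)
    (A : Set M) (hA : IsOpen A) (σ L ε : ℝ) (q : ℕ) (hσ : 1 < σ) (hL1 : 1 ≤ L) (hL2 : L ≤ 2)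
    (hε : 0 < ε) (hf1 : CondF1 Lf A σ L) (hf2 : CondF2 f A q) (hf3 : CondF3 ζ ρ ε)
    (hsmall : SmallnessCond ζ (mapDegree f) q σ L ε)
    -- the hypotheses on the fibre maps
    (G : M × K → K) (hG : Measurable G) (α : ℝ) (hα0 : 0 < α) (hα1 : α < 1)
    (hG1 : ∀ᵐ x ∂m₁, ∀ z₁ z₂ : K, dist (G (x, z₁)) (G (x, z₂)) ≤ α * dist z₁ z₂) :
    ∃ P N : Module.End ℝ (SInfty (K := K) ζ m₁),
      -- `F_*` maps `S^∞` to itself and equals `P + N`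
      (∀ μ : SInfty (K := K) ζ m₁,
        VectorMeasure.map (μ : SignedMeasure (M × K)) (skewProduct f G) = ((P + N) μ : _)) ∧
      -- a) `P` is a (bounded) projection of rank one
      P * P = P ∧ Module.finrank ℝ (LinearMap.range P) = 1 ∧
      (∃ C : ℝ, ∀ μ, sInftyNorm ζ m₁ (P μ : SignedMeasure (M × K)) ≤
        C * sInftyNorm ζ m₁ (μ : SignedMeasure (M × K))) ∧
      -- b) exponential decay of the powers of `N`
      (∃ ξ C : ℝ, 0 < ξ ∧ ξ < 1 ∧ 0 < C ∧ ∀ (n : ℕ) (μ : SInfty (K := K) ζ m₁),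
        sInftyNorm ζ m₁ ((N ^ n) μ : SignedMeasure (M × K)) ≤
          sInftyNorm ζ m₁ (μ : SignedMeasure (M × K)) * ξ ^ n * C) ∧
      -- c)
      P * N = 0 ∧ N * P = 0 ∧
      -- the explicit rate: there are base Lasota–Yorke and base decay rates, a base decay rate
      -- gives a rate of convergence to equilibrium, and `ξ = max {√lam, √β₁}` is admissible in b)
      (∃ lam : ℝ, 0 < lam ∧ lam < 1 ∧ IsBaseLasotaYorkeRate ζ f ρ lam) ∧
      (∃ r : ℝ, 0 < r ∧ r < 1 ∧ IsBaseDecayRate ζ m₁ f ρ r) ∧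
      (∀ r : ℝ, 0 < r → r < 1 → IsBaseDecayRate ζ m₁ f ρ r →
        IsEquilibriumRate (K := K) ζ m₁ (skewProduct f G) (max (√r) (√(α ^ (ζ : ℝ))))) ∧
      (∀ lam β₁ : ℝ, 0 < lam → lam < 1 → 0 < β₁ → β₁ < 1 →
        IsBaseLasotaYorkeRate ζ f ρ lam →
        IsEquilibriumRate (K := K) ζ m₁ (skewProduct f G) β₁ →
        ∃ C : ℝ, 0 < C ∧ ∀ (n : ℕ) (μ : SInfty (K := K) ζ m₁),
          sInftyNorm ζ m₁ ((N ^ n) μ : SignedMeasure (M × K)) ≤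
            sInftyNorm ζ m₁ (μ : SignedMeasure (M × K)) * (max (√lam) (√β₁)) ^ n * C) := by

  have hfh : IsLocalHomeomorph f := hf.isLocalHomeomorph
  have hgeo : ∀ (x y : M) (a : ℝ), 0 ≤ a → a ≤ 1 →
      ∃ z, dist x z ≤ a * dist x y ∧ dist z y ≤ (1 - a) * dist x y :=
    fun x y a ha0 ha1 => exists_dist_le_split (d := d) x y ha0 ha1
  obtain ⟨δ, θ, κ, c, C₀, C₁, hT⟩ := exists_transferSystem hζ0 hζ1 hgeo hfh hinv hρ hjac hLf hσ hL1
    hL2 hε hf1 hf2 hf3 hsmall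
  have hρm : Measurable ρ := (hf3.2.1.continuous hζ0).measurable
  obtain ⟨CL, hCL, hLYall⟩ := hT.exists_lasotaYorke hζ0 hζ1
  have hp : HasInjectivityPartition f := hf2.hasInjectivityPartition
  have hS : SkewSystem ζ f m₁ ρ G α :=
    { ζ_pos := hζ0
      measurePreserving := hinv
      hasJacobian := hjac
      weight_pos := hρ
      measurable_weight := hρm
      partition := hp
      finite_fibre := hT.finite_fibre
      measurable_fibreMap := hG
      α_pos := hα0
      α_lt_one := hα1
      contracting := hG1
      memHolder_iterate := fun φ hφ n => (hLYall φ hφ n).1 }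
  have hLY : IsBaseLasotaYorkeRate ζ f ρ θ := ⟨1, CL, one_pos, hCL, fun g hg n _ => by
    simpa using (hLYall g hg n).2⟩
  obtain ⟨r, hr0, hr1, hr⟩ := hT.exists_isBaseDecayRate hζ0 hζ1 m₁ Measure.support_mem_ae
    fun φ hφ => integral_perronFrobenius hinv.measurable hjac hρ hρm hp hT.finite_fibre
      hφ.measurable (hφ.integrable_of_hasCompactSupport (HasCompactSupport.of_compactSpace φ))
  have hER : ∀ r : ℝ, 0 < r → r < 1 → IsBaseDecayRate ζ m₁ f ρ r →
      IsEquilibriumRate (K := K) ζ m₁ (skewProduct f G) (max (√r) (√(α ^ (ζ : ℝ)))) :=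
    fun r hr0 hr1 hr => hS.isEquilibriumRate hr0 hr1 hr
  obtain ⟨ν, hνp, hνm, hνF⟩ := exists_invariant_measure hinv hG hα0.le hα1 hG1
  let μ₀ : SInfty (K := K) ζ m₁ := ⟨ν.toSignedMeasure, memSInfty_toSignedMeasure hζ0 hνm⟩
  have hFm := measurable_skewProduct hinv.measurable hG
  have hμ₀F : hS.transfer μ₀ = μ₀ := by
    refine Subtype.ext (VectorMeasure.ext fun i hi => ?_)
    change ν.toSignedMeasure.map (skewProduct f G) i = ν.toSignedMeasure i
    rw [VectorMeasure.map_apply _ hFm hi, Measure.toSignedMeasure_apply_measurable (hFm hi),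
      Measure.toSignedMeasure_apply_measurable hi]
    conv_rhs => rw [← hνF, map_measureReal_apply hFm hi]
  have hμ₀1 : totalMass ζ m₁ μ₀ = 1 := by
    change ν.toSignedMeasure univ = 1
    rw [Measure.toSignedMeasure_apply_measurable MeasurableSet.univ]
    simp
  obtain ⟨P, N, hP, hPN_add, hPP, hrank, hPN, hNP, hpow⟩ := exists_rank_one_decomposition
    hS.transfer (totalMass ζ m₁) μ₀ hS.transfer_apply_univ hμ₀F hμ₀1
  have hPb : ∀ μ, sInftyNorm ζ m₁ (P μ : SignedMeasure (M × K)) ≤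
      sInftyNorm ζ m₁ (μ₀ : SignedMeasure (M × K)) *
        sInftyNorm ζ m₁ (μ : SignedMeasure (M × K)) := by
    intro μ
    rw [hP]
    refine (sInftyNorm_smul_le hζ0 μ₀.2 (totalMass ζ m₁ μ)).trans ?_
    rw [mul_comm]
    exact mul_le_mul_of_nonneg_left (abs_apply_univ_le hζ0 μ.2) (sInftyNorm_nonneg _ _ _)
  have hrate : ∀ lam β₁ : ℝ, 0 < lam → lam < 1 → 0 < β₁ → β₁ < 1 →
      IsBaseLasotaYorkeRate ζ f ρ lam →
      IsEquilibriumRate (K := K) ζ m₁ (skewProduct f G) β₁ →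
      ∃ C : ℝ, 0 < C ∧ ∀ (n : ℕ) (μ : SInfty (K := K) ζ m₁),
        sInftyNorm ζ m₁ ((N ^ n) μ : SignedMeasure (M × K)) ≤
          sInftyNorm ζ m₁ (μ : SignedMeasure (M × K)) * (max (√lam) (√β₁)) ^ n * C := by
    intro lam β₁ hlam0 hlam1 hβ0 hβ1 hly he
    obtain ⟨C, hC, hdecay⟩ := hS.exists_sInftyNorm_iterate_le hlam0 hlam1 hβ0 hβ1 hly he
    set A₀ := sInftyNorm ζ m₁ (μ₀ : SignedMeasure (M × K))
    have hA₀ : 0 ≤ A₀ := sInftyNorm_nonneg _ _ _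
    -- The factor 1 + A₀ bounds the passage from μ to μ - Pμ; the summand 1 covers n = 0, for which
    -- the formula for N^n is not available.
    refine ⟨C * (1 + A₀) + 1, by positivity, fun n μ => ?_⟩
    have hN := sInftyNorm_nonneg ζ m₁ (μ : SignedMeasure (M × K))
    set ξ := max (√lam) (√β₁)
    have hξ : 0 ≤ ξ := le_max_of_le_left (Real.sqrt_nonneg _)
    rcases Nat.eq_zero_or_pos n with rfl | hn
    · rw [pow_zero, pow_zero, Module.End.one_apply, mul_one]
      exact le_mul_of_one_le_right hN (by linarith [show 0 ≤ C * (1 + A₀) by positivity])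
    · rw [hpow n hn, hS.coe_transfer_pow]
      have hmass : ((μ + (-1 : ℝ) • P μ : SInfty (K := K) ζ m₁) :
          SignedMeasure (M × K)) univ = 0 := by
        change totalMass ζ m₁ (μ + (-1 : ℝ) • P μ) = 0
        rw [map_add, map_smul, hP, map_smul, hμ₀1]
        simp
      refine (hdecay _ (μ + (-1 : ℝ) • P μ).2 hmass n hn).trans ?_
      have hnorm : sInftyNorm ζ m₁ ((μ + (-1 : ℝ) • P μ : SInfty (K := K) ζ m₁) :
          SignedMeasure (M × K)) ≤ (1 + A₀) * sInftyNorm ζ m₁ (μ : SignedMeasure (M × K)) := by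
        have h1 := sInftyNorm_add_le hζ0 μ.2 ((-1 : ℝ) • P μ).2
        have h2 := sInftyNorm_smul_le hζ0 (P μ).2 (-1)
        rw [abs_neg, abs_one, one_mul] at h2
        have h3 := h2.trans (hPb μ)
        refine h1.trans ?_
        change _ + sInftyNorm ζ m₁ ((-1 : ℝ) • (P μ : SignedMeasure (M × K))) ≤ _
        linarith
      calc _ ≤ C * ξ ^ n * ((1 + A₀) * sInftyNorm ζ m₁ (μ : SignedMeasure (M × K))) := by gcongr
        _ = sInftyNorm ζ m₁ (μ : SignedMeasure (M × K)) * ξ ^ n * (C * (1 + A₀)) := by ring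
        _ ≤ _ := by gcongr; linarith
  have hαζ0 : 0 < α ^ (ζ : ℝ) := Real.rpow_pos_of_pos hα0 _
  have hαζ1 : α ^ (ζ : ℝ) < 1 := Real.rpow_lt_one hα0.le hα1 hζ0
  have hsq : ∀ t : ℝ, t < 1 → √t < 1 := fun t ht => (Real.sqrt_lt' one_pos).2 (by simpa using ht)
  have hβ0 : 0 < max (√r) (√(α ^ (ζ : ℝ))) := lt_max_of_lt_left (Real.sqrt_pos.2 hr0)
  have hβ1 : max (√r) (√(α ^ (ζ : ℝ))) < 1 := max_lt (hsq _ hr1) (hsq _ hαζ1)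
  obtain ⟨C, hC, hCb⟩ := hrate θ _ hT.θ_pos hT.θ_lt_one hβ0 hβ1 hLY (hER r hr0 hr1 hr)
  refine ⟨P, N, fun μ => ?_, hPP, hrank, ⟨_, hPb⟩, ⟨_, C, ?_, ?_, hC, hCb⟩, hPN, hNP,
    ⟨θ, hT.θ_pos, hT.θ_lt_one, hLY⟩, ⟨r, hr0, hr1, hr⟩, hER, hrate⟩
  · rw [hPN_add]
    rfl
  · exact lt_max_of_lt_left (Real.sqrt_pos.2 hT.θ_pos)
  · exact max_lt (hsq _ hT.θ_lt_one) (hsq _ hβ1)
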